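/- All objects are $C^\infty$. For a Poisson structure $P$ near a point $p\in\mathbb R^3$ with $P(p)=0$ we say, in terms of suitable local coordinates $x,y,z$ centred at $p$, that $p$ is * a $V$ singularity if the 1-jet of $P$ is $\{x,y\}=0,\ \{y,z\}=y,\ \{z,x\}=-x$, or is $\{x,y\}=z,\ \{y,z\}=f_x+zg_x,\ \{z,x\}=f_y+zg_y$ with a quadratic form $f(x,y)$ and a nonzero linear form $g(x,y)$; * an $so(3)$ (resp. $sl(2)$) singularity if the 1-jet is $\{x,y\}=z,\ \{y,z\}=f_x,\ \{z,x\}=f_y$ with a quadratic form $f(x,y)$ linearly equivalent to $x^2+y^2$ (resp. to $x^2-y^2$ or $-x^2-y^2$); * an $N^{+}$ (resp. $N^-$) singularity if the 2-jet is $\{x,y\}=z,\ \{y,z\}=f_x+zg_x,\ \{z,x\}=f_y+zg_y$ with a cubic form $f(x,y)$ and a quadratic form $g(x,y)$ linearly equivalent to $x^2+y^2$ (resp. $x^2-y^2$). At a $V$ singularity the 1-jet of $P$ is, in suitable coordinates, $\partial_y\wedge v$ with a linear vector field $v$ on the $(x,z)$-plane. The singularity is a node if the eigenvalues of $v$ are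 real, nonzero and of the same sign, a saddle if they are real, nonzero and of opposite signs, and a focus if they are $a\pm ib$ with $a,b\neq0$. **Theorem 4.2.** Let $P_\epsilon$ be a smooth 1-parameter local family of Poisson structures near $0\in\mathbb R^3$ such that $P_0$ has an $N^{+}$ or an $N^-$ singularity at the origin; upper signs refer to $N^+$, lower signs to $N^-$. Then in suitable local coordinates depending smoothly on $\epsilon$ (and centred at the origin for $\epsilon=0$) $P_\epsilon$ has the form $$\{x,y\}=z,\quad \{y,z\}=A_\epsilon(x,y)\,(z+C_\epsilon(x,y))+z^2Q_{1,\epsilon},\quad \{z,x\}=B_\epsilon(x,y)\,(z+C_\epsilon(x,y))+z^2Q_{2,\epsilon},$$ $$A_\epsilon=\lambda_0(\epsilon)x+o(|(x,y)|),\quad B_\epsilon=\pm\lambda_0(\epsilon)y+o(|(x,y)|),\quad C_\epsilon=\mu_0(\epsilon)+\mu_1(\epsilon)(x^2\pm y^2)+o(|(x,y)|^2),$$ with $\lambda_0(0)\ne0$, $\mu_0(0)=0$. Take any such form, assume that it is generic, i.e. $\mu_1(0)\neq0$ and $\mu_0'(0)\mu_1(0)\ne0$, and put $\kappa_1=\lambda_0(0)\mu_1(0)$,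 $\kappa_2=\lambda_0(0)^2-8\kappa_1$. Then there are a local coordinate system $\tilde x_\epsilon,\tilde y_\epsilon,\tilde z_\epsilon$ depending smoothly on $\epsilon$ (centred at the origin for $\epsilon=0$) and a smooth function $Q$ with $Q(0)\ne0$ such that, with $\tilde\epsilon=\epsilon Q(\epsilon)$, the following holds for all $\epsilon$ near $0$ and all points near the origin. 1. The set of singular points of $P_\epsilon$ is $\{\tilde z=0,\ \tilde x^2\pm\tilde y^2-\tilde\epsilon=0\}\cup\{\tilde x=\tilde y=\tilde z=0\}$. 2. Every singular point other than $\tilde x=\tilde y=\tilde z=0$ is a $V$ singularity. It is a node if $\kappa_2>0$ and $\kappa_1>0$, a saddle if $\kappa_2\ge0$ and $\kappa_1<0$, a focus if $\kappa_2<0$, and either a node or a focus if $\kappa_2=0$. 3. In the $N^+$ case with $\kappa_1>0$, the point $\tilde x=\tilde y=\tilde z=0$ is an $so(3)$ singularity of $P_\epsilon$ if $\tilde\epsilon<0$ and an $sl(2)$ singularity if $\tilde\epsilon>0$. If $\kappa_1<0$, it is an $sl(2)$ singularity if $\tilde\epsilon<0$ and an $so(3)$ singularity if $\tilde\epsilon>0$.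 4. In the $N^-$ case the point $\tilde x=\tilde y=\tilde z=0$ is an $sl(2)$ singularity of $P_\epsilon$ for every $\epsilon\neq0$. -/

import Mathlib

open Topology Filter Asymptotics
open scoped ContDiff

noncomputable section

namespace PoissonBif

/-- The space `ℝ³` with coordinates `x = v 0`, `y = v 1`, `z = v 2`. -/
abbrev R3 := Fin 3 → ℝ

/-- The components `{x_i, x_j}` of a 2-vector at a point of `ℝ³`. -/
abbrev Bivec := Fin 3 → Fin 3 → ℝ

/-- The 2-vector with `{x,y} = u`, `{y,z} = v`, `{z,x} = w`. -/
def bivec (u v w : ℝ) : Bivec :=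
  ![![0, u, -w], ![-u, 0, v], ![w, -v, 0]]

/-- `f` is of class `C^∞` on some neighbourhood of `a`. -/
def SmoothNear {E F : Type*} [NormedAddCommGroup E] [NormedSpace ℝ E]
    [NormedAddCommGroup F] [NormedSpace ℝ F] (f : E → F) (a : E) : Prop :=
  ∀ᶠ x in 𝓝 a, ContDiffAt ℝ ∞ f x

/-- The bracket `{f, g} = π(df, dg)`. -/
def bracket (π : R3 → Bivec) (f g : R3 → ℝ) : R3 → ℝ := fun p =>
  ∑ i, ∑ j, π p i j * fderiv ℝ f p (Pi.single i 1) * fderiv ℝ g p (Pi.single j 1)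

/-- `P ε` is a local family of Poisson structures near `0 ∈ ℝ³`, for `ε` near `0`, depending
smoothly on `ε`: on a neighbourhood of `(0, 0)` the 2-vector is smooth in `(ε, p)`,
antisymmetric, and its bracket satisfies the Jacobi identity. -/
structure IsLocalPoissonFamily (P : ℝ → R3 → Bivec) : Prop where
  smooth : SmoothNear (fun q : ℝ × R3 => P q.1 q.2) (0, 0)
  antisymm : ∀ᶠ q : ℝ × R3 in 𝓝 (0, 0), ∀ i j, P q.1 q.2 i j = -P q.1 q.2 j i
  jacobi : ∀ᶠ q : ℝ × R3 in 𝓝 (0, 0), ∀ f g h : R3 → ℝ,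
    ContDiff ℝ ∞ f → ContDiff ℝ ∞ g → ContDiff ℝ ∞ h →
      bracket (P q.1) f (bracket (P q.1) g h) q.2
        + bracket (P q.1) g (bracket (P q.1) h f) q.2
        + bracket (P q.1) h (bracket (P q.1) f g) q.2 = 0

/-- `φ` is a smooth local coordinate system centred at `p`. -/
structure IsLocalChart (φ : R3 → R3) (p : R3) : Prop where
  smooth : SmoothNear φ p
  center : φ p = 0
  det_ne : (fderiv ℝ φ p).det ≠ 0

/-- `Φ ε` is a local coordinate system near `0 ∈ ℝ³` depending smoothly on `ε` near `0`,
with `Φ 0 0 = 0`; for `ε ≠ 0` it need not be centred at `0`. -/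
structure IsLocalChartFamily (Φ : ℝ → R3 → R3) : Prop where
  smooth : SmoothNear (fun q : ℝ × R3 => Φ q.1 q.2) (0, 0)
  center : Φ 0 0 = 0
  det_ne : (fderiv ℝ (Φ 0) 0).det ≠ 0

/-- The mutual brackets at `p` of the coordinate functions of `φ`. If they equal `π' (φ p)` for
all `p`, then `π' = φ_* π`. -/
def inCoords (π : R3 → Bivec) (φ : R3 → R3) (p : R3) : Bivec := fun i j =>
  bracket π (fun x => φ x i) (fun x => φ x j) p

/-- In suitable local coordinates centred at `p`, the `k`-jet of `π` is the one of `model`. -/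
def JetEquiv (k : ℕ) (π : R3 → Bivec) (p : R3) (model : R3 → Bivec) : Prop :=
  ∃ φ : R3 → R3, IsLocalChart φ p ∧
    (fun x => inCoords π φ x - model (φ x)) =o[𝓝 p] fun x => ‖x - p‖ ^ k

/-- `{x,y} = z`, `{y,z} = ∂f/∂x + z ∂g/∂x`, `{z,x} = ∂f/∂y + z ∂g/∂y`, where `f` and `g` are
polynomials in `x` and `y`. -/
def normalBivec (f g : MvPolynomial (Fin 2) ℝ) (v : R3) : Bivec :=
  bivec (v 2)
    (MvPolynomial.eval ![v 0, v 1] (MvPolynomial.pderiv 0 f)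
      + v 2 * MvPolynomial.eval ![v 0, v 1] (MvPolynomial.pderiv 0 g))
    (MvPolynomial.eval ![v 0, v 1] (MvPolynomial.pderiv 1 f)
      + v 2 * MvPolynomial.eval ![v 0, v 1] (MvPolynomial.pderiv 1 g))

/-- The quadratic form `f` becomes `a x² + b y²` after a linear change of the variables `x, y`. -/
def REquivDiag (f : MvPolynomial (Fin 2) ℝ) (a b : ℝ) : Prop :=
  ∃ S : Matrix (Fin 2) (Fin 2) ℝ, S.det ≠ 0 ∧
    ∀ v : Fin 2 → ℝ, MvPolynomial.eval (S.mulVec v) f = a * v 0 ^ 2 + b * v 1 ^ 2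

/-- `V` singularity at `p`: the 1-jet is isomorphic to `{x,y} = 0, {y,z} = y, {z,x} = -x`, or
in the normal form the 1-jet of `g` does not vanish. -/
def IsV (π : R3 → Bivec) (p : R3) : Prop :=
  JetEquiv 1 π p (fun v => bivec 0 (v 1) (-v 0)) ∨
    ∃ f g : MvPolynomial (Fin 2) ℝ, f.IsHomogeneous 2 ∧ g.IsHomogeneous 1 ∧ g ≠ 0 ∧
      JetEquiv 1 π p (normalBivec f g)

/-- `so(3)` singularity at `p`: in the normal form the 2-jet of `f` is equivalent to
`x² + y²` (and the 1-jet of `g` vanishes). -/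
def IsSO3 (π : R3 → Bivec) (p : R3) : Prop :=
  ∃ f : MvPolynomial (Fin 2) ℝ, f.IsHomogeneous 2 ∧ REquivDiag f 1 1 ∧
    JetEquiv 1 π p (normalBivec f 0)

/-- `sl(2)` singularity at `p`: in the normal form the 2-jet of `f` is equivalent to
`x² - y²` or to `-x² - y²` (and the 1-jet of `g` vanishes). -/
def IsSL2 (π : R3 → Bivec) (p : R3) : Prop :=
  ∃ f : MvPolynomial (Fin 2) ℝ, f.IsHomogeneous 2 ∧
    (REquivDiag f 1 (-1) ∨ REquivDiag f (-1) (-1)) ∧ JetEquiv 1 π p (normalBivec f 0)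

/-- `N⁺` (for `σ = 1`) or `N⁻` (for `σ = -1`) singularity at `p`: in the normal form the 2-jet
of `f` and the 1-jet of `g` vanish and the 2-jet of `g` is equivalent to `x² + σ y²`. -/
def IsN (σ : ℝ) (π : R3 → Bivec) (p : R3) : Prop :=
  ∃ f g : MvPolynomial (Fin 2) ℝ, f.IsHomogeneous 3 ∧ g.IsHomogeneous 2 ∧ REquivDiag g 1 σ ∧
    JetEquiv 2 π p (normalBivec f g)

/-- The 2-vector `∂/∂y ∧ v`, where `v` is the linear vector field on the `(x,z)`-plane with
matrix `M`. -/
def wedgeBivec (M : Matrix (Fin 2) (Fin 2) ℝ) (v : R3) : Bivec :=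
  bivec (-(M 0 0 * v 0 + M 0 1 * v 2)) (M 1 0 * v 0 + M 1 1 * v 2) 0

/-- `l₁, l₂` are eigenvalues of `π` at `p`: in suitable coordinates the 1-jet of `π` is
`∂/∂y ∧ v` with a linear vector field `v` on the `(x,z)`-plane that has the eigenvalues `l₁, l₂`
(with multiplicity). They are determined up to order and a common real factor at `V`
singularities. -/
def HasEigenvalues (π : R3 → Bivec) (p : R3) (l₁ l₂ : ℂ) : Prop :=
  ∃ M : Matrix (Fin 2) (Fin 2) ℝ, JetEquiv 1 π p (wedgeBivec M) ∧
    (M.map (algebraMap ℝ ℂ)).charpoly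
      = (Polynomial.X - Polynomial.C l₁) * (Polynomial.X - Polynomial.C l₂)

/-- Node `V` singularity: real nonzero eigenvalues of the same sign. -/
def IsNodeV (π : R3 → Bivec) (p : R3) : Prop :=
  IsV π p ∧ ∃ l₁ l₂ : ℝ, 0 < l₁ * l₂ ∧ HasEigenvalues π p l₁ l₂

/-- Saddle `V` singularity: real nonzero eigenvalues of different signs. -/
def IsSaddleV (π : R3 → Bivec) (p : R3) : Prop :=
  IsV π p ∧ ∃ l₁ l₂ : ℝ, l₁ * l₂ < 0 ∧ HasEigenvalues π p l₁ l₂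

/-- Focus `V` singularity: eigenvalues `a ± ib` with `a ≠ 0`, `b ≠ 0`. -/
def IsFocusV (π : R3 → Bivec) (p : R3) : Prop :=
  IsV π p ∧ ∃ a b : ℝ, a ≠ 0 ∧ b ≠ 0 ∧
    HasEigenvalues π p (a + b * Complex.I) (a - b * Complex.I)

/-- A reduction, by a smooth family of coordinate changes `Φ`, of the family `P` to the form
`{x,y} = z`, `{y,z} = A(x,y) (z + C(x,y)) + z² Q₁`, `{z,x} = B(x,y) (z + C(x,y)) + z² Q₂`
(everything depending smoothly on `ε`), with Taylor expansions at the origin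
`A = l₀(ε) x + …`, `B = σ l₀(ε) y + …`, `C = m₀(ε) + m₁(ε) (x² + σ y²) + …`,
where `l₀(0) ≠ 0` and `m₀(0) = 0`. Nothing is required of the terms of higher order; in
particular the reductions in which `A`, `B`, `C` have the Taylor series
`x (l₀ + l₁ ρ + …)`, `σ y (l₀ + l₁ ρ + …)`, `m₀ + m₁ ρ + m₂ ρ² + …` with `ρ = x² + σ y²`
are included. -/
structure NormalForm (σ : ℝ) (P : ℝ → R3 → Bivec) where
  Φ : ℝ → R3 → R3
  A : ℝ → ℝ × ℝ → ℝ
  B : ℝ → ℝ × ℝ → ℝ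
  C : ℝ → ℝ × ℝ → ℝ
  Q₁ : ℝ → R3 → ℝ
  Q₂ : ℝ → R3 → ℝ
  l₀ : ℝ → ℝ
  m₀ : ℝ → ℝ
  m₁ : ℝ → ℝ
  chart : IsLocalChartFamily Φ
  smooth_A : SmoothNear (fun q : ℝ × (ℝ × ℝ) => A q.1 q.2) (0, 0)
  smooth_B : SmoothNear (fun q : ℝ × (ℝ × ℝ) => B q.1 q.2) (0, 0)
  smooth_C : SmoothNear (fun q : ℝ × (ℝ × ℝ) => C q.1 q.2) (0, 0)
  smooth_Q₁ : SmoothNear (fun q : ℝ × R3 => Q₁ q.1 q.2) (0, 0)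
  smooth_Q₂ : SmoothNear (fun q : ℝ × R3 => Q₂ q.1 q.2) (0, 0)
  smooth_l₀ : SmoothNear l₀ 0
  smooth_m₀ : SmoothNear m₀ 0
  smooth_m₁ : SmoothNear m₁ 0
  reduces : ∀ᶠ q : ℝ × R3 in 𝓝 (0, 0), ∀ x y z : ℝ, Φ q.1 q.2 = ![x, y, z] →
    inCoords (P q.1) (Φ q.1) q.2
      = bivec z (A q.1 (x, y) * (z + C q.1 (x, y)) + z ^ 2 * Q₁ q.1 ![x, y, z])
          (B q.1 (x, y) * (z + C q.1 (x, y)) + z ^ 2 * Q₂ q.1 ![x, y, z])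
  expand_A : ∀ᶠ ε in 𝓝 (0 : ℝ),
    (fun v : ℝ × ℝ => A ε v - l₀ ε * v.1) =o[𝓝 0] fun v => ‖v‖
  expand_B : ∀ᶠ ε in 𝓝 (0 : ℝ),
    (fun v : ℝ × ℝ => B ε v - σ * l₀ ε * v.2) =o[𝓝 0] fun v => ‖v‖
  expand_C : ∀ᶠ ε in 𝓝 (0 : ℝ),
    (fun v : ℝ × ℝ => C ε v - (m₀ ε + m₁ ε * (v.1 ^ 2 + σ * v.2 ^ 2))) =o[𝓝 0]
      fun v => ‖v‖ ^ 2
  l₀_ne : l₀ 0 ≠ 0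
  m₀_zero : m₀ 0 = 0

namespace NormalForm

variable {σ : ℝ} {P : ℝ → R3 → Bivec}

/-- The `N^±` singularity of `P 0` is generic. -/
def GenericSingularity (D : NormalForm σ P) : Prop := D.m₁ 0 ≠ 0

/-- The unfolding `P` is generic. -/
def GenericUnfolding (D : NormalForm σ P) : Prop := deriv D.m₀ 0 * D.m₁ 0 ≠ 0

def κ₁ (D : NormalForm σ P) : ℝ := D.l₀ 0 * D.m₁ 0

def κ₂ (D : NormalForm σ P) : ℝ := D.l₀ 0 ^ 2 - 8 * D.κ₁

end NormalForm

end PoissonBif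

end

/-!
If `p` is an `N` singularity, the functions `x`, `y` and `z = {x, y}` are coordinates for every
`ε`, so the family is given by two functions: `{x,y} = z`, `{y,z} = F`, `{z,x} = G`. On `z = 0` the
Jacobi identity says that `(F, G)` is parallel to `(A, B) = (F_z, G_z)`. The derivative of `(A, B)`
at the singular point is the Hessian of the nondegenerate form `g`, so `(A, B)` can be used as
coordinates in the plane and one can divide: `F = A (z + C) + z² Q₁`, `G = B (z + C) + z² Q₂`
(`exists_smooth_quotient`, `exists_reduction`). The next coefficients of the Jacobi identity give
`dC + C D = h (A dx + B dy)` with a form `D` built from `Q₁, Q₂, C` and a smooth function `h`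
(`Reduction.exists_dC_eq`); both halves of the theorem rest on this identity.

For the normal form, note that a change of `x, y` with Jacobian determinant `J`, combined with
`z ↦ J z`, keeps the reduced form and multiplies `C` and `A dx + B dy` by `J`
(`Reduction.exists_change`). At a zero of `(A, B)` the Jacobi identity makes the derivative of
`(A, B)` symmetric; one moves this zero to the origin and diagonalizes the derivative smoothly in
`ε` (`Reduction.exists_diagonal`). Then one takes for `J` the 2-jet of `exp (l + q)`, where `l` and
`q` are the linear and the quadratic form whose derivatives match the value and the symmetric part
of the derivative of `D` at the origin. In `d(J C) = J h (A dx + B dy) + C (dJ - J D)` the last term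
then vanishes at the origin and has an antisymmetric derivative there; hence it does not affect the
2-jet of `J C`, and the new `C` is `μ₀ + μ₁ (x² ± y²)` up to higher order
(`Reduction.nonempty_normalForm`).

For the bifurcation, the singular points of a reduced form are given by `z = 0` and either `C = 0`
or `A = B = 0`, and the latter only holds at the origin. The Morse lemma with parameters
(`exists_morse_coordinates`) turns `C` into `μ₀(ε) + μ₁(0) (x² ± y²)`, so that `C = 0` is the conic
`x² ± y² = ε'` with `ε' = -μ₀(ε) / μ₁(0)`.
At a point with `C = 0` and `(A, B) = (A₀, B₀) ≠ 0` the identity above gives `dC = h (A dx + B dy)`,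
and with `u = A₀ x + B₀ y` and a dual coordinate `s` the linear part becomes `{u,s} = z`,
`{s,z} = h u + z`, `{z,u} = 0`. This is a `V` singularity whose eigenvalues are the roots of
`X² - X + h`. Since `h(0) = 2 μ₁(0) / λ₀(0)`, the number `h` has the sign of `κ₁`, and the
discriminant `1 - 4 h` has the sign of `κ₂` unless `κ₂ = 0`. At the origin the linear part is that
of `f = μ₀ λ₀ (x² ± y²) / 2`, and the sign of `μ₀ λ₀` is that of `-ε' κ₁`.
-/

open Topology Filter Asymptotics
open scoped ContDiff

noncomputable section

namespace PoissonBif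

/-! ### Smooth functions near a point -/

section Calculus

variable {E F G : Type} [NormedAddCommGroup E] [NormedSpace ℝ E]
  [NormedAddCommGroup F] [NormedSpace ℝ F] [NormedAddCommGroup G] [NormedSpace ℝ G]

/-- Smooth dependence of an integral over `[0, 1]` on parameters, by induction on the order of
differentiability; the target space varies in the induction. -/
theorem contDiff_integral_nat [FiniteDimensional ℝ E] (n : ℕ) : ∀ {F : Type} [NormedAddCommGroup F]
    [NormedSpace ℝ F] [CompleteSpace F] {f : E × ℝ → F}, ContDiff ℝ n f →
    ContDiff ℝ n fun x => ∫ t in (0 : ℝ)..1, f (x, t) := by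
  induction n with
  | zero =>
    intro F _ _ _ f hf
    have hf' : Continuous f := hf.continuous
    exact contDiff_zero.2
      (intervalIntegral.continuous_parametric_intervalIntegral_of_continuous' (by fun_prop) 0 1)
  | succ n ih =>
    intro F _ _ _ f hf
    have h1 : ContDiff ℝ n (fderiv ℝ f) := hf.fderiv_right (by norm_cast)
    have hd : Differentiable ℝ f := hf.differentiable (by norm_cast)
    have hfc : Continuous f := hf.continuous
    set f' : E × ℝ → (E →L[ℝ] F) := fun q => (fderiv ℝ f q).comp (.inl ℝ E ℝ) with hf'
    have h2 : ContDiff ℝ n f' := h1.clm_comp contDiff_const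
    have h2c : Continuous f' := h2.continuous
    push_cast
    refine contDiff_succ_iff_hasFDerivAt.2 ⟨_, ih h2, fun x => ?_⟩
    obtain ⟨M, hM⟩ := ((isCompact_closedBall x 1).prod (isCompact_Icc (a := (0 : ℝ))
      (b := 1))).exists_bound_of_continuousOn h2c.continuousOn
    refine intervalIntegral.hasFDerivAt_integral_of_dominated_of_fderiv_le (bound := fun _ => M)
      (Metric.closedBall_mem_nhds x one_pos) ?_ ?_ ?_ ?_ ?_ ?_ (F' := fun x t => f' (x, t))
    · exact .of_forall fun y => (Continuous.aestronglyMeasurable (by fun_prop))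
    · exact Continuous.intervalIntegrable (by fun_prop) _ _
    · exact Continuous.aestronglyMeasurable (by fun_prop)
    · refine .of_forall fun t ht y hy => hM (y, t) ⟨hy, ?_⟩
      rw [Set.uIoc_of_le zero_le_one] at ht
      exact ⟨ht.1.le, ht.2⟩
    · exact intervalIntegrable_const
    · refine .of_forall fun t _ y _ => ?_
      exact (hd (y, t)).hasFDerivAt.comp y (hasFDerivAt_prodMk_left y t)

theorem contDiff_integral [FiniteDimensional ℝ E] [CompleteSpace F] {f : E × ℝ → F}
    (hf : ContDiff ℝ ∞ f) :
    ContDiff ℝ ∞ fun x => ∫ t in (0 : ℝ)..1, f (x, t) :=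
  contDiff_infty.2 fun n => contDiff_integral_nat n (contDiff_infty.1 hf n)

/-- Hadamard's lemma along the direction `e`. -/
theorem exists_hadamard [FiniteDimensional ℝ E] [CompleteSpace F] {f : E → F}
    (hf : ContDiff ℝ ∞ f) (l : E →L[ℝ] ℝ) (e : E) :
    ∃ h : E → F, ContDiff ℝ ∞ h ∧ ∀ x, f x = f (x - l x • e) + l x • h x := by
  have hd : Differentiable ℝ f := hf.differentiable (by simp)
  have h1 : ContDiff ℝ ∞ (fderiv ℝ f) := hf.fderiv_right (by simp)
  have h2 : ContDiff ℝ ∞ fun q : E × ℝ => fderiv ℝ f (q.1 - ((1 - q.2) * l q.1) • e) e := by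
    fun_prop
  refine ⟨fun x => ∫ t in (0 : ℝ)..1, fderiv ℝ f (x - ((1 - t) * l x) • e) e,
    contDiff_integral h2, fun x => ?_⟩
  have h3 : ∀ t : ℝ, HasDerivAt (fun t : ℝ => f (x - ((1 - t) * l x) • e))
      (l x • fderiv ℝ f (x - ((1 - t) * l x) • e) e) t := fun t => by
    have h4 : HasDerivAt (fun t : ℝ => x - ((1 - t) * l x) • e) (l x • e) t := by
      have := ((((hasDerivAt_id t).const_sub 1).mul_const (l x)).smul_const e).const_sub x
      simpa using this
    simpa [Function.comp_def] using (hd _).hasFDerivAt.comp_hasDerivAt t h4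
  have h5 := intervalIntegral.integral_eq_sub_of_hasDerivAt (a := 0) (b := 1)
    (fun t _ => h3 t) (Continuous.intervalIntegrable (by
      have := h2.continuous
      have h6 : Continuous fun t : ℝ => fderiv ℝ f (x - ((1 - t) * l x) • e) e :=
        this.comp (by fun_prop : Continuous fun t : ℝ => (x, t))
      fun_prop) _ _)
  rw [intervalIntegral.integral_smul] at h5
  rw [h5]
  simp

/-- A function that is smooth near a point has a globally defined smooth representative. -/
theorem SmoothNear.exists_contDiff [FiniteDimensional ℝ E] {f : E → F} {a : E}
    (hf : SmoothNear f a) :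
    ∃ g : E → F, ContDiff ℝ ∞ g ∧ g =ᶠ[𝓝 a] f := by
  obtain ⟨r, hr, hball⟩ := Metric.eventually_nhds_iff_ball.1 hf
  let χ : ContDiffBump a := ⟨r / 3, r / 2, by positivity, by linarith⟩
  refine ⟨fun x => χ x • f x, contDiff_iff_contDiffAt.2 fun x => ?_, ?_⟩
  · by_cases hx : x ∈ Metric.ball a r
    · exact χ.contDiff.contDiffAt.smul (hball x hx)
    · have : x ∉ tsupport χ := by
        rw [χ.tsupport_eq]
        simp only [Metric.mem_closedBall, Metric.mem_ball, not_lt, not_le] at hx ⊢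
        exact lt_of_lt_of_le (by change r / 2 < r; linarith) hx
      have h0 := notMem_tsupport_iff_eventuallyEq.1 this
      refine (contDiffAt_const (c := (0 : F))).congr_of_eventuallyEq ?_
      filter_upwards [h0] with y hy
      simp [hy]
  · filter_upwards [χ.eventuallyEq_one] with x hx
    simp [hx]

theorem _root_.ContDiff.smoothNear {f : E → F} (hf : ContDiff ℝ ∞ f) (a : E) : SmoothNear f a :=
  .of_forall fun _ => hf.contDiffAt

theorem SmoothNear.contDiffAt {f : E → F} {a : E} (hf : SmoothNear f a) : ContDiffAt ℝ ∞ f a :=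
  hf.self_of_nhds

theorem SmoothNear.comp {f : F → G} {g : E → F} {a : E} (hf : SmoothNear f (g a))
    (hg : SmoothNear g a) : SmoothNear (fun x => f (g x)) a := by
  filter_upwards [hg, hg.contDiffAt.continuousAt.eventually hf] with x hx hfx
  exact hfx.comp x hx

/-- A smooth family of local diffeomorphisms fixing the origin has a smooth family of inverses. -/
theorem exists_family_inverse [FiniteDimensional ℝ E] {Φ : ℝ × E → E} (hΦ : SmoothNear Φ (0, 0))
    (h0 : Φ (0, 0) = 0) (hinj : Function.Injective (fderiv ℝ (fun x => Φ (0, x)) 0)) :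
    ∃ Ψ : ℝ × E → E, ContDiff ℝ ∞ Ψ ∧ Ψ (0, 0) = 0 ∧ (∀ᶠ q in 𝓝 (0, 0), Φ (q.1, Ψ q) = q.2) ∧
      ∀ᶠ q in 𝓝 (0, 0), Ψ (q.1, Φ q) = q.2 := by
  obtain ⟨Φ', hs, hΦ'⟩ := hΦ.exists_contDiff
  set T : ℝ × E → ℝ × E := fun q => (q.1, Φ' q) with hT
  have hTs : ContDiff ℝ ∞ T := by fun_prop
  have hΦ0 : Φ' (0, 0) = 0 := by rw [hΦ'.self_of_nhds, h0]
  have hT0 : T (0, 0) = (0, 0) := by simp [hT, hΦ0]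
  have hd : HasFDerivAt T ((ContinuousLinearMap.fst ℝ ℝ E).prod (fderiv ℝ Φ' (0, 0))) (0, 0) :=
    hasFDerivAt_fst.prodMk ((hs.differentiable (by simp)) _).hasFDerivAt
  have hslice : fderiv ℝ (fun x => Φ (0, x)) 0 = (fderiv ℝ Φ' (0, 0)).comp (.inr ℝ ℝ E) := by
    have h1 : (fun x => Φ (0, x)) =ᶠ[𝓝 0] fun x => Φ' (0, x) :=
      (Continuous.tendsto' (by fun_prop) _ _ rfl :
        Tendsto (fun x : E => ((0 : ℝ), x)) (𝓝 0) (𝓝 (0, 0))).eventually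
          (hΦ'.mono fun _ h => h.symm)
    rw [h1.fderiv_eq]
    exact (((hs.differentiable (by simp)) (0, 0)).hasFDerivAt.comp (0 : E)
      (hasFDerivAt_prodMk_right (0 : ℝ) (0 : E))).fderiv
  have hDinj : Function.Injective
      ((ContinuousLinearMap.fst ℝ ℝ E).prod (fderiv ℝ Φ' (0, 0)) : ℝ × E →L[ℝ] ℝ × E) := by
    rw [injective_iff_map_eq_zero]
    rintro ⟨s, x⟩ h
    simp only [ContinuousLinearMap.prod_apply, ContinuousLinearMap.coe_fst', Prod.mk_eq_zero] at h
    obtain ⟨rfl, h⟩ := h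
    rw [hslice] at hinj
    have : x = 0 := (injective_iff_map_eq_zero _).1 hinj x (by simpa using h)
    simp [this]
  let e : (ℝ × E) ≃L[ℝ] (ℝ × E) := (LinearEquiv.ofInjectiveEndo _ hDinj).toContinuousLinearEquiv
  have hde : HasFDerivAt T (e : ℝ × E →L[ℝ] ℝ × E) (0, 0) := by
    exact hd.congr_fderiv (ContinuousLinearMap.ext fun q => rfl)
  let H := hTs.contDiffAt.toOpenPartialHomeomorph T hde (by simp)
  have hHT : ∀ q, H q = T q := fun _ => rfl
  have hsrc : (0, 0) ∈ H.source := hTs.contDiffAt.mem_toOpenPartialHomeomorph_source hde (by simp)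
  have htgt : (0, 0) ∈ H.target := by
    have := hTs.contDiffAt.image_mem_toOpenPartialHomeomorph_target hde (by simp)
    rwa [hT0] at this
  have hsymm0 : H.symm (0, 0) = (0, 0) := by
    have := H.left_inv hsrc
    rwa [hHT, hT0] at this
  have hsc : ContinuousAt H.symm (0, 0) := H.continuousAt_symm htgt
  have hsc' : Tendsto H.symm (𝓝 (0, 0)) (𝓝 (0, 0)) := by simpa [ContinuousAt, hsymm0] using hsc
  -- the derivative of `T` stays invertible near the origin
  have hinv : ∀ᶠ q in 𝓝 ((0 : ℝ), (0 : E)), ∃ e' : (ℝ × E) ≃L[ℝ] (ℝ × E),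
      (e' : ℝ × E →L[ℝ] ℝ × E) = fderiv ℝ T q := by
    have hc : ContinuousAt (fderiv ℝ T) (0, 0) := (hTs.continuous_fderiv (by simp)).continuousAt
    refine hc.eventually (p := fun L => ∃ e' : (ℝ × E) ≃L[ℝ] (ℝ × E),
      (e' : ℝ × E →L[ℝ] ℝ × E) = L) ?_
    rw [hde.fderiv]
    exact ContinuousLinearEquiv.nhds e
  have hsmooth : SmoothNear H.symm (0, 0) := by
    filter_upwards [H.open_target.mem_nhds htgt, hsc'.eventually hinv] with a ha ⟨e', he'⟩
    refine H.contDiffAt_symm (f₀' := e') ha ?_ hTs.contDiffAt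
    rw [he']
    exact ((hTs.differentiable (by simp)) _).hasFDerivAt
  obtain ⟨Ψ, hΨ, hΨH⟩ :=
    (SmoothNear.comp (f := Prod.snd) (contDiff_snd.smoothNear _) hsmooth).exists_contDiff
  refine ⟨Ψ, hΨ, hΨH.self_of_nhds.trans (congrArg Prod.snd hsymm0), ?_, ?_⟩
  · filter_upwards [hΨH, H.open_target.mem_nhds htgt, hsc'.eventually hΦ'] with q hq hqt hq'
    have h1 : T (H.symm q) = q := H.right_inv hqt
    have h2 : (H.symm q).1 = q.1 := (Prod.ext_iff.1 h1).1
    have h3 : Φ' (H.symm q) = q.2 := (Prod.ext_iff.1 h1).2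
    rw [hq, ← h2, Prod.mk.eta, ← hq', h3]
  · have hTc : Tendsto T (𝓝 (0, 0)) (𝓝 (0, 0)) := by
      simpa [ContinuousAt, hT0] using hTs.continuous.continuousAt (x := ((0 : ℝ), (0 : E)))
    filter_upwards [hTc.eventually hΨH, H.open_source.mem_nhds hsrc, hΦ'] with q hq hqs hq'
    have h1 : H.symm (T q) = q := H.left_inv hqs
    rw [← hq', hq, h1]

/-- A function whose derivative is `o(‖x‖)` varies by `o(‖x‖²)`, by the mean value inequality. -/
theorem isLittleO_sq_of_fderiv {f : E → F} (hf : ∀ᶠ x in 𝓝 0, DifferentiableAt ℝ f x)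
    (h : fderiv ℝ f =o[𝓝 0] fun x => ‖x‖) :
    (fun x => f x - f 0) =o[𝓝 0] fun x => ‖x‖ ^ 2 := by
  refine isLittleO_iff.2 fun c hc => ?_
  obtain ⟨r, hr, hb⟩ := Metric.eventually_nhds_iff_ball.1 (hf.and (isLittleO_iff.1 h hc))
  filter_upwards [Metric.ball_mem_nhds (0 : E) hr] with x hx
  have hsub : ∀ y ∈ Metric.closedBall (0 : E) ‖x‖, y ∈ Metric.ball (0 : E) r := fun y hy => by
    simp only [Metric.mem_closedBall, dist_zero_right, Metric.mem_ball] at hy hx ⊢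
    exact hy.trans_lt hx
  have := (convex_closedBall (0 : E) ‖x‖).norm_image_sub_le_of_norm_fderiv_le (𝕜 := ℝ) (f := f)
    (C := c * ‖x‖) (fun y hy => (hb y (hsub y hy)).1) (fun y hy => by
      refine (hb y (hsub y hy)).2.trans ?_
      rw [norm_norm]
      exact mul_le_mul_of_nonneg_left (by simpa using hy) hc.le)
    (x := 0) (y := x) (by simp) (by simp)
  rw [sub_zero] at this
  rw [norm_pow, norm_norm, pow_two, ← mul_assoc]
  exact this

theorem eq_zero_of_isLittleO_pow {c : F} {k : ℕ} (h : (fun t : ℝ => t ^ k • c) =o[𝓝 0]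
    fun t : ℝ => t ^ k) : c = 0 := by
  by_contra hc
  have h1 := isLittleO_iff.1 h (half_pos (norm_pos_iff.2 hc))
  obtain ⟨t, ht, ht0⟩ := ((h1.filter_mono nhdsWithin_le_nhds).and
    (self_mem_nhdsWithin : {(0 : ℝ)}ᶜ ∈ 𝓝[≠] 0)).exists
  rw [norm_smul, mul_comm] at ht
  have h2 : 0 < ‖t ^ k‖ := norm_pos_iff.2 (pow_ne_zero _ ht0)
  have h3 := le_of_mul_le_mul_right ht h2
  linarith [norm_pos_iff.2 hc]

/-- The `2`-jet at the origin of a function that is `o(‖x‖²)` vanishes. -/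
theorem jet_two_eq_zero {f : E → ℝ} (hf : ContDiff ℝ ∞ f) (h : f =o[𝓝 0] fun x => ‖x‖ ^ 2) :
    f 0 = 0 ∧ fderiv ℝ f 0 = 0 ∧ HasFDerivAt (fderiv ℝ f) (0 : E →L[ℝ] E →L[ℝ] ℝ) 0 := by
  have h0 : f 0 = 0 := by simpa using (isLittleO_iff.1 h one_pos).self_of_nhds
  have hlin : f =o[𝓝 0] fun x => x := by
    refine h.trans_isBigO (IsBigO.of_norm_right ?_)
    simpa using (isLittleO_norm_pow_norm_pow (E' := E) (by norm_num : 1 < 2)).isBigO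
  have h1 : HasFDerivAt f (0 : E →L[ℝ] ℝ) 0 := by
    rw [hasFDerivAt_iff_isLittleO_nhds_zero]
    simpa [h0] using hlin
  refine ⟨h0, h1.fderiv, ?_⟩
  have hd : Differentiable ℝ f := hf.differentiable (by simp)
  have hd2 : HasFDerivAt (fderiv ℝ f) (fderiv ℝ (fderiv ℝ f) 0) 0 :=
    (((hf.fderiv_right (m := ∞) (by simp)).differentiable (by simp)) 0).hasFDerivAt
  set T := fderiv ℝ (fderiv ℝ f) 0 with hT
  have hsymm : ∀ x y, T x y = T y x := fun x y =>
    ((contDiff_infty.1 hf 2).contDiffAt (x := (0 : E))).isSymmSndFDerivAt (by simp) x y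
  have hg : ∀ x, HasFDerivAt (fun x => f x - (1 / 2 : ℝ) * T x x) (fderiv ℝ f x - T x) x := by
    intro x
    have h2 : HasFDerivAt (fun x => T x x) (T x + T.flip x) x := by
      have := T.hasFDerivAt (x := x) |>.clm_apply (hasFDerivAt_id x)
      exact HasFDerivAt.congr_fderiv (f := fun x => T x x) this (by ext y; simp)
    refine ((hd x).hasFDerivAt.sub (h2.const_mul (1 / 2 : ℝ))).congr_fderiv ?_
    ext y
    simp [hsymm y x]
    ring
  have hgo : (fun x => (f x - (1 / 2 : ℝ) * T x x) - (f 0 - (1 / 2 : ℝ) * T 0 0)) =o[𝓝 0]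
      fun x => ‖x‖ ^ 2 := by
    refine isLittleO_sq_of_fderiv (.of_forall fun x => (hg x).differentiableAt) ?_
    have h3 : fderiv ℝ (fun x => f x - (1 / 2 : ℝ) * T x x) = fun x => fderiv ℝ f x - T x :=
      funext fun x => (hg x).fderiv
    rw [h3]
    have := (hasFDerivAt_iff_isLittleO_nhds_zero.1 hd2)
    simpa [h1.fderiv] using this.norm_right
  have hTo : (fun x => T x x) =o[𝓝 0] fun x => ‖x‖ ^ 2 := by
    have := (h.sub hgo).const_mul_left 2
    refine this.congr_left fun x => ?_
    simp [h0]
  have hT0 : ∀ x, T x x = 0 := fun x => by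
    refine eq_zero_of_isLittleO_pow (k := 2) ?_
    have ht : Tendsto (fun t : ℝ => t • x) (𝓝 0) (𝓝 0) :=
      Continuous.tendsto' (by fun_prop) _ _ (by simp)
    have h4 := hTo.comp_tendsto ht
    refine IsLittleO.trans_isBigO (h4.congr_left fun t => ?_) (g := fun t : ℝ => ‖t • x‖ ^ 2) ?_
    · simp; ring
    · refine IsBigO.of_bound (‖x‖ ^ 2) (.of_forall fun t => ?_)
      simp [norm_smul, mul_pow]
      exact le_of_eq (mul_comm _ _)
  have : T = 0 := by
    ext x y
    have h5 := hT0 (x + y)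
    simp only [map_add, add_apply, hT0, hsymm y x] at h5
    simp
    linarith
  rwa [this] at hd2

theorem eq_zero_of_mul_self_eventually {g : ℝ → ℝ} (hg : ContinuousAt g 0)
    (h : ∀ᶠ t in 𝓝 0, t * g t = 0) : g 0 = 0 := by
  have h1 : Tendsto g (𝓝[≠] 0) (𝓝 (g 0)) := hg.mono_left nhdsWithin_le_nhds
  have h2 : Tendsto g (𝓝[≠] 0) (𝓝 0) := by
    refine tendsto_const_nhds.congr' ?_
    filter_upwards [h.filter_mono nhdsWithin_le_nhds, self_mem_nhdsWithin] with t ht ht0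
    exact ((mul_eq_zero.1 ht).resolve_left ht0).symm
  exact tendsto_nhds_unique h1 h2

/-- Division with parameters: if the vectors `(α, β)` and `(A, B)` are parallel and `(A, B)` is
a family of local diffeomorphisms of the plane, then `(α, β)` is a smooth multiple of
`(A, B)`. -/
theorem exists_smooth_quotient {A B α β : ℝ × (ℝ × ℝ) → ℝ} (hA : ContDiff ℝ ∞ A)
    (hB : ContDiff ℝ ∞ B) (hα : ContDiff ℝ ∞ α) (hβ : ContDiff ℝ ∞ β)
    (hA0 : A (0, 0) = 0) (hB0 : B (0, 0) = 0)
    (hinj : Function.Injective (fderiv ℝ (fun v => (A (0, v), B (0, v))) 0))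
    (h : ∀ᶠ q in 𝓝 (0, 0), α q * B q = β q * A q) :
    ∃ k : ℝ × (ℝ × ℝ) → ℝ, ContDiff ℝ ∞ k ∧ ∀ᶠ q in 𝓝 (0, 0), α q = k q * A q ∧ β q = k q * B q
    := by
  obtain ⟨Ψ, hΨ, hΨ0, h1, h2⟩ := exists_family_inverse (Φ := fun q => (A q, B q))
    ((hA.prodMk hB).smoothNear _) (by simp [hA0, hB0]) hinj
  set a : ℝ × (ℝ × ℝ) → ℝ := fun q => α (q.1, Ψ q) with ha
  set b : ℝ × (ℝ × ℝ) → ℝ := fun q => β (q.1, Ψ q) with hb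
  have has : ContDiff ℝ ∞ a := by fun_prop
  have hbs : ContDiff ℝ ∞ b := by fun_prop
  have hac := has.continuous
  have hbc := hbs.continuous
  have hT : Tendsto (fun q : ℝ × (ℝ × ℝ) => (q.1, Ψ q)) (𝓝 (0, 0)) (𝓝 (0, 0)) := by
    have := hΨ.continuous
    exact Continuous.tendsto' (by fun_prop) _ _ (by simp [hΨ0])
  have hpar : ∀ᶠ q in 𝓝 ((0 : ℝ), (0 : ℝ × ℝ)), a q * q.2.2 = b q * q.2.1 := by
    filter_upwards [hT.eventually h, h1] with q hq hq1
    obtain ⟨h3, h4⟩ := Prod.ext_iff.1 hq1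
    simp only at h3 h4
    rw [h3, h4] at hq
    exact hq
  obtain ⟨s, hs, hsv⟩ : ∃ h : ℝ × (ℝ × ℝ) → ℝ, ContDiff ℝ ∞ h ∧
      ∀ q, a q = a (q.1, 0, q.2.2) + q.2.1 * h q := by
    obtain ⟨h, hh, hh'⟩ := exists_hadamard has
      ((ContinuousLinearMap.fst ℝ ℝ ℝ).comp (.snd ℝ ℝ (ℝ × ℝ))) ((0 : ℝ), (1 : ℝ), (0 : ℝ))
    refine ⟨h, hh, fun q => (hh' q).trans ?_⟩
    congr 2
    ext <;> simp
  have ha0 : ∀ᶠ q in 𝓝 ((0 : ℝ), (0 : ℝ × ℝ)), a (q.1, 0, q.2.2) = 0 := by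
    have ht : Tendsto (fun q : ℝ × (ℝ × ℝ) => (q.1, ((0 : ℝ), q.2.2))) (𝓝 (0, 0)) (𝓝 (0, 0)) :=
      Continuous.tendsto' (by fun_prop) _ _ rfl
    filter_upwards [ht.eventually hpar.eventually_nhds] with q hq
    by_cases hq2 : q.2.2 = 0
    · rw [hq2] at hq ⊢
      have hg := eq_zero_of_mul_self_eventually (g := fun t => a (q.1, 0, t))
        (Continuous.continuousAt (by fun_prop)) (by
          have ht' : Tendsto (fun t : ℝ => (q.1, ((0 : ℝ), t))) (𝓝 0) (𝓝 (q.1, 0, 0)) :=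
            Continuous.tendsto' (by fun_prop) _ _ rfl
          filter_upwards [ht'.eventually hq] with t ht
          simpa [mul_comm] using ht)
      exact hg
    · simpa [hq2] using hq.self_of_nhds
  have hb0 : ∀ᶠ q in 𝓝 ((0 : ℝ), (0 : ℝ × ℝ)), b q = s q * q.2.2 := by
    filter_upwards [(hpar.and ha0).eventually_nhds] with q hq
    have key : ∀ q : ℝ × (ℝ × ℝ), (a q * q.2.2 = b q * q.2.1 ∧ a (q.1, 0, q.2.2) = 0) →
        q.2.1 * (b q - s q * q.2.2) = 0 := fun q ⟨h3, h4⟩ => by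
      rw [hsv q, h4] at h3
      linear_combination -h3
    by_cases hq1 : q.2.1 = 0
    · have hg := eq_zero_of_mul_self_eventually
        (g := fun t => b (q.1, t, q.2.2) - s (q.1, t, q.2.2) * q.2.2)
        (Continuous.continuousAt (by have := hs.continuous; fun_prop)) (by
          have ht' : Tendsto (fun t : ℝ => (q.1, (t, q.2.2))) (𝓝 0) (𝓝 q) :=
            Continuous.tendsto' (by fun_prop) _ _ (by ext <;> simp [hq1])
          filter_upwards [ht'.eventually hq] with t ht
          exact key _ ht)
      rw [← hq1] at hg
      exact sub_eq_zero.1 (hg.trans hq1)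
    · exact sub_eq_zero.1 ((mul_eq_zero.1 (key q hq.self_of_nhds)).resolve_left hq1)
  have hT2 : Tendsto (fun q : ℝ × (ℝ × ℝ) => (q.1, (A q, B q))) (𝓝 (0, 0)) (𝓝 (0, 0)) := by
    have := hA.continuous
    have := hB.continuous
    exact Continuous.tendsto' (by fun_prop) _ _ (by simp [hA0, hB0])
  refine ⟨fun q => s (q.1, (A q, B q)), by fun_prop, ?_⟩
  filter_upwards [h2, hT2.eventually ha0, hT2.eventually hb0] with q h3 h4 h5
  have h6 := hsv (q.1, (A q, B q))
  simp only [ha, hb, h3, Prod.mk.eta] at h4 h5 h6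
  simp only [h4, zero_add] at h6
  exact ⟨by rw [h6, mul_comm], h5⟩

end Calculus

/-! ### Brackets in coordinates -/

theorem bracket_congr {π : R3 → Bivec} {f f' g g' : R3 → ℝ} {p : R3} (hf : f =ᶠ[𝓝 p] f')
    (hg : g =ᶠ[𝓝 p] g') : bracket π f g p = bracket π f' g' p := by
  simp only [bracket, hf.fderiv_eq, hg.fderiv_eq]

theorem fderiv_comp_coord {φ : R3 → R3} {f : R3 → ℝ} {p : R3} (hφ : DifferentiableAt ℝ φ p)
    (hf : DifferentiableAt ℝ f (φ p)) (v : R3) :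
    fderiv ℝ (fun x => f (φ x)) p v =
      ∑ k, fderiv ℝ f (φ p) (Pi.single k 1) * fderiv ℝ (fun x => φ x k) p v := by
  have h1 : fderiv ℝ (fun x => f (φ x)) p v = fderiv ℝ f (φ p) (fderiv ℝ φ p v) := by
    rw [show (fun x => f (φ x)) = f ∘ φ from rfl, fderiv_comp _ hf hφ]
    rfl
  have h2 : ∀ k, fderiv ℝ (fun x => φ x k) p v = fderiv ℝ φ p v k := fun k =>
    congrArg (fun L : R3 →L[ℝ] ℝ => L v) (hasFDerivAt_pi'.1 hφ.hasFDerivAt k).fderiv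
  rw [h1]
  conv_lhs => rw [← Finset.univ_sum_single (fderiv ℝ φ p v), map_sum]
  refine Finset.sum_congr rfl fun k _ => ?_
  rw [h2 k, mul_comm, ← smul_eq_mul, ← map_smul]
  congr 1
  ext j
  simp [Pi.single_apply]

/-- Brackets of functions of the coordinates `φ` are computed from the brackets of the
coordinates. -/
theorem bracket_comp {π : R3 → Bivec} {φ : R3 → R3} {f g : R3 → ℝ} {p : R3}
    (hφ : DifferentiableAt ℝ φ p) (hf : DifferentiableAt ℝ f (φ p))
    (hg : DifferentiableAt ℝ g (φ p)) :
    bracket π (fun x => f (φ x)) (fun x => g (φ x)) p =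
      bracket (fun _ => inCoords π φ p) f g (φ p) := by
  simp only [bracket, inCoords, fderiv_comp_coord hφ hf, fderiv_comp_coord hφ hg,
    Fin.sum_univ_three]
  ring

theorem bracket_bivec (u v w : ℝ) (f g : R3 → ℝ) (a : R3) :
    bracket (fun _ => bivec u v w) f g a =
      u * (fderiv ℝ f a (Pi.single 0 1) * fderiv ℝ g a (Pi.single 1 1)
        - fderiv ℝ f a (Pi.single 1 1) * fderiv ℝ g a (Pi.single 0 1))
      + v * (fderiv ℝ f a (Pi.single 1 1) * fderiv ℝ g a (Pi.single 2 1)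
        - fderiv ℝ f a (Pi.single 2 1) * fderiv ℝ g a (Pi.single 1 1))
      + w * (fderiv ℝ f a (Pi.single 2 1) * fderiv ℝ g a (Pi.single 0 1)
        - fderiv ℝ f a (Pi.single 0 1) * fderiv ℝ g a (Pi.single 2 1)) := by
  simp only [bracket, bivec, Fin.sum_univ_three, Matrix.cons_val_zero, Matrix.cons_val_one,
    Matrix.cons_val]
  ring

theorem fderiv_coord (i : Fin 3) (a v : R3) : fderiv ℝ (fun x : R3 => x i) a v = v i := by
  have : HasFDerivAt (fun x : R3 => x i) (ContinuousLinearMap.proj (R := ℝ) i) a :=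
    hasFDerivAt_apply i a
  rw [this.fderiv]
  rfl

theorem bivec_antisymm (u v w : ℝ) (i j : Fin 3) : bivec u v w i j = -bivec u v w j i := by
  fin_cases i <;> fin_cases j <;> simp [bivec]

theorem bivec_eq_zero_iff {u v w : ℝ} : bivec u v w = 0 ↔ u = 0 ∧ v = 0 ∧ w = 0 := by
  constructor
  · intro h
    refine ⟨?_, ?_, ?_⟩
    · simpa [bivec] using congrFun (congrFun h 0) 1
    · simpa [bivec] using congrFun (congrFun h 1) 2
    · simpa [bivec] using congrFun (congrFun h 2) 0
  · rintro ⟨rfl, rfl, rfl⟩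
    ext i j
    fin_cases i <;> fin_cases j <;> simp [bivec]

theorem bracket_swap {π : R3 → Bivec} {p : R3} (h : ∀ i j, π p i j = -π p j i)
    (f g : R3 → ℝ) : bracket π f g p = -bracket π g f p := by
  simp only [bracket, ← Finset.sum_neg_distrib]
  rw [Finset.sum_comm]
  refine Finset.sum_congr rfl fun i _ => Finset.sum_congr rfl fun j _ => ?_
  rw [h j i]
  ring

theorem eq_bivec {M : Bivec} (h : ∀ i j, M i j = -M j i) : M = bivec (M 0 1) (M 1 2) (M 2 0) := by
  ext i j
  have h0 := h 0 0
  have h1 := h 1 1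
  have h2 := h 2 2
  fin_cases i <;> fin_cases j <;> simp [bivec]
  all_goals first | linarith | exact h _ _

/-- The Jacobi identity holds for functions that are only smooth near the point. -/
theorem IsLocalPoissonFamily.jacobi_smoothNear {P : ℝ → R3 → Bivec} (hP : IsLocalPoissonFamily P) :
    ∀ᶠ q : ℝ × R3 in 𝓝 (0, 0), ∀ f g h : R3 → ℝ,
      SmoothNear f q.2 → SmoothNear g q.2 → SmoothNear h q.2 →
      bracket (P q.1) f (bracket (P q.1) g h) q.2
        + bracket (P q.1) g (bracket (P q.1) h f) q.2
        + bracket (P q.1) h (bracket (P q.1) f g) q.2 = 0 := by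
  filter_upwards [hP.jacobi] with q hq f g h hf hg hh
  obtain ⟨f', hf', hff'⟩ := hf.exists_contDiff
  obtain ⟨g', hg', hgg'⟩ := hg.exists_contDiff
  obtain ⟨h', hh', hhh'⟩ := hh.exists_contDiff
  have key : ∀ {a b a' b' : R3 → ℝ}, a' =ᶠ[𝓝 q.2] a → b' =ᶠ[𝓝 q.2] b →
      bracket (P q.1) a' b' =ᶠ[𝓝 q.2] bracket (P q.1) a b := fun ha hb => by
    filter_upwards [ha.eventually_nhds, hb.eventually_nhds] with x hx hx'
    exact bracket_congr hx hx'
  have := hq f' g' h' hf' hg' hh'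
  rwa [bracket_congr hff' (key hgg' hhh'), bracket_congr hgg' (key hhh' hff'),
    bracket_congr hhh' (key hff' hgg')] at this

theorem injective_of_det_ne_zero {L : R3 →L[ℝ] R3} (h : L.det ≠ 0) : Function.Injective L :=
  LinearMap.ker_eq_bot.1 (by
    by_contra hne
    exact h (LinearMap.det_eq_zero_iff_ker_ne_bot.2 hne))

theorem det_ne_zero_of_injective {L : R3 →L[ℝ] R3} (h : Function.Injective L) : L.det ≠ 0 :=
  fun h0 => LinearMap.det_eq_zero_iff_ker_ne_bot.1 h0 (LinearMap.ker_eq_bot.2 h)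

/-- The inverses of a family of coordinate systems, extended to a globally defined smooth map. -/
theorem IsLocalChartFamily.exists_inverse {Φ : ℝ → R3 → R3} (hΦ : IsLocalChartFamily Φ) :
    ∃ Ψ : ℝ × R3 → R3, ContDiff ℝ ∞ Ψ ∧ Ψ (0, 0) = 0 ∧
      (∀ᶠ q in 𝓝 (0, 0), Φ q.1 (Ψ q) = q.2) ∧ ∀ᶠ q in 𝓝 (0, 0), Ψ (q.1, Φ q.1 q.2) = q.2 :=
  exists_family_inverse (Φ := fun q => Φ q.1 q.2) hΦ.smooth hΦ.center
    (injective_of_det_ne_zero hΦ.det_ne)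

theorem tendsto_graph {E F : Type} [TopologicalSpace E] [Zero E] [TopologicalSpace F] [Zero F]
    {Φ : ℝ × E → F} (h : ContinuousAt Φ (0, 0)) (h0 : Φ (0, 0) = 0) :
    Tendsto (fun q : ℝ × E => (q.1, Φ q)) (𝓝 (0, 0)) (𝓝 (0, 0)) := by
  have : ContinuousAt (fun q : ℝ × E => (q.1, Φ q)) (0, 0) := continuousAt_fst.prodMk h
  simpa [ContinuousAt, h0] using this

theorem IsLocalChartFamily.tendsto {Φ : ℝ → R3 → R3} (hΦ : IsLocalChartFamily Φ) :
    Tendsto (fun q : ℝ × R3 => (q.1, Φ q.1 q.2)) (𝓝 (0, 0)) (𝓝 (0, 0)) :=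
  tendsto_graph (Φ := fun q : ℝ × R3 => Φ q.1 q.2) hΦ.smooth.contDiffAt.continuousAt hΦ.center

theorem tendsto_slice {E : Type} [TopologicalSpace E] (q : ℝ × E) :
    Tendsto (fun x => (q.1, x)) (𝓝 q.2) (𝓝 q) :=
  Continuous.tendsto' (by fun_prop) _ _ rfl

theorem IsLocalChartFamily.eventually_smoothNear {Φ : ℝ → R3 → R3} (hΦ : IsLocalChartFamily Φ) :
    ∀ᶠ q : ℝ × R3 in 𝓝 (0, 0), SmoothNear (Φ q.1) q.2 := by
  filter_upwards [hΦ.smooth.eventually_nhds] with q hq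
  filter_upwards [(tendsto_slice q).eventually hq] with x hx
  exact hx.comp x (contDiff_prodMk_right q.1).contDiffAt

theorem IsLocalChartFamily.eventually_injective {Φ : ℝ → R3 → R3} (hΦ : IsLocalChartFamily Φ) :
    ∀ᶠ q : ℝ × R3 in 𝓝 (0, 0), Function.Injective (fderiv ℝ (Φ q.1) q.2) := by
  obtain ⟨Ψ, hΨ, -, -, h⟩ := hΦ.exists_inverse
  filter_upwards [h.eventually_nhds, hΦ.eventually_smoothNear] with q hq hs
  have h1 : (fun x => Ψ (q.1, Φ q.1 x)) =ᶠ[𝓝 q.2] id := (tendsto_slice q).eventually hq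
  have h2 : fderiv ℝ (fun x => Ψ (q.1, x)) (Φ q.1 q.2) ∘L fderiv ℝ (Φ q.1) q.2 = .id ℝ _ := by
    rw [← fderiv_comp q.2 _ (hs.contDiffAt.differentiableAt (by simp))]
    · rw [← fderiv_id (𝕜 := ℝ) (x := q.2)]
      exact h1.fderiv_eq
    · exact ((hΨ.comp (contDiff_prodMk_right q.1)).differentiable (by simp)) _
  exact Function.LeftInverse.injective (g := fderiv ℝ (fun x => Ψ (q.1, x)) (Φ q.1 q.2))
    fun v => congrArg (fun L : R3 →L[ℝ] R3 => L v) h2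

/-- Singular points are detected in coordinates. -/
theorem IsLocalChartFamily.eq_zero_iff {Φ : ℝ → R3 → R3} (hΦ : IsLocalChartFamily Φ)
    (P : ℝ → R3 → Bivec) :
    ∀ᶠ q : ℝ × R3 in 𝓝 (0, 0), P q.1 q.2 = 0 ↔ inCoords (P q.1) (Φ q.1) q.2 = 0 := by
  obtain ⟨Ψ, hΨ, -, -, h⟩ := hΦ.exists_inverse
  filter_upwards [h.eventually_nhds, hΦ.eventually_smoothNear] with q hq hs
  have h1 : ∀ i : Fin 3, (fun x => Ψ (q.1, Φ q.1 x) i) =ᶠ[𝓝 q.2] fun x => x i := fun i => by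
    filter_upwards [(tendsto_slice q).eventually hq] with x hx
    rw [hx]
  refine ⟨fun h0 => ?_, fun h0 => ?_⟩
  · ext i j
    simp [inCoords, bracket, h0]
  · ext i j
    have hd : ∀ i : Fin 3, DifferentiableAt ℝ (fun w => Ψ (q.1, w) i) (Φ q.1 q.2) := fun i =>
      ((contDiff_pi.1 (hΨ.comp (contDiff_prodMk_right q.1)) i).differentiable (by simp)) _
    have h2 := bracket_comp (π := P q.1) (hs.contDiffAt.differentiableAt (by simp)) (hd i) (hd j)
    rw [h0, bracket_congr (h1 i) (h1 j)] at h2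
    simpa [bracket, fderiv_coord, Pi.single_apply, Finset.sum_ite_eq] using h2

/-- The mutual brackets of the coordinates `x, y, z` given by `Φ ε` are `{x,y} = z`, `{y,z} = F`,
`{z,x} = G`. -/
def HasBrackets (P : ℝ → R3 → Bivec) (Φ : ℝ → R3 → R3) (F G : ℝ × R3 → ℝ) : Prop :=
  ∀ᶠ q : ℝ × R3 in 𝓝 (0, 0), inCoords (P q.1) (Φ q.1) q.2 =
    bivec (Φ q.1 q.2 2) (F (q.1, Φ q.1 q.2)) (G (q.1, Φ q.1 q.2))

theorem fderiv_slice {E F : Type} [NormedAddCommGroup E] [NormedSpace ℝ E]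
    [NormedAddCommGroup F] [NormedSpace ℝ F] {f : ℝ × E → F} (hf : ContDiff ℝ ∞ f) (ε : ℝ)
    (x v : E) :
    fderiv ℝ (fun x => f (ε, x)) x v = fderiv ℝ f (ε, x) (0, v) := by
  have := ((hf.differentiable (by simp)) (ε, x)).hasFDerivAt.comp x (hasFDerivAt_prodMk_right ε x)
  exact (congrArg (fun L : E →L[ℝ] F => L v) this.fderiv).trans (by simp)

/-- The Jacobi identity in coordinates with `{x,y} = z`, `{y,z} = F`, `{z,x} = G`. -/
theorem HasBrackets.jacobi {P : ℝ → R3 → Bivec} (hP : IsLocalPoissonFamily P) {Φ : ℝ → R3 → R3}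
    (hΦ : IsLocalChartFamily Φ) {F G : ℝ × R3 → ℝ} (hF : ContDiff ℝ ∞ F) (hG : ContDiff ℝ ∞ G)
    (h : HasBrackets P Φ F G) :
    ∀ᶠ q : ℝ × R3 in 𝓝 (0, 0),
      q.2 2 * (fderiv ℝ F q (0, Pi.single 1 1) - fderiv ℝ G q (0, Pi.single 0 1))
        + F q * fderiv ℝ G q (0, Pi.single 2 1) - G q * fderiv ℝ F q (0, Pi.single 2 1) = 0 := by
  obtain ⟨Ψ, hΨ, hΨ0, hΦΨ, -⟩ := hΦ.exists_inverse
  have h1 : ∀ᶠ q : ℝ × R3 in 𝓝 (0, 0),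
      Φ q.1 q.2 2 * (fderiv ℝ F (q.1, Φ q.1 q.2) (0, Pi.single 1 1)
          - fderiv ℝ G (q.1, Φ q.1 q.2) (0, Pi.single 0 1))
        + F (q.1, Φ q.1 q.2) * fderiv ℝ G (q.1, Φ q.1 q.2) (0, Pi.single 2 1)
        - G (q.1, Φ q.1 q.2) * fderiv ℝ F (q.1, Φ q.1 q.2) (0, Pi.single 2 1) = 0 := by
    filter_upwards [hP.jacobi_smoothNear, hΦ.eventually_smoothNear, h.eventually_nhds]
      with q hJ hs hb
    have hb' : ∀ᶠ x in 𝓝 q.2, inCoords (P q.1) (Φ q.1) x =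
        bivec (Φ q.1 x 2) (F (q.1, Φ q.1 x)) (G (q.1, Φ q.1 x)) := (tendsto_slice q).eventually hb
    have hsi : ∀ i, SmoothNear (fun x => Φ q.1 x i) q.2 := fun i =>
      SmoothNear.comp (f := fun w : R3 => w i) ((contDiff_apply ℝ ℝ i).smoothNear _) hs
    have hj := hJ _ _ _ (hsi 0) (hsi 1) (hsi 2)
    have e1 : bracket (P q.1) (fun x => Φ q.1 x 1) (fun x => Φ q.1 x 2) =ᶠ[𝓝 q.2]
        fun x => F (q.1, Φ q.1 x) := hb'.mono fun x hx => by
      have := congrFun (congrFun hx 1) 2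
      simp only [bivec] at this
      exact this
    have e2 : bracket (P q.1) (fun x => Φ q.1 x 2) (fun x => Φ q.1 x 0) =ᶠ[𝓝 q.2]
        fun x => G (q.1, Φ q.1 x) := hb'.mono fun x hx => by
      have := congrFun (congrFun hx 2) 0
      simp only [bivec] at this
      exact this
    have e3 : bracket (P q.1) (fun x => Φ q.1 x 0) (fun x => Φ q.1 x 1) =ᶠ[𝓝 q.2]
        fun x => Φ q.1 x 2 := hb'.mono fun x hx => by
      have := congrFun (congrFun hx 0) 1
      simp only [bivec] at this
      exact this
    have hd : DifferentiableAt ℝ (Φ q.1) q.2 := hs.contDiffAt.differentiableAt (by simp)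
    have hdi : ∀ i : Fin 3, DifferentiableAt ℝ (fun w : R3 => w i) (Φ q.1 q.2) := fun i =>
      ((contDiff_apply ℝ ℝ i).differentiable (n := ∞) (by simp)) _
    have hdF : DifferentiableAt ℝ (fun w => F (q.1, w)) (Φ q.1 q.2) :=
      ((hF.comp (contDiff_prodMk_right q.1)).differentiable (by simp)) _
    have hdG : DifferentiableAt ℝ (fun w => G (q.1, w)) (Φ q.1 q.2) :=
      ((hG.comp (contDiff_prodMk_right q.1)).differentiable (by simp)) _
    rw [bracket_congr (Eventually.of_forall fun _ => rfl) e1,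
      bracket_congr (Eventually.of_forall fun _ => rfl) e2,
      bracket_congr (Eventually.of_forall fun _ => rfl) e3,
      bracket_comp hd (hdi 0) hdF, bracket_comp hd (hdi 1) hdG, bracket_comp hd (hdi 2) (hdi 2),
      hb'.self_of_nhds] at hj
    simp only [bracket_bivec, fderiv_coord, fderiv_slice hF, fderiv_slice hG] at hj
    simp at hj
    linarith
  have ht := tendsto_graph (Φ := Ψ) hΨ.continuous.continuousAt hΨ0
  filter_upwards [ht.eventually h1, hΦΨ] with q hq hq'
  simpa only [hq', Prod.mk.eta] using hq

/-! ### The reduced form -/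

/-- The projection `(ε, (x, y, z)) ↦ (ε, (x, y))`. -/
def plane : ℝ × R3 →L[ℝ] ℝ × (ℝ × ℝ) :=
  (ContinuousLinearMap.fst ℝ ℝ R3).prod
    (((ContinuousLinearMap.proj (R := ℝ) (φ := fun _ : Fin 3 => ℝ) 0).comp (.snd ℝ ℝ R3)).prod
      ((ContinuousLinearMap.proj (R := ℝ) (φ := fun _ : Fin 3 => ℝ) 1).comp (.snd ℝ ℝ R3)))

@[simp]
theorem plane_apply (q : ℝ × R3) : plane q = (q.1, (q.2 0, q.2 1)) := rfl

/-- The point `(ε, (x, y, z))` over `(ε, (x, y))`. -/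
def lift (q : ℝ × (ℝ × ℝ)) (z : ℝ) : ℝ × R3 := (q.1, ![q.2.1, q.2.2, z])

@[simp]
theorem plane_lift (q : ℝ × (ℝ × ℝ)) (z : ℝ) : plane (lift q z) = q := rfl

@[simp]
theorem lift_snd_two (q : ℝ × (ℝ × ℝ)) (z : ℝ) : (lift q z).2 2 = z := rfl

theorem lift_plane (q : ℝ × R3) : lift (plane q) (q.2 2) = q := by
  refine Prod.ext rfl ?_
  ext i
  fin_cases i <;> rfl

theorem contDiff_lift : ContDiff ℝ ∞ fun q : (ℝ × (ℝ × ℝ)) × ℝ => lift q.1 q.2 := by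
  refine ContDiff.prodMk (by fun_prop) (contDiff_pi.2 fun i => ?_)
  fin_cases i
  · exact (by fun_prop : ContDiff ℝ ∞ fun q : (ℝ × (ℝ × ℝ)) × ℝ => q.1.2.1)
  · exact (by fun_prop : ContDiff ℝ ∞ fun q : (ℝ × (ℝ × ℝ)) × ℝ => q.1.2.2)
  · exact (by fun_prop : ContDiff ℝ ∞ fun q : (ℝ × (ℝ × ℝ)) × ℝ => q.2)

theorem contDiff_lift_zero : ContDiff ℝ ∞ fun q : ℝ × (ℝ × ℝ) => lift q 0 :=
  contDiff_lift.comp (contDiff_prodMk_left (0 : ℝ))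

theorem lift_zero : lift (0, 0) 0 = (0, 0) := by
  refine Prod.ext rfl ?_
  ext i
  fin_cases i <;> rfl

theorem tendsto_lift (q : ℝ × (ℝ × ℝ)) : Tendsto (lift q) (𝓝 0) (𝓝 (lift q 0)) :=
  ((contDiff_lift.comp (contDiff_prodMk_right q)).continuous).tendsto' _ _ rfl

theorem tendsto_lift_zero :
    Tendsto (fun q : ℝ × (ℝ × ℝ) => lift q 0) (𝓝 (0, 0)) (𝓝 (0, 0)) :=
  contDiff_lift_zero.continuous.tendsto' _ _ lift_zero

theorem hasDerivAt_lift (q : ℝ × (ℝ × ℝ)) (z : ℝ) :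
    HasDerivAt (lift q) (0, Pi.single 2 1) z := by
  refine HasDerivAt.prodMk (hasDerivAt_const _ _) (hasDerivAt_pi.2 fun i => ?_)
  fin_cases i
  · simpa using! hasDerivAt_const z q.2.1
  · simpa using! hasDerivAt_const z q.2.2
  · simpa using! hasDerivAt_id z

/-- The partial derivative `∂f/∂x` of `f (ε, (x, y))`. -/
def dx (f : ℝ × (ℝ × ℝ) → ℝ) (q : ℝ × (ℝ × ℝ)) : ℝ := fderiv ℝ f q (0, (1, 0))

/-- The partial derivative `∂f/∂y` of `f (ε, (x, y))`. -/
def dy (f : ℝ × (ℝ × ℝ) → ℝ) (q : ℝ × (ℝ × ℝ)) : ℝ := fderiv ℝ f q (0, (0, 1))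

theorem contDiff_dx {f : ℝ × (ℝ × ℝ) → ℝ} (hf : ContDiff ℝ ∞ f) : ContDiff ℝ ∞ (dx f) :=
  (hf.fderiv_right (m := ∞) (by simp)).clm_apply contDiff_const

theorem contDiff_dy {f : ℝ × (ℝ × ℝ) → ℝ} (hf : ContDiff ℝ ∞ f) : ContDiff ℝ ∞ (dy f) :=
  (hf.fderiv_right (m := ∞) (by simp)).clm_apply contDiff_const

theorem fderiv_plane_direction (f : ℝ × (ℝ × ℝ) → ℝ) (q : ℝ × (ℝ × ℝ)) (a b : ℝ) :
    fderiv ℝ f q (0, (a, b)) = a * dx f q + b * dy f q := by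
  have : ((0 : ℝ), (a, b)) = a • ((0 : ℝ), ((1 : ℝ), (0 : ℝ)))
      + b • ((0 : ℝ), ((0 : ℝ), (1 : ℝ))) := by
    ext <;> simp
  rw [this, map_add, map_smul, map_smul]
  rfl

/-- The right-hand side `A(x,y) (z + C(x,y)) + z² Q(x,y,z)` of the reduced form. -/
def reducedForm (A C : ℝ × (ℝ × ℝ) → ℝ) (Q : ℝ × R3 → ℝ) (q : ℝ × R3) : ℝ :=
  A (plane q) * (q.2 2 + C (plane q)) + q.2 2 ^ 2 * Q q

theorem contDiff_reducedForm {A C : ℝ × (ℝ × ℝ) → ℝ} {Q : ℝ × R3 → ℝ} (hA : ContDiff ℝ ∞ A)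
    (hC : ContDiff ℝ ∞ C) (hQ : ContDiff ℝ ∞ Q) : ContDiff ℝ ∞ (reducedForm A C Q) := by
  unfold reducedForm
  have h2 : ContDiff ℝ ∞ fun q : ℝ × R3 => q.2 2 := (contDiff_apply ℝ ℝ 2).comp contDiff_snd
  have hA' : ContDiff ℝ ∞ fun q => A (plane q) := hA.comp plane.contDiff
  have hC' : ContDiff ℝ ∞ fun q => C (plane q) := hC.comp plane.contDiff
  fun_prop

theorem fderiv_reducedForm {A C : ℝ × (ℝ × ℝ) → ℝ} {Q : ℝ × R3 → ℝ} (hA : ContDiff ℝ ∞ A)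
    (hC : ContDiff ℝ ∞ C) (hQ : ContDiff ℝ ∞ Q) (q v : ℝ × R3) :
    fderiv ℝ (reducedForm A C Q) q v =
      fderiv ℝ A (plane q) (plane v) * (q.2 2 + C (plane q))
        + A (plane q) * (v.2 2 + fderiv ℝ C (plane q) (plane v))
        + 2 * q.2 2 * v.2 2 * Q q + q.2 2 ^ 2 * fderiv ℝ Q q v := by
  have h2 : HasFDerivAt (fun q : ℝ × R3 => q.2 2)
      ((ContinuousLinearMap.proj (R := ℝ) (φ := fun _ : Fin 3 => ℝ) 2).comp (.snd ℝ ℝ R3)) q :=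
    (ContinuousLinearMap.comp (ContinuousLinearMap.proj (R := ℝ) (φ := fun _ : Fin 3 => ℝ) 2)
      (.snd ℝ ℝ R3)).hasFDerivAt
  have hA' : HasFDerivAt (fun q => A (plane q)) ((fderiv ℝ A (plane q)).comp plane) q :=
    ((hA.differentiable (by simp)) _).hasFDerivAt.comp q plane.hasFDerivAt
  have hC' : HasFDerivAt (fun q => C (plane q)) ((fderiv ℝ C (plane q)).comp plane) q :=
    ((hC.differentiable (by simp)) _).hasFDerivAt.comp q plane.hasFDerivAt
  have hQ' := ((hQ.differentiable (by simp)) q).hasFDerivAt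
  have h := (hA'.mul (h2.add hC')).add ((h2.pow 2).mul hQ')
  have h' : HasFDerivAt (reducedForm A C Q) _ q := h
  rw [h'.fderiv]
  simp
  ring

/-- The first two Taylor coefficients in `z` of the Jacobi identity. -/
theorem coeff_eq_zero_of_jacobi {u w r : ℝ → ℝ} {a C k : ℝ} (hu : HasDerivAt u (w 0) 0)
    (hw : DifferentiableAt ℝ w 0) (hr : DifferentiableAt ℝ r 0)
    (h : ∀ᶠ z in 𝓝 0, z * (a * (z + C) + k + u z * (z + 2 * C) + z * (z + C) * w z + z ^ 2 * r z)
      = 0) :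
    a * C + k + 2 * C * u 0 = 0 ∧ a + u 0 + 3 * C * w 0 = 0 := by
  set E : ℝ → ℝ := fun z =>
    a * (z + C) + k + u z * (z + 2 * C) + z * (z + C) * w z + z ^ 2 * r z with hE
  have hid : ∀ c : ℝ, HasDerivAt (fun z : ℝ => z + c) 1 0 := fun c => (hasDerivAt_id 0).add_const c
  have hd : HasDerivAt E (a + u 0 + 3 * C * w 0) 0 := by
    have h1 := (((((hid C).const_mul a).add_const k).add (hu.mul (hid (2 * C)))).add
      (((hasDerivAt_id (0 : ℝ)).mul (hid C)).mul hw.hasDerivAt)).add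
      (((hasDerivAt_id (0 : ℝ)).pow 2).mul hr.hasDerivAt)
    refine HasDerivAt.congr_deriv (f := E) h1 ?_
    simp
    ring
  have h0 : E 0 = 0 := eq_zero_of_mul_self_eventually hd.continuousAt h
  refine ⟨by simp only [hE] at h0; linarith, ?_⟩
  have hE0 : E =ᶠ[𝓝 0] fun _ => 0 := by
    filter_upwards [h] with z hz
    rcases mul_eq_zero.1 hz with rfl | hz
    · exact h0
    · exact hz
  rw [← hd.deriv, hE0.deriv_eq]
  simp

/-- A reduction of the family `P` to the form `{x,y} = z`, `{y,z} = A (z + C) + z² Q₁`,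
`{z,x} = B (z + C) + z² Q₂`, without any condition on the Taylor expansions of `A`, `B` and `C`. -/
structure Reduction (P : ℝ → R3 → Bivec) where
  Φ : ℝ → R3 → R3
  A : ℝ × (ℝ × ℝ) → ℝ
  B : ℝ × (ℝ × ℝ) → ℝ
  C : ℝ × (ℝ × ℝ) → ℝ
  Q₁ : ℝ × R3 → ℝ
  Q₂ : ℝ × R3 → ℝ
  chart : IsLocalChartFamily Φ
  smooth_A : ContDiff ℝ ∞ A
  smooth_B : ContDiff ℝ ∞ B
  smooth_C : ContDiff ℝ ∞ C
  smooth_Q₁ : ContDiff ℝ ∞ Q₁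
  smooth_Q₂ : ContDiff ℝ ∞ Q₂
  brackets : HasBrackets P Φ (reducedForm A C Q₁) (reducedForm B C Q₂)

namespace Reduction

variable {P : ℝ → R3 → Bivec} (R : Reduction P)

/-- The function `∂Q/∂z` restricted to `z = 0`. -/
def dzZero (Q : ℝ × R3 → ℝ) (q : ℝ × (ℝ × ℝ)) : ℝ := fderiv ℝ Q (lift q 0) (0, Pi.single 2 1)

theorem contDiff_dzZero {Q : ℝ × R3 → ℝ} (hQ : ContDiff ℝ ∞ Q) : ContDiff ℝ ∞ (dzZero Q) :=
  ((hQ.fderiv_right (m := ∞) (by simp)).comp contDiff_lift_zero).clm_apply contDiff_const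

/-- The coefficients of `z` and `z²` in the Jacobi identity for a reduced form, as identities
between functions of `(ε, x, y)`. -/
theorem jacobi_coeff (hP : IsLocalPoissonFamily P) :
    ∀ᶠ q in 𝓝 (0, 0),
      (dy R.A q - dx R.B q) * R.C q + (R.A q * dy R.C q - R.B q * dx R.C q)
        + 2 * R.C q * (R.A q * R.Q₂ (lift q 0) - R.B q * R.Q₁ (lift q 0)) = 0 ∧
      dy R.A q - dx R.B q + (R.A q * R.Q₂ (lift q 0) - R.B q * R.Q₁ (lift q 0))
        + 3 * R.C q * (R.A q * dzZero R.Q₂ q - R.B q * dzZero R.Q₁ q) = 0 := by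
  have hJ := R.brackets.jacobi hP R.chart
    (contDiff_reducedForm R.smooth_A R.smooth_C R.smooth_Q₁)
    (contDiff_reducedForm R.smooth_B R.smooth_C R.smooth_Q₂)
  filter_upwards [tendsto_lift_zero.eventually hJ.eventually_nhds] with q hq
  have hq' := (tendsto_lift q).eventually hq
  have hl : ContDiff ℝ ∞ (lift q) := contDiff_lift.comp (contDiff_prodMk_right q)
  have hdQ : ∀ {Q : ℝ × R3 → ℝ}, ContDiff ℝ ∞ Q → ∀ v,
      Differentiable ℝ fun z => fderiv ℝ Q (lift q z) v := fun hQ v =>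
    ContDiff.differentiable (n := ∞)
      (((hQ.fderiv_right (m := ∞) (by simp)).comp hl).clm_apply contDiff_const) (by simp)
  have hQz : ∀ {Q : ℝ × R3 → ℝ}, ContDiff ℝ ∞ Q →
      HasDerivAt (fun z => Q (lift q z)) (dzZero Q q) 0 := fun hQ =>
    ((hQ.differentiable (by simp)) _).hasFDerivAt.comp_hasDerivAt (0 : ℝ) (hasDerivAt_lift q 0)
  have h1 := R.smooth_Q₁
  have h2 := R.smooth_Q₂
  have d1 : DifferentiableAt ℝ (fun z => R.Q₁ (lift q z)) 0 := (hQz h1).differentiableAt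
  have d2 : DifferentiableAt ℝ (fun z => R.Q₂ (lift q z)) 0 := (hQz h2).differentiableAt
  refine coeff_eq_zero_of_jacobi (u := fun z => R.A q * R.Q₂ (lift q z) - R.B q * R.Q₁ (lift q z))
    (w := fun z => R.A q * fderiv ℝ R.Q₂ (lift q z) (0, Pi.single 2 1)
      - R.B q * fderiv ℝ R.Q₁ (lift q z) (0, Pi.single 2 1))
    (r := fun z => (fderiv ℝ R.Q₁ (lift q z) (0, Pi.single 1 1)
      - fderiv ℝ R.Q₂ (lift q z) (0, Pi.single 0 1))
      + z * (R.Q₁ (lift q z) * fderiv ℝ R.Q₂ (lift q z) (0, Pi.single 2 1)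
        - R.Q₂ (lift q z) * fderiv ℝ R.Q₁ (lift q z) (0, Pi.single 2 1)))
    (((hQz h2).const_mul _).sub ((hQz h1).const_mul _)) ?_ ?_ ?_
  · exact (((hdQ h2 _) 0).const_mul _).sub (((hdQ h1 _) 0).const_mul _)
  · exact (((hdQ h1 _) 0).sub ((hdQ h2 _) 0)).add (differentiableAt_id.mul
      ((d1.mul ((hdQ h2 _) 0)).sub (d2.mul ((hdQ h1 _) 0))))
  · filter_upwards [hq'] with z hz
    rw [fderiv_reducedForm R.smooth_A R.smooth_C h1, fderiv_reducedForm R.smooth_A R.smooth_C h1,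
      fderiv_reducedForm R.smooth_B R.smooth_C h2, fderiv_reducedForm R.smooth_B R.smooth_C h2]
      at hz
    simp only [reducedForm, plane_lift, lift_snd_two] at hz
    have e0 : plane (0, Pi.single 0 1) = (0, (1, 0)) := by simp
    have e1 : plane (0, Pi.single 1 1) = (0, (0, 1)) := by simp
    have e2 : plane (0, Pi.single 2 1) = 0 := by simp
    simp only [e0, e1, e2, map_zero] at hz
    simp at hz
    simp only [dx, dy]
    linear_combination hz

/-- The first component of the form `D = Q - 3 C ∂Q/∂z` on `z = 0`, where `Q` is short for
`Q₁ dx + Q₂ dy`; the Jacobi identity makes `dC + C D` a multiple of `A dx + B dy`. -/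
def D₁ (q : ℝ × (ℝ × ℝ)) : ℝ := R.Q₁ (lift q 0) - 3 * R.C q * dzZero R.Q₁ q

/-- The second component of the form `D`, see `Reduction.D₁`. -/
def D₂ (q : ℝ × (ℝ × ℝ)) : ℝ := R.Q₂ (lift q 0) - 3 * R.C q * dzZero R.Q₂ q

theorem contDiff_D₁ : ContDiff ℝ ∞ R.D₁ :=
  (R.smooth_Q₁.comp contDiff_lift_zero).sub
    ((contDiff_const.mul R.smooth_C).mul (contDiff_dzZero R.smooth_Q₁))

theorem contDiff_D₂ : ContDiff ℝ ∞ R.D₂ :=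
  (R.smooth_Q₂.comp contDiff_lift_zero).sub
    ((contDiff_const.mul R.smooth_C).mul (contDiff_dzZero R.smooth_Q₂))

/-- The key identity `dC + C D = h (A dx + B dy)`: eliminating `∂A/∂y - ∂B/∂x` from the two
identities of `jacobi_coeff` shows that the left-hand side is parallel to `A dx + B dy`, and one
can divide. -/
theorem exists_dC_eq (hP : IsLocalPoissonFamily P) (hA0 : R.A (0, 0) = 0) (hB0 : R.B (0, 0) = 0)
    (hinj : Function.Injective (fderiv ℝ (fun v => (R.A (0, v), R.B (0, v))) 0)) :
    ∃ h : ℝ × (ℝ × ℝ) → ℝ, ContDiff ℝ ∞ h ∧ ∀ᶠ q in 𝓝 (0, 0),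
      dx R.C q = h q * R.A q - R.C q * R.D₁ q ∧ dy R.C q = h q * R.B q - R.C q * R.D₂ q := by
  obtain ⟨h, hh, hq⟩ := exists_smooth_quotient R.smooth_A R.smooth_B
    ((contDiff_dx R.smooth_C).add (R.smooth_C.mul R.contDiff_D₁))
    ((contDiff_dy R.smooth_C).add (R.smooth_C.mul R.contDiff_D₂)) hA0 hB0 hinj (by
      filter_upwards [R.jacobi_coeff hP] with q ⟨h1, h2⟩
      simp only [D₁, D₂]
      linear_combination -h1 + R.C q * h2)
  refine ⟨h, hh, hq.mono fun q hq => ⟨?_, ?_⟩⟩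
  · linear_combination hq.1
  · linear_combination hq.2

end Reduction

/-! ### Changes of the coordinates `x, y` -/

/-- The Jacobian determinant of a planar map `(K₀, K₁)` depending on `ε`. -/
def jac (K₀ K₁ : ℝ × (ℝ × ℝ) → ℝ) (q : ℝ × (ℝ × ℝ)) : ℝ := dx K₀ q * dy K₁ q - dy K₀ q * dx K₁ q

theorem contDiff_jac {K₀ K₁ : ℝ × (ℝ × ℝ) → ℝ} (h₀ : ContDiff ℝ ∞ K₀) (h₁ : ContDiff ℝ ∞ K₁) :
    ContDiff ℝ ∞ (jac K₀ K₁) :=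
  ((contDiff_dx h₀).mul (contDiff_dy h₁)).sub ((contDiff_dy h₀).mul (contDiff_dx h₁))

theorem eq_zero_of_planar_system {a b c d x y : ℝ} (h : a * d - b * c ≠ 0)
    (h₁ : x * a + y * b = 0) (h₂ : x * c + y * d = 0) : x = 0 ∧ y = 0 :=
  ⟨(mul_eq_zero.1 (by linear_combination d * h₁ - b * h₂ :
      (a * d - b * c) * x = 0)).resolve_left h,
    (mul_eq_zero.1 (by linear_combination a * h₂ - c * h₁ :
      (a * d - b * c) * y = 0)).resolve_left h⟩

theorem injective_planar {f g : ℝ × (ℝ × ℝ) → ℝ} (hf : ContDiff ℝ ∞ f) (hg : ContDiff ℝ ∞ g)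
    (h : jac f g (0, 0) ≠ 0) :
    Function.Injective (fderiv ℝ (fun v : ℝ × ℝ => (f (0, v), g (0, v))) 0) := by
  rw [injective_iff_map_eq_zero]
  rintro ⟨x, y⟩ hv
  rw [fderiv_slice (f := fun q => (f q, g q)) (hf.prodMk hg)] at hv
  rw [((hf.differentiable (by simp)) (0, 0)).hasFDerivAt.prodMk
    ((hg.differentiable (by simp)) (0, 0)).hasFDerivAt |>.fderiv] at hv
  obtain ⟨h1, h2⟩ := Prod.ext_iff.1 hv
  simp only [ContinuousLinearMap.prod_apply, fderiv_plane_direction] at h1 h2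
  obtain ⟨hx, hy⟩ := eq_zero_of_planar_system h h1 h2
  simp [hx, hy]

/-- A planar map acting on `x, y`, together with a rescaling of `z`. -/
def planarMap (X Y S : ℝ × (ℝ × ℝ) → ℝ) (q : ℝ × R3) : R3 :=
  ![X (plane q), Y (plane q), S (plane q) * q.2 2]

theorem contDiff_planarMap {X Y S : ℝ × (ℝ × ℝ) → ℝ} (hX : ContDiff ℝ ∞ X) (hY : ContDiff ℝ ∞ Y)
    (hS : ContDiff ℝ ∞ S) : ContDiff ℝ ∞ (planarMap X Y S) := by
  refine contDiff_pi.2 fun i => ?_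
  fin_cases i
  · exact hX.comp plane.contDiff
  · exact hY.comp plane.contDiff
  · exact (hS.comp plane.contDiff).mul ((contDiff_apply ℝ ℝ 2).comp contDiff_snd)

theorem fderiv_comp_plane {X : ℝ × (ℝ × ℝ) → ℝ} (hX : ContDiff ℝ ∞ X) (ε : ℝ) (w v : R3) :
    fderiv ℝ (fun w => X (plane (ε, w))) w v =
      v 0 * dx X (plane (ε, w)) + v 1 * dy X (plane (ε, w)) := by
  have h : HasFDerivAt (fun q => X (plane q)) _ (ε, w) :=
    ((hX.differentiable (by simp)) _).hasFDerivAt.comp (ε, w) plane.hasFDerivAt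
  rw [fderiv_slice (f := fun q => X (plane q)) (hX.comp plane.contDiff), h.fderiv]
  exact fderiv_plane_direction _ _ _ _

theorem fderiv_mul_coord {S : ℝ × (ℝ × ℝ) → ℝ} (hS : ContDiff ℝ ∞ S) (ε : ℝ) (w v : R3) :
    fderiv ℝ (fun w : R3 => S (plane (ε, w)) * w 2) w v =
      (v 0 * dx S (plane (ε, w)) + v 1 * dy S (plane (ε, w))) * w 2 + S (plane (ε, w)) * v 2 := by
  have h1 : DifferentiableAt ℝ (fun w => S (plane (ε, w))) w :=
    ((hS.comp (plane.contDiff.comp (contDiff_prodMk_right ε))).differentiable (by simp)) w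
  have h2 : HasFDerivAt (fun w : R3 => w 2)
      (ContinuousLinearMap.proj (R := ℝ) (φ := fun _ : Fin 3 => ℝ) 2) w := hasFDerivAt_apply 2 w
  have h : HasFDerivAt (fun w : R3 => S (plane (ε, w)) * w 2) _ w := h1.hasFDerivAt.mul h2
  rw [h.fderiv]
  simp only [add_apply, smul_apply, fderiv_comp_plane hS, smul_eq_mul,
    ContinuousLinearMap.proj_apply]
  ring

/-- Composing a coordinate system with a planar change and a rescaling of `z` gives a coordinate
system. -/
theorem IsLocalChartFamily.planar {Φ : ℝ → R3 → R3} (hΦ : IsLocalChartFamily Φ)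
    {X Y S : ℝ × (ℝ × ℝ) → ℝ} (hX : ContDiff ℝ ∞ X) (hY : ContDiff ℝ ∞ Y) (hS : ContDiff ℝ ∞ S)
    (hX0 : X (0, 0) = 0) (hY0 : Y (0, 0) = 0) (hJ : jac X Y (0, 0) ≠ 0) (hS0 : S (0, 0) ≠ 0) :
    IsLocalChartFamily fun ε p => planarMap X Y S (ε, Φ ε p) := by
  have hχ := contDiff_planarMap hX hY hS
  have hΦc : Φ 0 0 = 0 := hΦ.center
  have hd0 : DifferentiableAt ℝ (Φ 0) 0 :=
    hΦ.eventually_smoothNear.self_of_nhds.contDiffAt.differentiableAt (by simp)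
  have hχd : Differentiable ℝ fun w => planarMap X Y S (0, w) :=
    (hχ.comp (contDiff_prodMk_right 0)).differentiable (by simp)
  refine ⟨?_, ?_, det_ne_zero_of_injective ?_⟩
  · have hs : SmoothNear (fun q : ℝ × R3 => (q.1, Φ q.1 q.2)) (0, 0) := by
      filter_upwards [hΦ.smooth] with q hq
      exact contDiffAt_fst.prodMk hq
    exact SmoothNear.comp (f := planarMap X Y S) (hχ.smoothNear _) hs
  · have : planarMap X Y S (0, Φ 0 0) = ![X (0, 0), Y (0, 0), S (0, 0) * 0] := by
      rw [hΦc]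
      rfl
    rw [this, hX0, hY0, mul_zero]
    ext i
    fin_cases i <;> rfl
  · have e : fderiv ℝ (fun p => planarMap X Y S (0, Φ 0 p)) 0
        = fderiv ℝ (fun w => planarMap X Y S (0, w)) 0 ∘L fderiv ℝ (Φ 0) 0 := by
      rw [← hΦc]
      conv_rhs => rw [hΦc]
      have := fderiv_comp (𝕜 := ℝ) 0 (hχd (Φ 0 0)) hd0
      rw [hΦc] at this ⊢
      exact this
    rw [e]
    refine Function.Injective.comp (g := fderiv ℝ (fun w => planarMap X Y S (0, w)) 0) ?_
      (injective_of_det_ne_zero hΦ.det_ne)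
    rw [injective_iff_map_eq_zero]
    intro v hv
    have hi : ∀ i, fderiv ℝ (fun w => planarMap X Y S (0, w) i) 0 v = 0 := fun i => by
      rw [(hasFDerivAt_pi'.1 (hχd 0).hasFDerivAt i).fderiv]
      exact congrFun hv i
    have h0 := hi 0
    have h1 := hi 1
    have h2 := hi 2
    simp only [planarMap, Matrix.cons_val_zero, Matrix.cons_val_one, Matrix.cons_val] at h0 h1 h2
    rw [fderiv_comp_plane hX] at h0
    rw [fderiv_comp_plane hY] at h1
    rw [fderiv_mul_coord hS] at h2
    have hp : plane ((0 : ℝ), (0 : R3)) = (0, 0) := rfl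
    rw [hp] at h0 h1 h2
    obtain ⟨e0, e1⟩ := eq_zero_of_planar_system hJ h0 h1
    have e2 : v 2 = 0 := by simpa [hS0] using h2
    ext i
    fin_cases i
    exacts [e0, e1, e2]

/-- The brackets of the new coordinates `X(x, y), Y(x, y), S(x, y) z`. -/
theorem inCoords_planar {π : R3 → Bivec} {φ : R3 → R3} {p : R3} {u F G : ℝ}
    {X Y S : ℝ × (ℝ × ℝ) → ℝ} (hX : ContDiff ℝ ∞ X) (hY : ContDiff ℝ ∞ Y) (hS : ContDiff ℝ ∞ S)
    (ε : ℝ) (hφ : DifferentiableAt ℝ φ p) (hb : inCoords π φ p = bivec u F G) :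
    inCoords π (fun x => planarMap X Y S (ε, φ x)) p =
      bivec (jac X Y (plane (ε, φ p)) * u)
        (φ p 2 * u * (dx Y (plane (ε, φ p)) * dy S (plane (ε, φ p))
            - dy Y (plane (ε, φ p)) * dx S (plane (ε, φ p)))
          + S (plane (ε, φ p)) * (dy Y (plane (ε, φ p)) * F - dx Y (plane (ε, φ p)) * G))
        (φ p 2 * u * (dx S (plane (ε, φ p)) * dy X (plane (ε, φ p))
            - dy S (plane (ε, φ p)) * dx X (plane (ε, φ p)))
          + S (plane (ε, φ p)) * (dx X (plane (ε, φ p)) * G - dy X (plane (ε, φ p)) * F)) := by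
  have hd : ∀ i, DifferentiableAt ℝ (fun w => planarMap X Y S (ε, w) i) (φ p) :=
    fun i => ((contDiff_pi.1 ((contDiff_planarMap hX hY hS).comp
      (contDiff_prodMk_right ε)) i).differentiable (by simp)) _
  have hcomp : ∀ i j, inCoords π (fun x => planarMap X Y S (ε, φ x)) p i j
      = bracket (fun _ => bivec u F G) (fun w => planarMap X Y S (ε, w) i)
        (fun w => planarMap X Y S (ε, w) j) (φ p) := fun i j => by
    rw [← hb]
    exact bracket_comp (f := fun w => planarMap X Y S (ε, w) i)
      (g := fun w => planarMap X Y S (ε, w) j) hφ (hd i) (hd j)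
  rw [eq_bivec (M := inCoords π (fun x => planarMap X Y S (ε, φ x)) p) (fun i j => by
    rw [hcomp, hcomp]
    exact bracket_swap (fun i j => bivec_antisymm _ _ _ i j) _ _)]
  rw [hcomp, hcomp, hcomp]
  simp only [planarMap, Matrix.cons_val_zero, Matrix.cons_val_one, Matrix.cons_val]
  simp only [bracket_bivec, fderiv_comp_plane hX, fderiv_comp_plane hY, fderiv_mul_coord hS]
  generalize plane (ε, φ p) = v
  simp only [Pi.single_eq_same, Pi.single_eq_of_ne, ne_eq, Fin.reduceEq, not_false_eq_true,
    one_ne_zero, zero_ne_one, jac]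
  congr 1 <;> ring

theorem exists_smooth_inv {J : ℝ × (ℝ × ℝ) → ℝ} (hJ : ContDiff ℝ ∞ J) (h0 : J (0, 0) ≠ 0) :
    ∃ I : ℝ × (ℝ × ℝ) → ℝ, ContDiff ℝ ∞ I ∧ ∀ᶠ q in 𝓝 (0, 0), I q * J q = 1 := by
  have hne : ∀ᶠ q in 𝓝 (0, 0), J q ≠ 0 := hJ.continuous.continuousAt.eventually_ne h0
  have hs : SmoothNear (fun q => (J q)⁻¹) (0, 0) := by
    filter_upwards [hne] with q hq
    exact hJ.contDiffAt.inv hq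
  obtain ⟨I, hI, hII⟩ := hs.exists_contDiff
  refine ⟨I, hI, ?_⟩
  filter_upwards [hne, hII] with q hq hq'
  rw [hq', inv_mul_cancel₀ hq]

/-- A change of the coordinates `x, y` with Jacobian determinant `J`, followed by `z ↦ J z`,
preserves the reduced form: it multiplies `C` and the form `A dx + B dy` by `J`. -/
theorem Reduction.exists_change {P : ℝ → R3 → Bivec} (R : Reduction P)
    {K₀ K₁ : ℝ × (ℝ × ℝ) → ℝ} (h₀ : ContDiff ℝ ∞ K₀) (h₁ : ContDiff ℝ ∞ K₁)
    (h₀0 : K₀ (0, 0) = 0) (h₁0 : K₁ (0, 0) = 0) (hJ0 : jac K₀ K₁ (0, 0) ≠ 0) :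
    ∃ R' : Reduction P, ∀ᶠ q in 𝓝 (0, 0),
      R'.A (q.1, (K₀ q, K₁ q)) = dy K₁ q * R.A q - dx K₁ q * R.B q ∧
      R'.B (q.1, (K₀ q, K₁ q)) = dx K₀ q * R.B q - dy K₀ q * R.A q ∧
      R'.C (q.1, (K₀ q, K₁ q)) = jac K₀ K₁ q * R.C q := by
  obtain ⟨k, hk, hk0, -, hkK⟩ := exists_family_inverse (Φ := fun q => (K₀ q, K₁ q))
    ((h₀.prodMk h₁).smoothNear _) (by simp [h₀0, h₁0]) (injective_planar h₀ h₁ hJ0)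
  have hJ := contDiff_jac h₀ h₁
  obtain ⟨I, hI, hIJ⟩ := exists_smooth_inv hJ hJ0
  set kk : ℝ × (ℝ × ℝ) → ℝ × (ℝ × ℝ) := fun q => (q.1, k q) with hkk
  have hkks : ContDiff ℝ ∞ kk := contDiff_fst.prodMk hk
  have hkK' : ∀ᶠ q in 𝓝 (0, 0), kk (q.1, (K₀ q, K₁ q)) = q := by
    filter_upwards [hkK] with q hq
    exact Prod.ext rfl hq
  set m : ℝ × R3 → ℝ × R3 := fun q => lift (kk (plane q)) (I (kk (plane q)) * q.2 2) with hm
  have hkp : ContDiff ℝ ∞ fun q : ℝ × R3 => kk (plane q) := hkks.comp plane.contDiff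
  have hms : ContDiff ℝ ∞ m := contDiff_lift.comp (hkp.prodMk ((hI.comp hkp).mul
    ((contDiff_apply ℝ ℝ 2).comp contDiff_snd)))
  set A' : ℝ × (ℝ × ℝ) → ℝ := fun q =>
    dy K₁ (kk q) * R.A (kk q) - dx K₁ (kk q) * R.B (kk q) with hA'
  set B' : ℝ × (ℝ × ℝ) → ℝ := fun q =>
    dx K₀ (kk q) * R.B (kk q) - dy K₀ (kk q) * R.A (kk q) with hB'
  set C' : ℝ × (ℝ × ℝ) → ℝ := fun q => jac K₀ K₁ (kk q) * R.C (kk q) with hC'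
  set Q' : (ℝ × (ℝ × ℝ) → ℝ) → (ℝ × R3 → ℝ) → ℝ × R3 → ℝ := fun T U q =>
    I (kk (plane q)) ^ 2 * (T (kk (plane q)) + jac K₀ K₁ (kk (plane q)) * U (m q)) with hQ'
  have hQ's : ∀ {T U}, ContDiff ℝ ∞ T → ContDiff ℝ ∞ U → ContDiff ℝ ∞ (Q' T U) := fun hT hU =>
    ((hI.comp hkp).pow 2).mul ((hT.comp hkp).add ((hJ.comp hkp).mul (hU.comp hms)))
  have hx0 := contDiff_dx h₀
  have hy0 := contDiff_dy h₀
  have hx1 := contDiff_dx h₁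
  have hy1 := contDiff_dy h₁
  have hxJ := contDiff_dx hJ
  have hyJ := contDiff_dy hJ
  have hAs := R.smooth_A
  have hBs := R.smooth_B
  have hCs := R.smooth_C
  have hQ₁ := R.smooth_Q₁
  have hQ₂ := R.smooth_Q₂
  refine ⟨{
    Φ := fun ε p => planarMap K₀ K₁ (jac K₀ K₁) (ε, R.Φ ε p)
    A := A'
    B := B'
    C := C'
    Q₁ := Q' (fun q => dx K₁ q * dy (jac K₀ K₁) q - dy K₁ q * dx (jac K₀ K₁) q)
      (fun q => dy K₁ (plane q) * R.Q₁ q - dx K₁ (plane q) * R.Q₂ q)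
    Q₂ := Q' (fun q => dx (jac K₀ K₁) q * dy K₀ q - dy (jac K₀ K₁) q * dx K₀ q)
      (fun q => dx K₀ (plane q) * R.Q₂ q - dy K₀ (plane q) * R.Q₁ q)
    chart := R.chart.planar h₀ h₁ hJ h₀0 h₁0 hJ0 hJ0
    smooth_A := by fun_prop
    smooth_B := by fun_prop
    smooth_C := by fun_prop
    smooth_Q₁ := hQ's ((hx1.mul hyJ).sub (hy1.mul hxJ)) (((hy1.comp plane.contDiff).mul hQ₁).sub
      ((hx1.comp plane.contDiff).mul hQ₂))
    smooth_Q₂ := hQ's ((hxJ.mul hy0).sub (hyJ.mul hx0)) (((hx0.comp plane.contDiff).mul hQ₂).sub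
      ((hy0.comp plane.contDiff).mul hQ₁))
    brackets := ?_ }, ?_⟩
  · have hpl : Tendsto (fun q : ℝ × R3 => plane (q.1, R.Φ q.1 q.2)) (𝓝 (0, 0)) (𝓝 (0, 0)) :=
      (plane.continuous.tendsto' (0, 0) (0, 0) rfl).comp R.chart.tendsto
    filter_upwards [R.brackets, R.chart.eventually_smoothNear, hpl.eventually hkK',
      hpl.eventually hIJ] with q hb hs hkq hIq
    set w := R.Φ q.1 q.2 with hw
    set ε := q.1 with hε
    refine (inCoords_planar h₀ h₁ hJ ε (hs.contDiffAt.differentiableAt (by simp)) hb).trans ?_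
    have e1 : planarMap K₀ K₁ (jac K₀ K₁) (ε, w) 2 = jac K₀ K₁ (plane (ε, w)) * w 2 := rfl
    have hmq : m (ε, planarMap K₀ K₁ (jac K₀ K₁) (ε, w)) = (ε, w) := by
      have e1 : plane (ε, planarMap K₀ K₁ (jac K₀ K₁) (ε, w)) =
        (ε, (K₀ (plane (ε, w)), K₁ (plane (ε, w)))) := rfl
      have e2 : planarMap K₀ K₁ (jac K₀ K₁) (ε, w) 2 = jac K₀ K₁ (plane (ε, w)) * w 2 := rfl
      have hkq' : kk (ε, (K₀ (plane (ε, w)), K₁ (plane (ε, w)))) = plane (ε, w) := hkq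
      simp only [hm, e1, hkq', e2, ← mul_assoc, hIq, one_mul]
      exact lift_plane (ε, w)
    have hkq' : kk (plane (ε, planarMap K₀ K₁ (jac K₀ K₁) (ε, w))) = plane (ε, w) := hkq
    simp only [reducedForm, hA', hB', hC', hQ', hkq', hmq]
    simp only [e1, ← hw]
    set v := plane (ε, w) with hv
    have hI2 : jac K₀ K₁ v ^ 2 * I v ^ 2 = 1 := by rw [← mul_pow, mul_comm, hIq, one_pow]
    congr 1
    · linear_combination (-(w 2 ^ 2 * ((dx K₁ v * dy (jac K₀ K₁) v - dy K₁ v * dx (jac K₀ K₁) v) +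
        jac K₀ K₁ v * (dy K₁ v * R.Q₁ (ε, w) - dx K₁ v * R.Q₂ (ε, w))))) * hI2
    · linear_combination (-(w 2 ^ 2 * ((dx (jac K₀ K₁) v * dy K₀ v - dy (jac K₀ K₁) v * dx K₀ v) +
        jac K₀ K₁ v * (dx K₀ v * R.Q₂ (ε, w) - dy K₀ v * R.Q₁ (ε, w))))) * hI2
  · filter_upwards [hkK'] with q hq
    simp only [hA', hB', hC', hq, and_self]

/-! ### Partial derivatives and Taylor expansions in the plane -/

section Partial

variable {f g : ℝ × (ℝ × ℝ) → ℝ} {q : ℝ × (ℝ × ℝ)}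

theorem hasFDerivAt_of_contDiff (hf : ContDiff ℝ ∞ f) (q : ℝ × (ℝ × ℝ)) :
    HasFDerivAt f (fderiv ℝ f q) q := ((hf.differentiable (by simp)) q).hasFDerivAt

theorem dx_congr (h : f =ᶠ[𝓝 q] g) : dx f q = dx g q := by simp only [dx, h.fderiv_eq]

theorem dy_congr (h : f =ᶠ[𝓝 q] g) : dy f q = dy g q := by simp only [dy, h.fderiv_eq]

theorem dx_sub (hf : ContDiff ℝ ∞ f) (hg : ContDiff ℝ ∞ g) :
    dx (fun q => f q - g q) q = dx f q - dx g q := by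
  have h : HasFDerivAt (fun q => f q - g q) _ q :=
    (hasFDerivAt_of_contDiff hf q).sub (hasFDerivAt_of_contDiff hg q)
  simp [dx, h.fderiv]

theorem dy_sub (hf : ContDiff ℝ ∞ f) (hg : ContDiff ℝ ∞ g) :
    dy (fun q => f q - g q) q = dy f q - dy g q := by
  have h : HasFDerivAt (fun q => f q - g q) _ q :=
    (hasFDerivAt_of_contDiff hf q).sub (hasFDerivAt_of_contDiff hg q)
  simp [dy, h.fderiv]

theorem dx_add (hf : ContDiff ℝ ∞ f) (hg : ContDiff ℝ ∞ g) :
    dx (fun q => f q + g q) q = dx f q + dx g q := by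
  have h : HasFDerivAt (fun q => f q + g q) _ q :=
    (hasFDerivAt_of_contDiff hf q).add (hasFDerivAt_of_contDiff hg q)
  simp [dx, h.fderiv]

theorem dy_add (hf : ContDiff ℝ ∞ f) (hg : ContDiff ℝ ∞ g) :
    dy (fun q => f q + g q) q = dy f q + dy g q := by
  have h : HasFDerivAt (fun q => f q + g q) _ q :=
    (hasFDerivAt_of_contDiff hf q).add (hasFDerivAt_of_contDiff hg q)
  simp [dy, h.fderiv]

theorem dx_mul (hf : ContDiff ℝ ∞ f) (hg : ContDiff ℝ ∞ g) :
    dx (fun q => f q * g q) q = dx f q * g q + f q * dx g q := by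
  have h : HasFDerivAt (fun q => f q * g q) _ q :=
    (hasFDerivAt_of_contDiff hf q).mul (hasFDerivAt_of_contDiff hg q)
  simp [dx, h.fderiv]
  ring

theorem dy_mul (hf : ContDiff ℝ ∞ f) (hg : ContDiff ℝ ∞ g) :
    dy (fun q => f q * g q) q = dy f q * g q + f q * dy g q := by
  have h : HasFDerivAt (fun q => f q * g q) _ q :=
    (hasFDerivAt_of_contDiff hf q).mul (hasFDerivAt_of_contDiff hg q)
  simp [dy, h.fderiv]
  ring

theorem dx_eq_of_hasDerivAt (hf : ContDiff ℝ ∞ f) {ε x y a : ℝ}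
    (h : HasDerivAt (fun x => f (ε, (x, y))) a x) : dx f (ε, (x, y)) = a := by
  have h1 : HasDerivAt (fun x : ℝ => (ε, (x, y))) (0, (1, 0)) x :=
    (hasDerivAt_const _ _).prodMk ((hasDerivAt_id x).prodMk (hasDerivAt_const _ _))
  exact ((hasFDerivAt_of_contDiff hf (ε, (x, y))).comp_hasDerivAt x h1).unique h

theorem dy_eq_of_hasDerivAt (hf : ContDiff ℝ ∞ f) {ε x y a : ℝ}
    (h : HasDerivAt (fun y => f (ε, (x, y))) a y) : dy f (ε, (x, y)) = a := by
  have h1 : HasDerivAt (fun y : ℝ => (ε, (x, y))) (0, (0, 1)) y :=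
    (hasDerivAt_const _ _).prodMk ((hasDerivAt_const _ _).prodMk (hasDerivAt_id y))
  exact ((hasFDerivAt_of_contDiff hf (ε, (x, y))).comp_hasDerivAt y h1).unique h

theorem dx_fst_mul {c : ℝ → ℝ} (hc : ContDiff ℝ ∞ c) (hf : ContDiff ℝ ∞ f) :
    dx (fun q => c q.1 * f q) q = c q.1 * dx f q := by
  have hc' : ContDiff ℝ ∞ fun q : ℝ × (ℝ × ℝ) => c q.1 := hc.comp contDiff_fst
  have h0 : dx (fun q : ℝ × (ℝ × ℝ) => c q.1) q = 0 :=
    dx_eq_of_hasDerivAt (x := q.2.1) hc' (hasDerivAt_const q.2.1 (c q.1))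
  rw [dx_mul hc' hf, h0, zero_mul, zero_add]

theorem dy_fst_mul {c : ℝ → ℝ} (hc : ContDiff ℝ ∞ c) (hf : ContDiff ℝ ∞ f) :
    dy (fun q => c q.1 * f q) q = c q.1 * dy f q := by
  have hc' : ContDiff ℝ ∞ fun q : ℝ × (ℝ × ℝ) => c q.1 := hc.comp contDiff_fst
  have h0 : dy (fun q : ℝ × (ℝ × ℝ) => c q.1) q = 0 :=
    dy_eq_of_hasDerivAt (y := q.2.2) hc' (hasDerivAt_const q.2.2 (c q.1))
  rw [dy_mul hc' hf, h0, zero_mul, zero_add]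

theorem fderiv_comp_planar (hf : ContDiff ℝ ∞ f) {K₀ K₁ : ℝ × (ℝ × ℝ) → ℝ}
    (h₀ : ContDiff ℝ ∞ K₀) (h₁ : ContDiff ℝ ∞ K₁) (v : ℝ × ℝ) :
    fderiv ℝ (fun q => f (q.1, (K₀ q, K₁ q))) q (0, v) =
      fderiv ℝ K₀ q (0, v) * dx f (q.1, (K₀ q, K₁ q))
        + fderiv ℝ K₁ q (0, v) * dy f (q.1, (K₀ q, K₁ q)) := by
  have h1 : HasFDerivAt (fun q => (q.1, (K₀ q, K₁ q))) _ q := hasFDerivAt_fst.prodMk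
    ((hasFDerivAt_of_contDiff h₀ q).prodMk (hasFDerivAt_of_contDiff h₁ q))
  have h : HasFDerivAt (fun q => f (q.1, (K₀ q, K₁ q))) _ q :=
    (hasFDerivAt_of_contDiff hf _).comp q h1
  rw [h.fderiv]
  simp only [ContinuousLinearMap.comp_apply, ContinuousLinearMap.prod_apply,
    ContinuousLinearMap.coe_fst', fderiv_plane_direction]

theorem dx_comp_planar (hf : ContDiff ℝ ∞ f) {K₀ K₁ : ℝ × (ℝ × ℝ) → ℝ}
    (h₀ : ContDiff ℝ ∞ K₀) (h₁ : ContDiff ℝ ∞ K₁) :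
    dx (fun q => f (q.1, (K₀ q, K₁ q))) q =
      dx K₀ q * dx f (q.1, (K₀ q, K₁ q)) + dx K₁ q * dy f (q.1, (K₀ q, K₁ q)) :=
  fderiv_comp_planar hf h₀ h₁ _

theorem dy_comp_planar (hf : ContDiff ℝ ∞ f) {K₀ K₁ : ℝ × (ℝ × ℝ) → ℝ}
    (h₀ : ContDiff ℝ ∞ K₀) (h₁ : ContDiff ℝ ∞ K₁) :
    dy (fun q => f (q.1, (K₀ q, K₁ q))) q =
      dy K₀ q * dx f (q.1, (K₀ q, K₁ q)) + dy K₁ q * dy f (q.1, (K₀ q, K₁ q)) :=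
  fderiv_comp_planar hf h₀ h₁ _

theorem dx_dy_comm (hf : ContDiff ℝ ∞ f) : dx (dy f) q = dy (dx f) q := by
  have hd : HasFDerivAt (fderiv ℝ f) (fderiv ℝ (fderiv ℝ f) q) q :=
    (((hf.fderiv_right (m := ∞) (by simp)).differentiable (by simp)) q).hasFDerivAt
  have h : ∀ v w : ℝ × (ℝ × ℝ), fderiv ℝ (fun q => fderiv ℝ f q v) q w
      = fderiv ℝ (fderiv ℝ f) q w v := fun v w => by
    have := hd.clm_apply (hasFDerivAt_const v q)
    rw [this.fderiv]
    simp
  have hs := ((contDiff_infty.1 hf 2).contDiffAt (x := q)).isSymmSndFDerivAt (by simp)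
  exact (h _ _).trans ((hs _ _).trans (h _ _).symm)

theorem hasFDerivAt_slice (hf : ContDiff ℝ ∞ f) (ε : ℝ) (v : ℝ × ℝ) :
    HasFDerivAt (fun v => f (ε, v)) (dx f (ε, v) • ContinuousLinearMap.fst ℝ ℝ ℝ
      + dy f (ε, v) • ContinuousLinearMap.snd ℝ ℝ ℝ) v := by
  have h1 : DifferentiableAt ℝ (fun v => f (ε, v)) v :=
    ((hf.comp (contDiff_prodMk_right ε)).differentiable (by simp)) v
  refine h1.hasFDerivAt.congr_fderiv (ContinuousLinearMap.ext fun w => ?_)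
  rw [fderiv_slice hf, ← Prod.mk.eta (p := w), fderiv_plane_direction]
  simp [mul_comm]

/-- First order Taylor expansion in `(x, y)`. -/
theorem isLittleO_one (hf : ContDiff ℝ ∞ f) {ε a b : ℝ} (h0 : f (ε, 0) = 0)
    (ha : dx f (ε, 0) = a) (hb : dy f (ε, 0) = b) :
    (fun v : ℝ × ℝ => f (ε, v) - (a * v.1 + b * v.2)) =o[𝓝 0] fun v => ‖v‖ := by
  have h := hasFDerivAt_iff_isLittleO_nhds_zero.1 (hasFDerivAt_slice hf ε 0)
  refine (h.congr_left fun v => ?_).norm_right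
  simp [h0, ha, hb]

/-- Second order Taylor expansion in `(x, y)` at a critical point with diagonal Hessian. -/
theorem isLittleO_two (hf : ContDiff ℝ ∞ f) {ε a b : ℝ} (hx : dx f (ε, 0) = 0)
    (hy : dy f (ε, 0) = 0) (hxx : dx (dx f) (ε, 0) = 2 * a) (hyx : dy (dx f) (ε, 0) = 0)
    (hyy : dy (dy f) (ε, 0) = 2 * b) :
    (fun v : ℝ × ℝ => f (ε, v) - (f (ε, 0) + a * v.1 ^ 2 + b * v.2 ^ 2)) =o[𝓝 0]
      fun v => ‖v‖ ^ 2 := by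
  have h1 : ∀ v : ℝ × ℝ, HasFDerivAt (fun v : ℝ × ℝ => f (ε, v) - (f (ε, 0) + a * v.1 ^ 2
      + b * v.2 ^ 2)) ((dx f (ε, v) - (2 * a * v.1 + 0 * v.2)) • ContinuousLinearMap.fst ℝ ℝ ℝ
      + (dy f (ε, v) - (0 * v.1 + 2 * b * v.2)) • ContinuousLinearMap.snd ℝ ℝ ℝ) v := fun v => by
    have h2 : HasFDerivAt (fun v : ℝ × ℝ => v.1) (ContinuousLinearMap.fst ℝ ℝ ℝ) v :=
      hasFDerivAt_fst
    have h3 : HasFDerivAt (fun v : ℝ × ℝ => v.2) (ContinuousLinearMap.snd ℝ ℝ ℝ) v :=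
      hasFDerivAt_snd
    have h4 : HasFDerivAt
        (fun v : ℝ × ℝ => f (ε, v) - (f (ε, 0) + a * v.1 ^ 2 + b * v.2 ^ 2)) _ v :=
      (hasFDerivAt_slice hf ε v).sub
        ((((h2.pow 2).const_mul a).const_add (f (ε, 0))).add ((h3.pow 2).const_mul b))
    refine h4.congr_fderiv (ContinuousLinearMap.ext fun w => ?_)
    simp
    ring
  have h5 := isLittleO_sq_of_fderiv (.of_forall fun v => (h1 v).differentiableAt) (by
    rw [funext fun v => (h1 v).fderiv]
    have e1 := isLittleO_one (contDiff_dx hf) hx hxx hyx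
    have e2 := isLittleO_one (contDiff_dy hf) hy ((dx_dy_comm hf).trans hyx) hyy
    have c1 := e1.smul_isBigO (isBigO_refl (fun _ : ℝ × ℝ => ContinuousLinearMap.fst ℝ ℝ ℝ) _)
    have c2 := e2.smul_isBigO (isBigO_refl (fun _ : ℝ × ℝ => ContinuousLinearMap.snd ℝ ℝ ℝ) _)
    refine IsLittleO.add (c1.trans_isBigO ?_) (c2.trans_isBigO ?_)
    · exact (isBigO_refl _ _).smul (isBigO_const_const _ (one_ne_zero (α := ℝ)) _) |>.trans
        (by simpa using isBigO_refl _ _)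
    · exact (isBigO_refl _ _).smul (isBigO_const_const _ (one_ne_zero (α := ℝ)) _) |>.trans
        (by simpa using isBigO_refl _ _))
  simpa using h5

end Partial

/-! ### Existence of the normal form -/

namespace Reduction

variable {P : ℝ → R3 → Bivec}

theorem tendsto_prodMk_zero : Tendsto (fun ε : ℝ => (ε, (0 : ℝ × ℝ))) (𝓝 0) (𝓝 (0, 0)) :=
  Continuous.tendsto' (by fun_prop) _ _ rfl

/-- The linear system for `(∂A', ∂B')` that arises in `exists_diagonal`, solved by Cramer's rule. -/
theorem solve_adapted_system {a b c d τ ρ u v X Y : ℝ} (h : a * d - b * c ≠ 0)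
    (h₁ : (d - τ * c) / (a * d - b * c) * X + -(ρ * c) / (a * d - b * c) * Y = u)
    (h₂ : -(b - τ * a) / (a * d - b * c) * X + ρ * a / (a * d - b * c) * Y = v) :
    X = a * u + c * v ∧ ρ * Y = (b - τ * a) * u + (d - τ * c) * v := by
  subst h₁ h₂
  have hi := mul_inv_cancel₀ h
  simp only [div_eq_mul_inv]
  generalize (a * d - b * c)⁻¹ = i at hi
  exact ⟨by linear_combination -X * hi, by linear_combination -ρ * Y * hi⟩

/-- The point `A = B = 0` can be moved to the origin, and the linear part of `(A, B)`, which is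
symmetric at that point, can be diagonalized, for all `ε` simultaneously. -/
theorem exists_diagonal (hP : IsLocalPoissonFamily P) {σ : ℝ} (hσ : σ = 1 ∨ σ = -1)
    (R : Reduction P) (hA0 : R.A (0, 0) = 0) (hB0 : R.B (0, 0) = 0) (hC0 : R.C (0, 0) = 0)
    (S : Matrix (Fin 2) (Fin 2) ℝ) (hS : S.det ≠ 0)
    (hα : S 0 0 ^ 2 * dx R.A (0, 0) + 2 * (S 0 0 * S 1 0) * dy R.A (0, 0)
      + S 1 0 ^ 2 * dy R.B (0, 0) = 2)
    (hβ : S 0 0 * S 0 1 * dx R.A (0, 0) + (S 0 0 * S 1 1 + S 1 0 * S 0 1) * dy R.A (0, 0)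
      + S 1 0 * S 1 1 * dy R.B (0, 0) = 0)
    (hγ : S 0 1 ^ 2 * dx R.A (0, 0) + 2 * (S 0 1 * S 1 1) * dy R.A (0, 0)
      + S 1 1 ^ 2 * dy R.B (0, 0) = 2 * σ) :
    ∃ R' : Reduction P, dx R'.A (0, 0) ≠ 0 ∧ R'.C (0, 0) = 0 ∧ ∀ᶠ ε in 𝓝 (0 : ℝ),
      R'.A (ε, 0) = 0 ∧ R'.B (ε, 0) = 0 ∧ dy R'.A (ε, 0) = 0 ∧ dx R'.B (ε, 0) = 0 ∧
      dy R'.B (ε, 0) = σ * dx R'.A (ε, 0) := by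
  have hσ2 : σ * σ = 1 := by rcases hσ with rfl | rfl <;> norm_num
  have hΔ : S 0 0 * S 1 1 - S 0 1 * S 1 0 ≠ 0 := by rwa [Matrix.det_fin_two] at hS
  have hsym := (R.jacobi_coeff hP).mono fun q hq => hq.2
  have hsym0 : dx R.B (0, 0) = dy R.A (0, 0) := by
    have := hsym.self_of_nhds
    rw [hA0, hB0] at this
    linarith
  set s00 := S 0 0
  set s01 := S 0 1
  set s10 := S 1 0
  set s11 := S 1 1
  have hAs := R.smooth_A
  have hBs := R.smooth_B
  have hjac : jac R.A R.B (0, 0) ≠ 0 := by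
    have : (s00 * s11 - s01 * s10) ^ 2 * jac R.A R.B (0, 0) = 4 * σ := by
      rw [jac, hsym0]
      linear_combination (s01 ^ 2 * dx R.A (0, 0) + 2 * (s01 * s11) * dy R.A (0, 0)
        + s11 ^ 2 * dy R.B (0, 0)) * hα + 2 * hγ
        - (s00 * s01 * dx R.A (0, 0) + (s00 * s11 + s10 * s01) * dy R.A (0, 0)
        + s10 * s11 * dy R.B (0, 0)) * hβ
    intro h0
    rw [h0, mul_zero] at this
    rcases hσ with rfl | rfl <;> norm_num at this
  obtain ⟨k, hk, hk0, hAk, -⟩ := exists_family_inverse (Φ := fun q => (R.A q, R.B q))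
    ((hAs.prodMk hBs).smoothNear _) (by simp [hA0, hB0]) (injective_planar hAs hBs hjac)
  -- the zero of `(A, B)`
  set c : ℝ → ℝ × ℝ := fun ε => k (ε, 0) with hc
  have hcs : ContDiff ℝ ∞ c := hk.comp (contDiff_prodMk_left 0)
  have hc0 : c 0 = 0 := hk0
  have hcc : Tendsto (fun ε => (ε, c ε)) (𝓝 0) (𝓝 (0, 0)) :=
    (continuous_id.prodMk hcs.continuous).tendsto' _ _ (by simp [hc0])
  have hAc : ∀ᶠ ε in 𝓝 0, R.A (ε, c ε) = 0 ∧ R.B (ε, c ε) = 0 := by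
    filter_upwards [tendsto_prodMk_zero.eventually hAk] with ε hε
    exact Prod.ext_iff.1 hε
  have hsymc : ∀ᶠ ε in 𝓝 0, dx R.B (ε, c ε) = dy R.A (ε, c ε) := by
    filter_upwards [hAc, hcc.eventually hsym] with ε ⟨h1, h2⟩ h3
    rw [h1, h2] at h3
    linarith
  -- the matrix of the linear part in the basis given by the columns of `S`
  set p : ℝ → ℝ := fun ε => dx R.A (ε, c ε) with hp
  set m : ℝ → ℝ := fun ε => dy R.A (ε, c ε) with hm
  set r : ℝ → ℝ := fun ε => dy R.B (ε, c ε) with hr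
  have hps : ContDiff ℝ ∞ p := (contDiff_dx hAs).comp (contDiff_id.prodMk hcs)
  have hms : ContDiff ℝ ∞ m := (contDiff_dy hAs).comp (contDiff_id.prodMk hcs)
  have hrs : ContDiff ℝ ∞ r := (contDiff_dy hBs).comp (contDiff_id.prodMk hcs)
  set α : ℝ → ℝ := fun ε => s00 ^ 2 * p ε + 2 * (s00 * s10) * m ε + s10 ^ 2 * r ε with hαd
  set β : ℝ → ℝ := fun ε => s00 * s01 * p ε + (s00 * s11 + s10 * s01) * m ε + s10 * s11 * r ε
    with hβd
  set γ : ℝ → ℝ := fun ε => s01 ^ 2 * p ε + 2 * (s01 * s11) * m ε + s11 ^ 2 * r ε with hγd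
  have hαs : ContDiff ℝ ∞ α := by fun_prop
  have hβs : ContDiff ℝ ∞ β := by fun_prop
  have hγs : ContDiff ℝ ∞ γ := by fun_prop
  have hα0 : α 0 = 2 := by simp only [hαd, hp, hm, hr, hc0]; exact hα
  have hβ0 : β 0 = 0 := by simp only [hβd, hp, hm, hr, hc0]; exact hβ
  have hγ0 : γ 0 = 2 * σ := by simp only [hγd, hp, hm, hr, hc0]; exact hγ
  have hαne : ∀ᶠ ε in 𝓝 0, α ε ≠ 0 :=
    hαs.continuous.continuousAt.eventually_ne (by rw [hα0]; norm_num)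
  obtain ⟨τ, hτs, hτ⟩ := SmoothNear.exists_contDiff (f := fun ε => β ε / α ε) (a := 0) (by
    filter_upwards [hαne] with ε hε
    exact hβs.contDiffAt.div hαs.contDiffAt hε)
  have hτ0 : τ 0 = 0 := by simp [hτ.self_of_nhds, hβ0]
  have hpos : ∀ᶠ ε in 𝓝 0, 0 < σ * (γ ε - β ε * τ ε) / α ε := by
    have hcont : ContinuousAt (fun ε => σ * (γ ε - β ε * τ ε) / α ε) 0 := by
      have := hτs.continuous
      have := hαs.continuous
      have := hβs.continuous
      have := hγs.continuous
      exact ContinuousAt.div (by fun_prop) (by fun_prop) (by rw [hα0]; norm_num)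
    refine hcont.eventually_const_lt (u := 0) ?_
    simp only [hα0, hβ0, hγ0, zero_mul, sub_zero]
    linarith
  obtain ⟨ρ, hρs, hρ⟩ := SmoothNear.exists_contDiff
    (f := fun ε => Real.sqrt (σ * (γ ε - β ε * τ ε) / α ε)) (a := 0) (by
    filter_upwards [hαne, hpos] with ε hε hε'
    exact ((contDiffAt_const.mul (hγs.contDiffAt.sub (hβs.contDiffAt.mul hτs.contDiffAt))).div
      hαs.contDiffAt hε).sqrt hε'.ne')
  have hρ0 : ρ 0 ≠ 0 := by
    rw [hρ.self_of_nhds]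
    exact (Real.sqrt_pos.2 hpos.self_of_nhds).ne'
  set Δ := s00 * s11 - s01 * s10 with hΔd
  set K₀ : ℝ × (ℝ × ℝ) → ℝ := fun q => ((s11 - τ q.1 * s10) * (q.2.1 - (c q.1).1)
    - (s01 - τ q.1 * s00) * (q.2.2 - (c q.1).2)) / Δ with hK₀
  set K₁ : ℝ × (ℝ × ℝ) → ℝ := fun q => ρ q.1 * (s00 * (q.2.2 - (c q.1).2)
    - s10 * (q.2.1 - (c q.1).1)) / Δ with hK₁
  have h₀ : ContDiff ℝ ∞ K₀ := by fun_prop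
  have h₁ : ContDiff ℝ ∞ K₁ := by fun_prop
  have hid : ∀ b x : ℝ, HasDerivAt (fun x => x - b) 1 x := fun b x => (hasDerivAt_id x).sub_const b
  have d1 : ∀ q, dx K₀ q = (s11 - τ q.1 * s10) / Δ := fun q =>
    dx_eq_of_hasDerivAt (x := q.2.1) h₀ (by
      simpa using ((((hid (c q.1).1 q.2.1).const_mul (s11 - τ q.1 * s10)).sub_const
        ((s01 - τ q.1 * s00) * (q.2.2 - (c q.1).2))).div_const Δ))
  have d2 : ∀ q, dy K₀ q = -(s01 - τ q.1 * s00) / Δ := fun q =>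
    dy_eq_of_hasDerivAt (y := q.2.2) h₀ (by
      simpa using ((((hid (c q.1).2 q.2.2).const_mul (s01 - τ q.1 * s00)).const_sub
        ((s11 - τ q.1 * s10) * (q.2.1 - (c q.1).1))).div_const Δ))
  have d3 : ∀ q, dx K₁ q = -(ρ q.1 * s10) / Δ := fun q =>
    dx_eq_of_hasDerivAt (x := q.2.1) h₁ (by
      simpa using (((((hid (c q.1).1 q.2.1).const_mul s10).const_sub
        (s00 * (q.2.2 - (c q.1).2))).const_mul (ρ q.1)).div_const Δ))
  have d4 : ∀ q, dy K₁ q = ρ q.1 * s00 / Δ := fun q =>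
    dy_eq_of_hasDerivAt (y := q.2.2) h₁ (by
      simpa using (((((hid (c q.1).2 q.2.2).const_mul s00).sub_const
        (s10 * (q.2.1 - (c q.1).1))).const_mul (ρ q.1)).div_const Δ))
  have hJ : ∀ q, jac K₀ K₁ q = ρ q.1 / Δ := fun q => by
    rw [jac, d1, d2, d3, d4]
    field_simp
    rw [hΔd]
    ring
  have hK₀c : ∀ ε, K₀ (ε, c ε) = 0 := fun ε => by simp [hK₀]
  have hK₁c : ∀ ε, K₁ (ε, c ε) = 0 := fun ε => by simp [hK₁]
  have hK₀0 : K₀ (0, 0) = 0 := by simpa [hc0] using hK₀c 0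
  have hK₁0 : K₁ (0, 0) = 0 := by simpa [hc0] using hK₁c 0
  obtain ⟨R', hR'⟩ := R.exists_change h₀ h₁ hK₀0 hK₁0
    (by rw [hJ]; exact div_ne_zero hρ0 hΔ)
  have hmain : ∀ᶠ ε in 𝓝 (0 : ℝ), R'.A (ε, 0) = 0 ∧ R'.B (ε, 0) = 0 ∧
      dx R'.A (ε, 0) = ρ ε / Δ * α ε ∧ dy R'.A (ε, 0) = 0 ∧ dx R'.B (ε, 0) = 0 ∧
      dy R'.B (ε, 0) = σ * (ρ ε / Δ * α ε) := by
    filter_upwards [hcc.eventually hR'.eventually_nhds, hAc, hsymc, hτ, hαne, hρ, hpos]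
      with ε hε ⟨hA, hB⟩ hsy hτε hαε hρε hpε
    have hτα : τ ε * α ε = β ε := by rw [hτε, div_mul_cancel₀ _ hαε]
    have hρ2 : ρ ε ^ 2 * α ε = σ * (γ ε - β ε * τ ε) := by
      rw [hρε, Real.sq_sqrt hpε.le, div_mul_cancel₀ _ hαε]
    have hρne : ρ ε ≠ 0 := by rw [hρε]; exact (Real.sqrt_pos.2 hpε).ne'
    have e0 := hε.self_of_nhds
    simp only [hK₀c, hK₁c, hA, hB, mul_zero, sub_zero] at e0
    have eA : (fun q => R'.A (q.1, (K₀ q, K₁ q))) =ᶠ[𝓝 (ε, c ε)]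
        fun q => ρ q.1 * s00 / Δ * R.A q - -(ρ q.1 * s10) / Δ * R.B q := by
      filter_upwards [hε] with q hq
      rw [hq.1, d3, d4]
    have eB : (fun q => R'.B (q.1, (K₀ q, K₁ q))) =ᶠ[𝓝 (ε, c ε)]
        fun q => (s11 - τ q.1 * s10) / Δ * R.B q - -(s01 - τ q.1 * s00) / Δ * R.A q := by
      filter_upwards [hε] with q hq
      rw [hq.2.1, d1, d2]
    have a1 : ContDiff ℝ ∞ fun ε => ρ ε * s00 / Δ := by fun_prop
    have a2 : ContDiff ℝ ∞ fun ε => -(ρ ε * s10) / Δ := by fun_prop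
    have a3 : ContDiff ℝ ∞ fun ε => (s11 - τ ε * s10) / Δ := by fun_prop
    have a4 : ContDiff ℝ ∞ fun ε => -(s01 - τ ε * s00) / Δ := by fun_prop
    have m1 : ∀ {b : ℝ → ℝ} {f : ℝ × (ℝ × ℝ) → ℝ}, ContDiff ℝ ∞ b → ContDiff ℝ ∞ f →
        ContDiff ℝ ∞ fun q : ℝ × (ℝ × ℝ) => b q.1 * f q := fun hb hf =>
      (hb.comp contDiff_fst).mul hf
    have xA := dx_congr eA
    have yA := dy_congr eA
    have xB := dx_congr eB
    have yB := dy_congr eB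
    rw [dx_comp_planar R'.smooth_A h₀ h₁, dx_sub (m1 a1 hAs) (m1 a2 hBs), dx_fst_mul a1 hAs,
      dx_fst_mul a2 hBs, d1, d3] at xA
    rw [dy_comp_planar R'.smooth_A h₀ h₁, dy_sub (m1 a1 hAs) (m1 a2 hBs), dy_fst_mul a1 hAs,
      dy_fst_mul a2 hBs, d2, d4] at yA
    rw [dx_comp_planar R'.smooth_B h₀ h₁, dx_sub (m1 a3 hBs) (m1 a4 hAs), dx_fst_mul a3 hBs,
      dx_fst_mul a4 hAs, d1, d3] at xB
    rw [dy_comp_planar R'.smooth_B h₀ h₁, dy_sub (m1 a3 hBs) (m1 a4 hAs), dy_fst_mul a3 hBs,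
      dy_fst_mul a4 hAs, d2, d4] at yB
    simp only [hK₀c, hK₁c, hsy] at xA yA xB yB
    change _ = _ * p ε - _ * m ε at xA
    change _ = _ * m ε - _ * r ε at yA
    change _ = _ * m ε - _ * p ε at xB
    change _ = _ * r ε - _ * m ε at yB
    rw [← Prod.zero_eq_mk] at e0 xA yA xB yB
    have hα' : α ε = s00 ^ 2 * p ε + 2 * (s00 * s10) * m ε + s10 ^ 2 * r ε := rfl
    have hβ' : β ε = s00 * s01 * p ε + (s00 * s11 + s10 * s01) * m ε + s10 * s11 * r ε := rfl
    have hγ' : γ ε = s01 ^ 2 * p ε + 2 * (s01 * s11) * m ε + s11 ^ 2 * r ε := rfl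
    obtain ⟨sA1, sA2⟩ := solve_adapted_system hΔ xA yA
    obtain ⟨sB1, sB2⟩ := solve_adapted_system hΔ xB yB
    refine ⟨e0.1, e0.2.1, ?_, ?_, ?_, ?_⟩
    · rw [sA1, hα']
      ring
    · refine mul_left_cancel₀ hρne ?_
      rw [sA2, mul_zero]
      linear_combination (ρ ε / Δ) * (τ ε * hα' - hβ' - hτα)
    · rw [sB1]
      linear_combination (1 / Δ) * (τ ε * hα' - hβ' - hτα)
    · refine mul_left_cancel₀ hρne ?_
      rw [sB2]
      linear_combination (1 / Δ) * (-hγ' + 2 * τ ε * hβ' - τ ε ^ 2 * hα' + τ ε * hτα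
        - σ * hρ2 - (γ ε - β ε * τ ε) * hσ2)
  refine ⟨R', ?_, ?_, hmain.mono fun ε h => ⟨h.1, h.2.1, h.2.2.2.1, h.2.2.2.2.1, ?_⟩⟩
  · have := hmain.self_of_nhds.2.2.1
    rw [hα0] at this
    rw [Prod.mk_zero_zero] at this ⊢
    rw [this]
    exact mul_ne_zero (div_ne_zero hρ0 hΔ) two_ne_zero
  · have := hR'.self_of_nhds.2.2
    rwa [hK₀0, hK₁0, hC0, mul_zero] at this
  · rw [h.2.2.2.2.2, h.2.2.1]

end Reduction

theorem hasDerivAt_cubic (c₀ c₁ c₂ c₃ x : ℝ) :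
    HasDerivAt (fun x : ℝ => c₀ + c₁ * x + c₂ * x ^ 2 + c₃ * x ^ 3)
      (c₁ + 2 * c₂ * x + 3 * c₃ * x ^ 2) x := by
  have h := hasDerivAt_id x
  have := (((h.const_mul c₁).const_add c₀).add ((h.pow 2).const_mul c₂)).add
    ((h.pow 3).const_mul c₃)
  refine HasDerivAt.congr_deriv (f := fun x : ℝ => c₀ + c₁ * x + c₂ * x ^ 2 + c₃ * x ^ 3) this ?_
  simp
  ring

section

variable {a C J h A D f X : ℝ × (ℝ × ℝ) → ℝ} {q : ℝ × (ℝ × ℝ)}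

theorem dx_sum_prod (ha : ContDiff ℝ ∞ a) (hC : ContDiff ℝ ∞ C) (hJ : ContDiff ℝ ∞ J)
    (hh : ContDiff ℝ ∞ h) (hA : ContDiff ℝ ∞ A) (hD : ContDiff ℝ ∞ D) :
    dx (fun q => a q * C q + J q * (h q * A q - C q * D q)) q =
      dx a q * C q + a q * dx C q + dx J q * (h q * A q - C q * D q)
        + J q * (dx h q * A q + h q * dx A q - (dx C q * D q + C q * dx D q)) := by
  rw [dx_add (ha.mul hC) (hJ.mul ((hh.mul hA).sub (hC.mul hD))), dx_mul ha hC,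
    dx_mul hJ ((hh.mul hA).sub (hC.mul hD)), dx_sub (hh.mul hA) (hC.mul hD), dx_mul hh hA,
    dx_mul hC hD]
  ring

theorem dy_sum_prod (ha : ContDiff ℝ ∞ a) (hC : ContDiff ℝ ∞ C) (hJ : ContDiff ℝ ∞ J)
    (hh : ContDiff ℝ ∞ h) (hA : ContDiff ℝ ∞ A) (hD : ContDiff ℝ ∞ D) :
    dy (fun q => a q * C q + J q * (h q * A q - C q * D q)) q =
      dy a q * C q + a q * dy C q + dy J q * (h q * A q - C q * D q)
        + J q * (dy h q * A q + h q * dy A q - (dy C q * D q + C q * dy D q)) := by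
  rw [dy_add (ha.mul hC) (hJ.mul ((hh.mul hA).sub (hC.mul hD))), dy_mul ha hC,
    dy_mul hJ ((hh.mul hA).sub (hC.mul hD)), dy_sub (hh.mul hA) (hC.mul hD), dy_mul hh hA,
    dy_mul hC hD]
  ring

theorem dx_snd : dx (fun q => q.2.2) q = 0 :=
  dx_eq_of_hasDerivAt (x := q.2.1) (by fun_prop) (hasDerivAt_const q.2.1 q.2.2)

theorem dy_snd : dy (fun q => q.2.2) q = 1 :=
  dy_eq_of_hasDerivAt (y := q.2.2) (by fun_prop) (hasDerivAt_id q.2.2)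

theorem dx_comp_shear (hf : ContDiff ℝ ∞ f) (hX : ContDiff ℝ ∞ X) :
    dx (fun q => f (q.1, (X q, q.2.2))) q = dx X q * dx f (q.1, (X q, q.2.2)) := by
  rw [dx_comp_planar hf hX (K₁ := fun q => q.2.2) (by fun_prop), dx_snd, zero_mul, add_zero]

theorem dy_comp_shear (hf : ContDiff ℝ ∞ f) (hX : ContDiff ℝ ∞ X) :
    dy (fun q => f (q.1, (X q, q.2.2))) q =
      dy X q * dx f (q.1, (X q, q.2.2)) + dy f (q.1, (X q, q.2.2)) := by
  rw [dy_comp_planar hf hX (K₁ := fun q => q.2.2) (by fun_prop), dy_snd, one_mul]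

end

namespace Reduction

variable {P : ℝ → R3 → Bivec}

/-- Once the linear part of `(A, B)` is diagonal, a change `x ↦ X(x, y)` whose Jacobian
determinant has a suitable `2`-jet brings `C` to the required form. -/
theorem nonempty_normalForm (hP : IsLocalPoissonFamily P) {σ : ℝ} (hσ : σ = 1 ∨ σ = -1)
    (R : Reduction P) (hl : dx R.A (0, 0) ≠ 0) (hC0 : R.C (0, 0) = 0)
    (hdiag : ∀ᶠ ε in 𝓝 (0 : ℝ), R.A (ε, 0) = 0 ∧ R.B (ε, 0) = 0 ∧ dy R.A (ε, 0) = 0 ∧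
      dx R.B (ε, 0) = 0 ∧ dy R.B (ε, 0) = σ * dx R.A (ε, 0)) :
    Nonempty (NormalForm σ P) := by
  have hAs := R.smooth_A
  have hBs := R.smooth_B
  have hCs := R.smooth_C
  have hD₁ := R.contDiff_D₁
  have hD₂ := R.contDiff_D₂
  obtain ⟨z1, z2, z3, z4, z5⟩ := hdiag.self_of_nhds
  obtain ⟨h, hh, hdC⟩ := R.exists_dC_eq hP z1 z2 (injective_planar hAs hBs (by
    rw [jac]
    have z3' : dy R.A (0, 0) = 0 := z3
    have z5' : dy R.B (0, 0) = σ * dx R.A (0, 0) := z5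
    rw [z3', z5', zero_mul, sub_zero]
    rcases hσ with rfl | rfl <;> simpa using hl))
  -- `J` is the `2`-jet of `exp (l + q)`, where the linear form `l` is the value of `D` at the
  -- origin and the quadratic form `q` has the symmetric part of the derivative of `D` as Hessian;
  -- thus `dJ - J D` vanishes at the origin and has an antisymmetric derivative there
  set d₁ : ℝ → ℝ := fun ε => R.D₁ (ε, 0) with hd₁
  set d₂ : ℝ → ℝ := fun ε => R.D₂ (ε, 0) with hd₂
  set e₁ : ℝ → ℝ := fun ε => (dx R.D₁ (ε, 0) + d₁ ε ^ 2) / 2 with he₁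
  set e₂ : ℝ → ℝ := fun ε => (dy R.D₁ (ε, 0) + dx R.D₂ (ε, 0)) / 2 + d₁ ε * d₂ ε with he₂
  set e₃ : ℝ → ℝ := fun ε => (dy R.D₂ (ε, 0) + d₂ ε ^ 2) / 2 with he₃
  have hslice : ∀ {f : ℝ × (ℝ × ℝ) → ℝ}, ContDiff ℝ ∞ f → ContDiff ℝ ∞ fun ε : ℝ => f (ε, 0) :=
    fun hf => hf.comp (contDiff_prodMk_left 0)
  have hd₁s : ContDiff ℝ ∞ d₁ := hslice hD₁
  have hd₂s : ContDiff ℝ ∞ d₂ := hslice hD₂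
  have he₁s : ContDiff ℝ ∞ e₁ := ((hslice (contDiff_dx hD₁)).add (hd₁s.pow 2)).div_const 2
  have he₂s : ContDiff ℝ ∞ e₂ := (((hslice (contDiff_dy hD₁)).add
    (hslice (contDiff_dx hD₂))).div_const 2).add (hd₁s.mul hd₂s)
  have he₃s : ContDiff ℝ ∞ e₃ := ((hslice (contDiff_dy hD₂)).add (hd₂s.pow 2)).div_const 2
  set X : ℝ × (ℝ × ℝ) → ℝ := fun q => q.2.1 + d₁ q.1 * q.2.1 ^ 2 / 2 + d₂ q.1 * q.2.1 * q.2.2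
    + e₁ q.1 * q.2.1 ^ 3 / 3 + e₂ q.1 * q.2.1 ^ 2 * q.2.2 / 2 + e₃ q.1 * q.2.1 * q.2.2 ^ 2 with hX
  set J : ℝ × (ℝ × ℝ) → ℝ := fun q => 1 + d₁ q.1 * q.2.1 + d₂ q.1 * q.2.2
    + e₁ q.1 * q.2.1 ^ 2 + e₂ q.1 * q.2.1 * q.2.2 + e₃ q.1 * q.2.2 ^ 2 with hJ
  have hXs : ContDiff ℝ ∞ X := by fun_prop
  have hJs : ContDiff ℝ ∞ J := by fun_prop
  have xX : dx X = J := funext fun q => dx_eq_of_hasDerivAt (x := q.2.1) hXs <| by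
    convert! hasDerivAt_cubic 0 (1 + d₂ q.1 * q.2.2 + e₃ q.1 * q.2.2 ^ 2)
      (d₁ q.1 / 2 + e₂ q.1 * q.2.2 / 2) (e₁ q.1 / 3) q.2.1 using 1
    · ext x
      simp only [hX]
      ring
    · simp only [hJ]
      ring
  have yX : dy X = fun q => d₂ q.1 * q.2.1 + e₂ q.1 * q.2.1 ^ 2 / 2 + 2 * e₃ q.1 * q.2.1 * q.2.2 :=
    funext fun q => dy_eq_of_hasDerivAt (y := q.2.2) hXs <| by
      convert! hasDerivAt_cubic (q.2.1 + d₁ q.1 * q.2.1 ^ 2 / 2 + e₁ q.1 * q.2.1 ^ 3 / 3)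
        (d₂ q.1 * q.2.1 + e₂ q.1 * q.2.1 ^ 2 / 2) (e₃ q.1 * q.2.1) 0 q.2.2 using 1
      · ext x
        simp only [hX]
        ring
      · ring
  have xJ : dx J = fun q => d₁ q.1 + 2 * e₁ q.1 * q.2.1 + e₂ q.1 * q.2.2 :=
    funext fun q => dx_eq_of_hasDerivAt (x := q.2.1) hJs <| by
      convert! hasDerivAt_cubic (1 + d₂ q.1 * q.2.2 + e₃ q.1 * q.2.2 ^ 2)
        (d₁ q.1 + e₂ q.1 * q.2.2) (e₁ q.1) 0 q.2.1 using 1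
      · ext x
        simp only [hJ]
        ring
      · ring
  have yJ : dy J = fun q => d₂ q.1 + e₂ q.1 * q.2.1 + 2 * e₃ q.1 * q.2.2 :=
    funext fun q => dy_eq_of_hasDerivAt (y := q.2.2) hJs <| by
      convert! hasDerivAt_cubic (1 + d₁ q.1 * q.2.1 + e₁ q.1 * q.2.1 ^ 2)
        (d₂ q.1 + e₂ q.1 * q.2.1) (e₃ q.1) 0 q.2.2 using 1
      · ext x
        simp only [hJ]
        ring
      · ring
  have hxJs := contDiff_dx hJs
  have hyJs := contDiff_dy hJs
  have hyXs := contDiff_dy hXs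
  have xxJ : ∀ ε, dx (dx J) (ε, (0, 0)) = 2 * e₁ ε := fun ε => dx_eq_of_hasDerivAt hxJs <| by
    rw [xJ]
    convert! hasDerivAt_cubic (d₁ ε) (2 * e₁ ε) 0 0 0 using 1
    · ext x
      ring
    · ring
  have yxJ : ∀ ε, dy (dx J) (ε, (0, 0)) = e₂ ε := fun ε => dy_eq_of_hasDerivAt hxJs <| by
    rw [xJ]
    convert! hasDerivAt_cubic (d₁ ε) (e₂ ε) 0 0 0 using 1
    · ext x
      ring
    · ring
  have xyJ : ∀ ε, dx (dy J) (ε, (0, 0)) = e₂ ε := fun ε => (dx_dy_comm hJs).trans (yxJ ε)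
  have yyJ : ∀ ε, dy (dy J) (ε, (0, 0)) = 2 * e₃ ε := fun ε => dy_eq_of_hasDerivAt hyJs <| by
    rw [yJ]
    convert! hasDerivAt_cubic (d₂ ε) (2 * e₃ ε) 0 0 0 using 1
    · ext x
      ring
    · ring
  have hX0 : ∀ ε, X (ε, (0, 0)) = 0 := fun ε => by simp [hX]
  have hJ0 : ∀ ε, J (ε, (0, 0)) = 1 := fun ε => by simp [hJ]
  have hyX0 : ∀ ε, dy X (ε, (0, 0)) = 0 := fun ε => by simp [yX]
  have hxJ0 : ∀ ε, dx J (ε, (0, 0)) = d₁ ε := fun ε => by simp [xJ]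
  have hyJ0 : ∀ ε, dy J (ε, (0, 0)) = d₂ ε := fun ε => by simp [yJ]
  have hY : ContDiff ℝ ∞ fun q : ℝ × (ℝ × ℝ) => q.2.2 := by fun_prop
  have hjac : ∀ q, jac X (fun q => q.2.2) q = J q := fun q => by
    rw [jac, dx_snd, dy_snd, xX, mul_one, mul_zero, sub_zero]
  obtain ⟨R', hR'⟩ := R.exists_change hXs hY (hX0 0) rfl (by
    rw [hjac]
    exact (hJ0 0).symm ▸ one_ne_zero)
  have hA's := R'.smooth_A
  have hB's := R'.smooth_B
  have hC's := R'.smooth_C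
  have hmain : ∀ᶠ ε in 𝓝 (0 : ℝ), (R'.A (ε, (0, 0)) = 0 ∧ dx R'.A (ε, (0, 0)) = dx R.A (ε, (0, 0)) ∧
      dy R'.A (ε, (0, 0)) = 0) ∧ (R'.B (ε, (0, 0)) = 0 ∧ dx R'.B (ε, (0, 0)) = 0 ∧
      dy R'.B (ε, (0, 0)) = σ * dx R.A (ε, (0, 0))) ∧
      (dx R'.C (ε, (0, 0)) = 0 ∧ dy R'.C (ε, (0, 0)) = 0 ∧
      dx (dx R'.C) (ε, (0, 0)) = h (ε, (0, 0)) * dx R.A (ε, (0, 0)) ∧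
      dy (dx R'.C) (ε, (0, 0)) = 0 ∧
      dy (dy R'.C) (ε, (0, 0)) = h (ε, (0, 0)) * (σ * dx R.A (ε, (0, 0)))) := by
    filter_upwards [hdiag, tendsto_prodMk_zero.eventually hR'.eventually_nhds.eventually_nhds,
      tendsto_prodMk_zero.eventually hdC.eventually_nhds] with ε hdg hε hdCε
    change R.A (ε, (0, 0)) = 0 ∧ R.B (ε, (0, 0)) = 0 ∧ dy R.A (ε, (0, 0)) = 0 ∧
      dx R.B (ε, (0, 0)) = 0 ∧ dy R.B (ε, (0, 0)) = σ * dx R.A (ε, (0, 0)) at hdg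
    change ∀ᶠ q in 𝓝 (ε, ((0 : ℝ), (0 : ℝ))), _ at hε
    change ∀ᶠ q in 𝓝 (ε, ((0 : ℝ), (0 : ℝ))), _ at hdCε
    obtain ⟨a0, b0, ya, xb, yb⟩ := hdg
    have eA : (fun q => R'.A (q.1, (X q, q.2.2))) =ᶠ[𝓝 (ε, (0, 0))] R.A := by
      filter_upwards [hε] with q hq
      rw [hq.self_of_nhds.1, dx_snd, dy_snd]
      ring
    have eB : (fun q => R'.B (q.1, (X q, q.2.2))) =ᶠ[𝓝 (ε, (0, 0))]
        fun q => J q * R.B q - dy X q * R.A q := by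
      filter_upwards [hε] with q hq
      rw [hq.self_of_nhds.2.1, xX]
    have xA := dx_congr eA
    have yA := dy_congr eA
    have xB := dx_congr eB
    have yB := dy_congr eB
    have a0' := eA.self_of_nhds
    have b0' := eB.self_of_nhds
    rw [dx_comp_shear hA's hXs, xX] at xA
    rw [dy_comp_shear hA's hXs] at yA
    rw [dx_comp_shear hB's hXs, xX, dx_sub (hJs.mul hBs) (hyXs.mul hAs), dx_mul hJs hBs,
      dx_mul hyXs hAs] at xB
    rw [dy_comp_shear hB's hXs, dy_sub (hJs.mul hBs) (hyXs.mul hAs), dy_mul hJs hBs,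
      dy_mul hyXs hAs] at yB
    simp only [hX0, hJ0, hyX0, a0, b0, ya, xb, yb, mul_zero, zero_mul, one_mul, add_zero, zero_add,
      sub_zero] at xA yA xB yB a0' b0'
    have eC : ∀ᶠ q in 𝓝 (ε, ((0 : ℝ), (0 : ℝ))), (fun q => R'.C (q.1, (X q, q.2.2))) =ᶠ[𝓝 q]
        fun q => J q * R.C q := by
      filter_upwards [hε] with q hq
      filter_upwards [hq] with q' hq'
      rw [hq'.2.2, hjac]
    have e1 : (fun q => J q * dx R'.C (q.1, (X q, q.2.2))) =ᶠ[𝓝 (ε, (0, 0))]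
        fun q => dx J q * R.C q + J q * (h q * R.A q - R.C q * R.D₁ q) := by
      filter_upwards [eC, hdCε] with q hq hq'
      have := dx_congr hq
      rw [dx_comp_shear hC's hXs, xX, dx_mul hJs hCs, hq'.1] at this
      exact this
    have e2 : (fun q => dy X q * dx R'.C (q.1, (X q, q.2.2)) + dy R'.C (q.1, (X q, q.2.2)))
        =ᶠ[𝓝 (ε, (0, 0))]
        fun q => dy J q * R.C q + J q * (h q * R.B q - R.C q * R.D₂ q) := by
      filter_upwards [eC, hdCε] with q hq hq'
      have := dy_congr hq
      rw [dy_comp_shear hC's hXs, dy_mul hJs hCs, hq'.2] at this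
      exact this
    have hsh : ∀ {f : ℝ × (ℝ × ℝ) → ℝ}, ContDiff ℝ ∞ f →
        ContDiff ℝ ∞ fun q : ℝ × (ℝ × ℝ) => f (q.1, (X q, q.2.2)) := fun hf => by fun_prop
    have hxC := contDiff_dx hC's
    have hyC := contDiff_dy hC's
    have f1 := e1.self_of_nhds
    have f2 := e2.self_of_nhds
    have hd₁' : R.D₁ (ε, (0, 0)) = d₁ ε := rfl
    have hd₂' : R.D₂ (ε, (0, 0)) = d₂ ε := rfl
    simp only [hX0, hJ0, hyX0, hxJ0, hyJ0, hd₁', hd₂', a0, b0, mul_zero, zero_mul, one_mul,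
      zero_add, zero_sub] at f1 f2
    have f1' : dx R'.C (ε, (0, 0)) = 0 := by rw [f1]; ring
    have f2' : dy R'.C (ε, (0, 0)) = 0 := by rw [f2]; ring
    obtain ⟨g1, g2⟩ := hdCε.self_of_nhds
    have x1 := dx_congr e1
    have y1 := dy_congr e1
    have x2 := dx_congr e2
    have y2 := dy_congr e2
    rw [dx_sum_prod hxJs hCs hJs hh hAs hD₁, dx_mul hJs (hsh hxC), dx_comp_shear hxC hXs] at x1
    rw [dy_sum_prod hxJs hCs hJs hh hAs hD₁, dy_mul hJs (hsh hxC), dy_comp_shear hxC hXs] at y1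
    rw [dx_sum_prod hyJs hCs hJs hh hBs hD₂, dx_add (hyXs.mul (hsh hxC)) (hsh hyC),
      dx_mul hyXs (hsh hxC), dx_comp_shear hxC hXs, dx_comp_shear hyC hXs] at x2
    rw [dy_sum_prod hyJs hCs hJs hh hBs hD₂, dy_add (hyXs.mul (hsh hxC)) (hsh hyC),
      dy_mul hyXs (hsh hxC), dy_comp_shear hxC hXs, dy_comp_shear hyC hXs] at y2
    simp only [g1, g2, xX, hX0, hJ0, hyX0, hxJ0, hyJ0, xxJ, xyJ, yxJ, yyJ, hd₁', hd₂', a0, b0, ya,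
      xb, yb, f1', mul_zero, zero_mul, one_mul, add_zero, zero_add, zero_sub] at x1 y1 x2 y2
    have he₁' : e₁ ε = (dx R.D₁ (ε, (0, 0)) + d₁ ε ^ 2) / 2 := rfl
    have he₂' : e₂ ε = (dy R.D₁ (ε, (0, 0)) + dx R.D₂ (ε, (0, 0))) / 2 + d₁ ε * d₂ ε := rfl
    have he₃' : e₃ ε = (dy R.D₂ (ε, (0, 0)) + d₂ ε ^ 2) / 2 := rfl
    have hsymC : dx (dy R'.C) (ε, (0, 0)) = dy (dx R'.C) (ε, (0, 0)) := dx_dy_comm hC's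
    refine ⟨⟨a0', xA, yA⟩, ⟨b0', xB, yB⟩, f1', f2', ?_, ?_, ?_⟩
    · rw [x1, he₁']
      ring
    · rw [he₂'] at x2 y1
      linarith
    · rw [y2, he₃']
      ring
  refine ⟨{
    Φ := R'.Φ
    A := fun ε v => R'.A (ε, v)
    B := fun ε v => R'.B (ε, v)
    C := fun ε v => R'.C (ε, v)
    Q₁ := fun ε w => R'.Q₁ (ε, w)
    Q₂ := fun ε w => R'.Q₂ (ε, w)
    l₀ := fun ε => dx R.A (ε, 0)
    m₀ := fun ε => R'.C (ε, 0)
    m₁ := fun ε => h (ε, 0) * dx R.A (ε, 0) / 2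
    chart := R'.chart
    smooth_A := hA's.smoothNear _
    smooth_B := hB's.smoothNear _
    smooth_C := hC's.smoothNear _
    smooth_Q₁ := R'.smooth_Q₁.smoothNear _
    smooth_Q₂ := R'.smooth_Q₂.smoothNear _
    smooth_l₀ := (hslice (contDiff_dx hAs)).smoothNear _
    smooth_m₀ := (hslice hC's).smoothNear _
    smooth_m₁ := (((hslice hh).mul (hslice (contDiff_dx hAs))).div_const 2).smoothNear _
    reduces := ?_
    expand_A := ?_
    expand_B := ?_
    expand_C := ?_
    l₀_ne := hl
    m₀_zero := ?_ }⟩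
  · filter_upwards [R'.brackets] with q hq x y z hxyz
    rw [hq, hxyz]
    rfl
  · filter_upwards [hmain] with ε hε
    refine (isLittleO_one hA's hε.1.1 hε.1.2.1 hε.1.2.2).congr_left fun v => ?_
    rw [zero_mul, add_zero]
    rfl
  · filter_upwards [hmain] with ε hε
    refine (isLittleO_one hB's hε.2.1.1 hε.2.1.2.1 hε.2.1.2.2).congr_left fun v => ?_
    rw [zero_mul, zero_add]
    rfl
  · filter_upwards [hmain] with ε hε
    obtain ⟨-, -, k1, k2, k3, k4, k5⟩ := hε
    refine (isLittleO_two hC's (a := h (ε, 0) * dx R.A (ε, 0) / 2)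
      (b := σ * (h (ε, 0) * dx R.A (ε, 0) / 2)) k1 k2 (k3.trans ?_) k4 (k5.trans ?_)).congr_left
      fun v => ?_
    · rw [← Prod.mk_zero_zero]
      ring
    · rw [← Prod.mk_zero_zero]
      ring
    · ring
  · have := hR'.self_of_nhds.2.2
    have hX00 : X (0, 0) = 0 := hX0 0
    rw [hX00, hC0, mul_zero] at this
    exact this

end Reduction

/-! ### The reduced form near an `N` singularity -/

/-- A polynomial in `x, y` as a function of `(ε, (x, y))`. -/
def polFun (p : MvPolynomial (Fin 2) ℝ) (q : ℝ × (ℝ × ℝ)) : ℝ :=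
  MvPolynomial.eval ![q.2.1, q.2.2] p

theorem hasFDerivAt_polFun (p : MvPolynomial (Fin 2) ℝ) :
    ContDiff ℝ ∞ (polFun p) ∧ ∀ q, dx (polFun p) q = polFun (MvPolynomial.pderiv 0 p) q ∧
      dy (polFun p) q = polFun (MvPolynomial.pderiv 1 p) q := by
  induction p using MvPolynomial.induction_on with
  | C a =>
    have h : polFun (MvPolynomial.C a) = fun _ => a := funext fun q => by simp [polFun]
    refine ⟨h ▸ contDiff_const, fun q => ?_⟩
    rw [h]
    simp [dx, dy, polFun]
  | add p r hp hr =>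
    have h : polFun (p + r) = fun q => polFun p q + polFun r q := funext fun q => by simp [polFun]
    refine ⟨h ▸ hp.1.add hr.1, fun q => ?_⟩
    rw [h, dx_add hp.1 hr.1, dy_add hp.1 hr.1, (hp.2 q).1, (hp.2 q).2, (hr.2 q).1, (hr.2 q).2]
    simp [polFun]
  | mul_X p i hp =>
    have hX : ContDiff ℝ ∞ (polFun (MvPolynomial.X i)) ∧
        ∀ q, dx (polFun (MvPolynomial.X i)) q =
          polFun (MvPolynomial.pderiv 0 (MvPolynomial.X i)) q ∧
        dy (polFun (MvPolynomial.X i)) q = polFun (MvPolynomial.pderiv 1 (MvPolynomial.X i)) q := by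
      fin_cases i
      · have h : polFun (MvPolynomial.X 0) = fun q => q.2.1 := funext fun q => by simp [polFun]
        have hs : ContDiff ℝ ∞ fun q : ℝ × (ℝ × ℝ) => q.2.1 := by fun_prop
        simp only [Fin.zero_eta, h]
        refine ⟨hs, fun q => ⟨?_, ?_⟩⟩
        · rw [dx_eq_of_hasDerivAt (x := q.2.1) hs (hasDerivAt_id q.2.1)]
          simp [polFun]
        · rw [dy_eq_of_hasDerivAt (y := q.2.2) hs (hasDerivAt_const q.2.2 q.2.1)]
          simp [polFun, MvPolynomial.pderiv_X]
      · have h : polFun (MvPolynomial.X 1) = fun q => q.2.2 := funext fun q => by simp [polFun]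
        simp only [Fin.mk_one, h]
        refine ⟨by fun_prop, fun q => ⟨?_, ?_⟩⟩
        · rw [dx_snd]
          simp [polFun, MvPolynomial.pderiv_X]
        · rw [dy_snd]
          simp [polFun]
    have h : polFun (p * MvPolynomial.X i) = fun q => polFun p q * polFun (MvPolynomial.X i) q :=
      funext fun q => by simp [polFun]
    refine ⟨h ▸ hp.1.mul hX.1, fun q => ?_⟩
    rw [h, dx_mul hp.1 hX.1, dy_mul hp.1 hX.1, (hp.2 q).1, (hp.2 q).2, (hX.2 q).1, (hX.2 q).2]
    simp only [polFun, Derivation.leibniz, map_add, smul_eq_mul, map_mul]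
    constructor <;> ring

theorem contDiff_polFun (p : MvPolynomial (Fin 2) ℝ) : ContDiff ℝ ∞ (polFun p) :=
  (hasFDerivAt_polFun p).1

theorem dx_polFun (p : MvPolynomial (Fin 2) ℝ) :
    dx (polFun p) = polFun (MvPolynomial.pderiv 0 p) :=
  funext fun q => ((hasFDerivAt_polFun p).2 q).1

theorem dy_polFun (p : MvPolynomial (Fin 2) ℝ) :
    dy (polFun p) = polFun (MvPolynomial.pderiv 1 p) :=
  funext fun q => ((hasFDerivAt_polFun p).2 q).2

theorem euler_polFun {p : MvPolynomial (Fin 2) ℝ} {n : ℕ} (h : p.IsHomogeneous n)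
    (q : ℝ × (ℝ × ℝ)) : q.2.1 * polFun (MvPolynomial.pderiv 0 p) q
      + q.2.2 * polFun (MvPolynomial.pderiv 1 p) q = n * polFun p q := by
  have := congrArg (MvPolynomial.eval ![q.2.1, q.2.2]) h.sum_X_mul_pderiv
  simpa [polFun, Fin.sum_univ_two] using this

theorem polFun_zero {p : MvPolynomial (Fin 2) ℝ} {n : ℕ} (h : p.IsHomogeneous n) (hn : n ≠ 0)
    (ε : ℝ) : polFun p (ε, (0, 0)) = 0 := by
  have := euler_polFun h (ε, (0, 0))
  simp only [zero_mul, add_zero] at this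
  exact (mul_eq_zero.1 this.symm).resolve_left (by exact_mod_cast hn)

theorem polFun_const {p : MvPolynomial (Fin 2) ℝ} (h : p.IsHomogeneous 0) (q : ℝ × (ℝ × ℝ)) :
    polFun p q = polFun p (0, (0, 0)) := by
  rw [MvPolynomial.totalDegree_eq_zero_iff_eq_C.1 (Nat.le_zero.1 h.totalDegree_le)]
  simp [polFun]

theorem polFun_quadratic {g : MvPolynomial (Fin 2) ℝ} (h : g.IsHomogeneous 2)
    (q : ℝ × (ℝ × ℝ)) : 2 * polFun g q = q.2.1 ^ 2 * dx (dx (polFun g)) (0, (0, 0))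
      + 2 * (q.2.1 * q.2.2) * dy (dx (polFun g)) (0, (0, 0))
      + q.2.2 ^ 2 * dy (dy (polFun g)) (0, (0, 0)) := by
  have hc : dx (dy (polFun g)) (0, (0, 0)) = dy (dx (polFun g)) (0, (0, 0)) :=
    dx_dy_comm (contDiff_polFun g)
  simp only [dx_polFun, dy_polFun] at hc ⊢
  have e := euler_polFun h q
  have e0 := euler_polFun (h.pderiv (i := 0)) q
  have e1 := euler_polFun (h.pderiv (i := 1)) q
  rw [polFun_const ((h.pderiv (i := 0)).pderiv (i := 0)),
    polFun_const ((h.pderiv (i := 0)).pderiv (i := 1))] at e0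
  rw [polFun_const ((h.pderiv (i := 1)).pderiv (i := 0)),
    polFun_const ((h.pderiv (i := 1)).pderiv (i := 1))] at e1
  push_cast at e e0 e1
  linear_combination -e - q.2.1 * e0 - q.2.2 * e1 + q.2.1 * q.2.2 * hc

/-- The Gram matrix of a quadratic form that is equivalent to `x² + σ y²`. -/
theorem gram_of_rEquivDiag {g : MvPolynomial (Fin 2) ℝ} (h : g.IsHomogeneous 2) {σ : ℝ}
    {S : Matrix (Fin 2) (Fin 2) ℝ}
    (hS : ∀ v : Fin 2 → ℝ, MvPolynomial.eval (S.mulVec v) g = 1 * v 0 ^ 2 + σ * v 1 ^ 2) {a b c : ℝ}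
    (ha : dx (dx (polFun g)) (0, (0, 0)) = a) (hb : dy (dx (polFun g)) (0, (0, 0)) = b)
    (hc : dy (dy (polFun g)) (0, (0, 0)) = c) :
    S 0 0 ^ 2 * a + 2 * (S 0 0 * S 1 0) * b + S 1 0 ^ 2 * c = 2 ∧
    S 0 0 * S 0 1 * a + (S 0 0 * S 1 1 + S 1 0 * S 0 1) * b + S 1 0 * S 1 1 * c = 0 ∧
    S 0 1 ^ 2 * a + 2 * (S 0 1 * S 1 1) * b + S 1 1 ^ 2 * c = 2 * σ := by
  have key : ∀ x y : ℝ, (S 0 0 * x + S 0 1 * y) ^ 2 * a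
      + 2 * ((S 0 0 * x + S 0 1 * y) * (S 1 0 * x + S 1 1 * y)) * b
      + (S 1 0 * x + S 1 1 * y) ^ 2 * c = 2 * (x ^ 2 + σ * y ^ 2) := fun x y => by
    have h1 := hS ![x, y]
    have h2 := polFun_quadratic h (0, (S 0 0 * x + S 0 1 * y, S 1 0 * x + S 1 1 * y))
    rw [ha, hb, hc] at h2
    have h3 : S.mulVec ![x, y] = ![S 0 0 * x + S 0 1 * y, S 1 0 * x + S 1 1 * y] := by
      ext i
      fin_cases i <;> simp [Matrix.mulVec, dotProduct, Fin.sum_univ_two]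
    rw [h3] at h1
    simp only [polFun, h1] at h2
    simp only [Matrix.cons_val_zero, Matrix.cons_val_one] at h2
    linear_combination -h2
  have k1 := key 1 0
  have k2 := key 0 1
  have k3 := key 1 1
  refine ⟨by linear_combination k1, by linear_combination (k3 - k1 - k2) / 2,
    by linear_combination k2⟩

/-- Second order Taylor expansion in `z`. -/
theorem exists_taylor_z {F : ℝ × R3 → ℝ} (hF : ContDiff ℝ ∞ F) :
    ∃ Q : ℝ × R3 → ℝ, ContDiff ℝ ∞ Q ∧ ∀ q, F q = F (lift (plane q) 0)
      + q.2 2 * Reduction.dzZero F (plane q) + q.2 2 ^ 2 * Q q := by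
  set l : ℝ × R3 →L[ℝ] ℝ :=
    (ContinuousLinearMap.proj (R := ℝ) (φ := fun _ : Fin 3 => ℝ) 2).comp (.snd ℝ ℝ R3) with hl
  have hle : ∀ q : ℝ × R3, q - l q • ((0 : ℝ), (Pi.single 2 1 : R3)) = lift (plane q) 0 := by
    intro q
    refine Prod.ext (by simp [lift]) ?_
    ext i
    fin_cases i <;> simp [lift, hl]
  obtain ⟨h, hh, hF'⟩ := exists_hadamard hF l (0, Pi.single 2 1)
  obtain ⟨Q, hQ, hh'⟩ := exists_hadamard hh l (0, Pi.single 2 1)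
  simp only [hle, smul_eq_mul] at hF' hh'
  have hlq : ∀ q : ℝ × R3, l q = q.2 2 := fun _ => rfl
  have hdz : ∀ q, Reduction.dzZero F q = h (lift q 0) := fun q => by
    have h1 : HasDerivAt (fun z => F (lift q z)) (Reduction.dzZero F q) 0 :=
      ((hF.differentiable (by simp)) _).hasFDerivAt.comp_hasDerivAt (0 : ℝ) (hasDerivAt_lift q 0)
    have h2 : (fun z => F (lift q z)) = fun z => F (lift q 0) + z * h (lift q z) :=
      funext fun z => by rw [hF' (lift q z)]; rfl
    have h3 : HasDerivAt (fun z => h (lift q z)) (Reduction.dzZero h q) 0 :=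
      ((hh.differentiable (by simp)) _).hasFDerivAt.comp_hasDerivAt (0 : ℝ) (hasDerivAt_lift q 0)
    rw [h2] at h1
    refine h1.unique ((((hasDerivAt_id (0 : ℝ)).mul h3).const_add (F (lift q 0))).congr_deriv ?_)
    simp
  refine ⟨Q, hQ, fun q => ?_⟩
  rw [hdz, hF' q, hh' q, hlq]
  ring

theorem hasDerivAt_x {f : ℝ × (ℝ × ℝ) → ℝ} (hf : ContDiff ℝ ∞ f) (ε x y : ℝ) :
    HasDerivAt (fun x => f (ε, (x, y))) (dx f (ε, (x, y))) x :=
  (hasFDerivAt_of_contDiff hf (ε, (x, y))).comp_hasDerivAt x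
    ((hasDerivAt_const _ _).prodMk ((hasDerivAt_id x).prodMk (hasDerivAt_const _ _)))

theorem hasDerivAt_y {f : ℝ × (ℝ × ℝ) → ℝ} (hf : ContDiff ℝ ∞ f) (ε x y : ℝ) :
    HasDerivAt (fun y => f (ε, (x, y))) (dy f (ε, (x, y))) y :=
  (hasFDerivAt_of_contDiff hf (ε, (x, y))).comp_hasDerivAt y
    ((hasDerivAt_const _ _).prodMk ((hasDerivAt_const _ _).prodMk (hasDerivAt_id y)))

/-- If `F = p(x,y) + z s(x,y)` up to second order at `ε = 0`, then the coefficients of `F` as a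
power series in `z` have the expected jets. -/
theorem jets_of_remainder {F : ℝ × R3 → ℝ} (hF : ContDiff ℝ ∞ F) (p s : MvPolynomial (Fin 2) ℝ)
    (h : (fun w : R3 => F (0, w) - (polFun p (plane (0, w)) + polFun s (plane (0, w)) * w 2))
      =o[𝓝 0] fun w => ‖w‖ ^ 2) :
    (Reduction.dzZero F (0, (0, 0)) = polFun s (0, (0, 0)) ∧
      dx (Reduction.dzZero F) (0, (0, 0)) = dx (polFun s) (0, (0, 0)) ∧
      dy (Reduction.dzZero F) (0, (0, 0)) = dy (polFun s) (0, (0, 0))) ∧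
    dx (fun q => F (lift q 0)) (0, (0, 0)) = dx (polFun p) (0, (0, 0)) ∧
    dy (fun q => F (lift q 0)) (0, (0, 0)) = dy (polFun p) (0, (0, 0)) := by
  have hps := contDiff_polFun p
  have hss := contDiff_polFun s
  set T : R3 → ℝ := fun w =>
    F (0, w) - (polFun p (plane (0, w)) + polFun s (plane (0, w)) * w 2) with hT
  have hF0 : ContDiff ℝ ∞ fun w => F (0, w) := hF.comp (contDiff_prodMk_right 0)
  have hp0 : ContDiff ℝ ∞ fun w : R3 => polFun p (plane (0, w)) :=
    hps.comp (plane.contDiff.comp (contDiff_prodMk_right 0))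
  have hs0 : ContDiff ℝ ∞ fun w : R3 => polFun s (plane (0, w)) :=
    hss.comp (plane.contDiff.comp (contDiff_prodMk_right 0))
  have hs2 : ContDiff ℝ ∞ fun w : R3 => polFun s (plane (0, w)) * w 2 :=
    hs0.mul (contDiff_apply ℝ ℝ 2)
  have hTs : ContDiff ℝ ∞ T := hF0.sub (hp0.add hs2)
  obtain ⟨-, j1, j2⟩ := jet_two_eq_zero hTs h
  have hdF : ∀ v : ℝ × ℝ, Reduction.dzZero F (0, v) =
      fderiv ℝ T (lift (0, v) 0).2 (Pi.single 2 1) + polFun s (0, v) := fun v => by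
    have e : fderiv ℝ T (lift (0, v) 0).2 (Pi.single 2 1) =
        fderiv ℝ F (0, (lift (0, v) 0).2) (0, Pi.single 2 1) - polFun s (0, v) := by
      have d1 := (hF0.differentiable (by simp) (lift (0, v) 0).2).hasFDerivAt
      have d2 := (hp0.differentiable (by simp) (lift (0, v) 0).2).hasFDerivAt
      have d3 := (hs2.differentiable (by simp) (lift (0, v) 0).2).hasFDerivAt
      have d4 : HasFDerivAt T _ (lift (0, v) 0).2 := d1.sub (d2.add d3)
      rw [d4.fderiv]
      simp only [sub_apply, add_apply, fderiv_slice hF, fderiv_comp_plane hps,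
        fderiv_mul_coord hss]
      have : plane (0, (lift (0, v) 0).2) = (0, v) := rfl
      simp [this]
    rw [e]
    exact (sub_add_cancel _ _).symm
  have hlift : ContDiff ℝ ∞ fun v : ℝ × ℝ => (lift (0, v) 0).2 :=
    contDiff_snd.comp (contDiff_lift_zero.comp (contDiff_prodMk_right 0))
  have hl0 : (lift (0, (0, 0)) 0).2 = 0 := (Prod.ext_iff.1 lift_zero).2
  have hW : HasFDerivAt (fun v : ℝ × ℝ => fderiv ℝ T (lift (0, v) 0).2 (Pi.single 2 1))
      (0 : ℝ × ℝ →L[ℝ] ℝ) ((0 : ℝ), (0 : ℝ)) := by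
    have h1 := (hlift.differentiable (by simp) ((0 : ℝ), (0 : ℝ))).hasFDerivAt
    rw [← hl0] at j2
    have h2 := (j2.comp ((0 : ℝ), (0 : ℝ)) h1).clm_apply
      (hasFDerivAt_const (Pi.single 2 1 : R3) ((0 : ℝ), (0 : ℝ)))
    refine HasFDerivAt.congr_fderiv (f := fun v : ℝ × ℝ => fderiv ℝ T (lift (0, v) 0).2
      (Pi.single 2 1)) h2 ?_
    ext <;> simp
  have hV : HasFDerivAt (fun v : ℝ × ℝ => T (lift (0, v) 0).2)
      (0 : ℝ × ℝ →L[ℝ] ℝ) ((0 : ℝ), (0 : ℝ)) := by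
    have h1 := (hlift.differentiable (by simp) ((0 : ℝ), (0 : ℝ))).hasFDerivAt
    have h3 : HasFDerivAt T (0 : R3 →L[ℝ] ℝ) (lift (0, (0, 0)) 0).2 := by
      rw [hl0, ← j1]
      exact (hTs.differentiable (by simp) 0).hasFDerivAt
    have h4 := h3.comp ((0 : ℝ), (0 : ℝ)) h1
    refine HasFDerivAt.congr_fderiv (f := fun v : ℝ × ℝ => T (lift (0, v) 0).2) h4 ?_
    ext <;> simp
  have hFl : ∀ v : ℝ × ℝ, F (lift (0, v) 0) = T (lift (0, v) 0).2 + polFun p (0, v) := fun v => by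
    have e2 : (lift (0, v) 0).2 2 = 0 := rfl
    have e : T (lift (0, v) 0).2 = F (lift (0, v) 0)
        - (polFun p (0, v) + polFun s (0, v) * (lift (0, v) 0).2 2) := rfl
    rw [e, e2]
    ring
  have hx : HasDerivAt (fun x : ℝ => (x, (0 : ℝ))) (1, 0) 0 :=
    (hasDerivAt_id 0).prodMk (hasDerivAt_const _ _)
  have hy : HasDerivAt (fun y : ℝ => ((0 : ℝ), y)) (0, 1) 0 :=
    (hasDerivAt_const _ _).prodMk (hasDerivAt_id 0)
  have hWx : HasDerivAt (fun x : ℝ => fderiv ℝ T (lift (0, (x, 0)) 0).2 (Pi.single 2 1)) 0 0 := by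
    simpa using! HasFDerivAt.comp_hasDerivAt (f := fun x : ℝ => (x, (0 : ℝ))) (0 : ℝ) hW hx
  have hWy : HasDerivAt (fun y : ℝ => fderiv ℝ T (lift (0, (0, y)) 0).2 (Pi.single 2 1)) 0 0 := by
    simpa using! HasFDerivAt.comp_hasDerivAt (f := fun y : ℝ => ((0 : ℝ), y)) (0 : ℝ) hW hy
  have hVx : HasDerivAt (fun x : ℝ => T (lift (0, (x, 0)) 0).2) 0 0 := by
    simpa using! HasFDerivAt.comp_hasDerivAt (f := fun x : ℝ => (x, (0 : ℝ))) (0 : ℝ) hV hx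
  have hVy : HasDerivAt (fun y : ℝ => T (lift (0, (0, y)) 0).2) 0 0 := by
    simpa using! HasFDerivAt.comp_hasDerivAt (f := fun y : ℝ => ((0 : ℝ), y)) (0 : ℝ) hV hy
  have hz := Reduction.contDiff_dzZero hF
  have hFls : ContDiff ℝ ∞ fun q => F (lift q 0) := hF.comp contDiff_lift_zero
  refine ⟨⟨?_, ?_, ?_⟩, ?_, ?_⟩
  · rw [hdF, hl0, j1]
    simp
  · refine dx_eq_of_hasDerivAt hz ?_
    simp only [hdF]
    simpa using! hWx.add (hasDerivAt_x hss 0 0 0)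
  · refine dy_eq_of_hasDerivAt hz ?_
    simp only [hdF]
    simpa using! hWy.add (hasDerivAt_y hss 0 0 0)
  · refine dx_eq_of_hasDerivAt hFls ?_
    simp only [hFl]
    simpa using! hVx.add (hasDerivAt_x hps 0 0 0)
  · refine dy_eq_of_hasDerivAt hFls ?_
    simp only [hFl]
    simpa using! hVy.add (hasDerivAt_y hps 0 0 0)

/-- A reduction from coordinates with `{x,y} = z`, `{y,z} = F`, `{z,x} = G`: by the Jacobi identity
on `z = 0`, the functions `F` and `G` vanish there together with a common factor `C`. -/
theorem exists_reduction_of_hasBrackets {P : ℝ → R3 → Bivec} (hP : IsLocalPoissonFamily P)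
    {Φ : ℝ → R3 → R3} (hΦ : IsLocalChartFamily Φ) {F G : ℝ × R3 → ℝ} (hF : ContDiff ℝ ∞ F)
    (hG : ContDiff ℝ ∞ G) (h : HasBrackets P Φ F G)
    (hF0 : Reduction.dzZero F (0, 0) = 0) (hG0 : Reduction.dzZero G (0, 0) = 0)
    (hjac : jac (Reduction.dzZero F) (Reduction.dzZero G) (0, 0) ≠ 0) :
    ∃ R : Reduction P, R.A = Reduction.dzZero F ∧ R.B = Reduction.dzZero G ∧
      ∀ᶠ q in 𝓝 (0, 0), F (lift q 0) = R.C q * R.A q := by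
  have hA := Reduction.contDiff_dzZero hF
  have hB := Reduction.contDiff_dzZero hG
  obtain ⟨Q₁, hQ₁, hFQ⟩ := exists_taylor_z hF
  obtain ⟨Q₂, hQ₂, hGQ⟩ := exists_taylor_z hG
  obtain ⟨C, hC, hCq⟩ := exists_smooth_quotient hA hB (hF.comp contDiff_lift_zero)
    (hG.comp contDiff_lift_zero) hF0 hG0 (injective_planar hA hB hjac) (by
      filter_upwards [tendsto_lift_zero.eventually (h.jacobi hP hΦ hF hG)] with q hq
      rw [lift_snd_two, zero_mul, zero_add] at hq
      exact sub_eq_zero.1 hq)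
  have hpl : Tendsto (fun q : ℝ × R3 => plane (q.1, Φ q.1 q.2)) (𝓝 (0, 0)) (𝓝 (0, 0)) :=
    (plane.continuous.tendsto' (0, 0) (0, 0) rfl).comp hΦ.tendsto
  refine ⟨⟨Φ, Reduction.dzZero F, Reduction.dzZero G, C, Q₁, Q₂, hΦ, hA, hB, hC, hQ₁, hQ₂, ?_⟩,
    rfl, rfl, hCq.mono fun q hq => hq.1⟩
  filter_upwards [h, hpl.eventually hCq] with q hq hq'
  simp only [Function.comp_apply] at hq'
  rw [hq, hFQ (q.1, Φ q.1 q.2), hGQ (q.1, Φ q.1 q.2), hq'.1, hq'.2]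
  simp only [reducedForm]
  congr 1 <;> ring

/-- The bracket of two functions depending on `ε`. -/
def famBracket (P : ℝ × R3 → Bivec) (a b : ℝ × R3 → ℝ) (q : ℝ × R3) : ℝ :=
  ∑ i, ∑ j, P q i j * fderiv ℝ a q (0, Pi.single i 1) * fderiv ℝ b q (0, Pi.single j 1)

theorem contDiff_famBracket {P : ℝ × R3 → Bivec} {a b : ℝ × R3 → ℝ} (hP : ContDiff ℝ ∞ P)
    (ha : ContDiff ℝ ∞ a) (hb : ContDiff ℝ ∞ b) : ContDiff ℝ ∞ (famBracket P a b) :=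
  ContDiff.sum fun i _ => ContDiff.sum fun j _ =>
    ((contDiff_pi.1 (contDiff_pi.1 hP i) j).mul
      ((ha.fderiv_right (m := ∞) (by simp)).clm_apply contDiff_const)).mul
      ((hb.fderiv_right (m := ∞) (by simp)).clm_apply contDiff_const)

theorem bracket_eq_famBracket {P : ℝ → R3 → Bivec} {P' : ℝ × R3 → Bivec} {a b : ℝ × R3 → ℝ}
    (ha : ContDiff ℝ ∞ a) (hb : ContDiff ℝ ∞ b) {q : ℝ × R3} (h : P' q = P q.1 q.2) :
    bracket (P q.1) (fun p => a (q.1, p)) (fun p => b (q.1, p)) q.2 = famBracket P' a b q := by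
  simp only [bracket, famBracket, h, fderiv_slice ha, fderiv_slice hb]

/-- At a zero of `π` the bracket `{a, b}` is `o(‖x‖²)` as soon as the products of the partial
derivatives of `a` and `b` are `o(‖x‖)`. -/
theorem isLittleO_bracket {π : R3 → Bivec} (hπ : DifferentiableAt ℝ π 0) (h0 : π 0 = 0)
    {a b : R3 → ℝ} (h : ∀ v w : R3, (fun x => fderiv ℝ a x v * fderiv ℝ b x w) =o[𝓝 0]
      fun x => ‖x‖) : bracket π a b =o[𝓝 0] fun x => ‖x‖ ^ 2 := by
  have key : ∀ i j, (fun p => π p i j * fderiv ℝ a p (Pi.single i 1)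
      * fderiv ℝ b p (Pi.single j 1)) =o[𝓝 0] fun x => ‖x‖ ^ 2 := fun i j => by
    have h1 : (fun x => π x i j) =O[𝓝 0] fun x => ‖x‖ := by
      have hd : DifferentiableAt ℝ (fun x => π x i j) 0 :=
        differentiableAt_pi.1 (differentiableAt_pi.1 hπ i) j
      have := hd.isBigO_sub
      simpa [h0] using this.norm_right
    simp only [mul_assoc, pow_two]
    exact h1.mul_isLittleO (h _ _)
  have h2 : ∀ i, (fun p => ∑ j, π p i j * fderiv ℝ a p (Pi.single i 1)
      * fderiv ℝ b p (Pi.single j 1)) =o[𝓝 0] fun x => ‖x‖ ^ 2 := fun i =>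
    IsLittleO.fun_sum fun j _ => key i j
  exact IsLittleO.fun_sum fun i _ => h2 i

/-! ### Taking `{x, y}` as the third coordinate -/

/-- The coordinates `x, y, {x, y}`, where `x` and `y` are the first two coordinates of `φ`. -/
def bracketChart (P : ℝ × R3 → Bivec) (φ : R3 → R3) (ε : ℝ) (p : R3) : R3 :=
  ![φ p 0, φ p 1, famBracket P (fun q => φ q.2 0) (fun q => φ q.2 1) (ε, p)]

theorem contDiff_coord_snd {φ : R3 → R3} (hφ : ContDiff ℝ ∞ φ) (i : Fin 3) :
    ContDiff ℝ ∞ fun q : ℝ × R3 => φ q.2 i :=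
  (contDiff_apply ℝ ℝ i).comp (hφ.comp contDiff_snd)

theorem contDiff_bracketChart {P : ℝ × R3 → Bivec} (hP : ContDiff ℝ ∞ P) {φ : R3 → R3}
    (hφ : ContDiff ℝ ∞ φ) (i : Fin 3) :
    ContDiff ℝ ∞ fun q : ℝ × R3 => bracketChart P φ q.1 q.2 i := by
  fin_cases i
  · exact contDiff_coord_snd hφ 0
  · exact contDiff_coord_snd hφ 1
  · exact contDiff_famBracket hP (contDiff_coord_snd hφ 0) (contDiff_coord_snd hφ 1)

/-- The coordinates `bracketChart` have `{x,y} = z`. -/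
theorem inCoords_bracketChart {P : ℝ → R3 → Bivec} (hP : IsLocalPoissonFamily P)
    {P' : ℝ × R3 → Bivec} (hP's : ContDiff ℝ ∞ P')
    (hP' : P' =ᶠ[𝓝 (0, 0)] fun q => P q.1 q.2) {φ : R3 → R3} (hφ : ContDiff ℝ ∞ φ) :
    ∀ᶠ q : ℝ × R3 in 𝓝 (0, 0), inCoords (P q.1) (bracketChart P' φ q.1) q.2 =
      bivec (bracketChart P' φ q.1 q.2 2)
        (famBracket P' (fun q => bracketChart P' φ q.1 q.2 1)
          (fun q => bracketChart P' φ q.1 q.2 2) q)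
        (famBracket P' (fun q => bracketChart P' φ q.1 q.2 2)
          (fun q => bracketChart P' φ q.1 q.2 0) q) := by
  have hc := contDiff_bracketChart hP's hφ
  filter_upwards [hP.antisymm, hP'] with q ha hq
  have hb : ∀ i j, inCoords (P q.1) (bracketChart P' φ q.1) q.2 i j =
      famBracket P' (fun q => bracketChart P' φ q.1 q.2 i)
        (fun q => bracketChart P' φ q.1 q.2 j) q :=
    fun i j => bracket_eq_famBracket (hc i) (hc j) hq
  rw [eq_bivec (M := inCoords (P q.1) (bracketChart P' φ q.1) q.2) (fun i j => bracket_swap ha _ _)]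
  rw [hb, hb, hb]
  rfl

/-- The remainder of `{a, c + r}` when `r` vanishes to third order. -/
theorem isLittleO_bracket_remainder {π : R3 → Bivec} (hπ : DifferentiableAt ℝ π 0) (h0 : π 0 = 0)
    {a r : R3 → ℝ} (ha : ContDiff ℝ ∞ a) (hr : ContDiff ℝ ∞ r)
    (hr2 : r =o[𝓝 0] fun x => ‖x‖ ^ 2) : bracket π a r =o[𝓝 0] fun x => ‖x‖ ^ 2 := by
  refine isLittleO_bracket hπ h0 fun v w => ?_
  obtain ⟨-, h1, h2⟩ := jet_two_eq_zero hr hr2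
  have h3 : (fun x => fderiv ℝ r x w) =o[𝓝 0] fun x => ‖x‖ := by
    have h4 := h2.isLittleO
    simp only [h1, sub_zero, zero_apply] at h4
    refine IsBigO.trans_isLittleO (IsBigO.of_bound ‖w‖ (Eventually.of_forall fun x => ?_))
      (h4.norm_right)
    rw [mul_comm]
    exact (fderiv ℝ r x).le_opNorm w
  have h5 : (fun x => fderiv ℝ a x v) =O[𝓝 0] fun _ => (1 : ℝ) :=
    (((ha.fderiv_right (m := ∞) (by simp)).clm_apply contDiff_const).continuous.tendsto
      0).isBigO_one ℝ
  simpa using h5.mul_isLittleO h3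

theorem bracket_add_right (π : R3 → Bivec) (a : R3 → ℝ) {c r : R3 → ℝ} {p : R3}
    (hc : DifferentiableAt ℝ c p) (hr : DifferentiableAt ℝ r p) :
    bracket π a (fun x => c x + r x) p = bracket π a c p + bracket π a r p := by
  have h : fderiv ℝ (fun x => c x + r x) p = fderiv ℝ c p + fderiv ℝ r p :=
    (hc.hasFDerivAt.add hr.hasFDerivAt).fderiv
  simp only [bracket, h, add_apply, mul_add, Finset.sum_add_distrib]

theorem bracket_add_left (π : R3 → Bivec) (a : R3 → ℝ) {c r : R3 → ℝ} {p : R3}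
    (hc : DifferentiableAt ℝ c p) (hr : DifferentiableAt ℝ r p) :
    bracket π (fun x => c x + r x) a p = bracket π c a p + bracket π r a p := by
  have h : fderiv ℝ (fun x => c x + r x) p = fderiv ℝ c p + fderiv ℝ r p :=
    (hc.hasFDerivAt.add hr.hasFDerivAt).fderiv
  simp only [bracket, h, add_apply, mul_add, add_mul, Finset.sum_add_distrib]

/-- The derivative of the smooth family of inverses is bounded: `Ψ(0, w) = O(w)`. -/
theorem isBigO_inverse {Ψ : ℝ × R3 → R3} (hΨ : ContDiff ℝ ∞ Ψ) (h0 : Ψ (0, 0) = 0) :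
    (fun w : R3 => Ψ (0, w)) =O[𝓝 0] fun w => w := by
  have hd : DifferentiableAt ℝ (fun w : R3 => Ψ (0, w)) 0 :=
    (hΨ.comp (contDiff_prodMk_right 0)).differentiable (by simp) 0
  simpa [h0] using hd.isBigO_sub

variable {P : ℝ → R3 → Bivec} {P' : ℝ × R3 → Bivec} {φ : R3 → R3}

/-- A 2-vector with the 2-jet of an `N` singularity vanishes at the singular point. -/
theorem eq_zero_of_jet {f g : MvPolynomial (Fin 2) ℝ} (hf : f.IsHomogeneous 3)
    (hφ : IsLocalChart φ 0) (h : (fun x => inCoords (P 0) φ x - normalBivec f g (φ x)) =o[𝓝 0]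
      fun x => ‖x‖ ^ 2) : P 0 0 = 0 := by
  have hc : IsLocalChartFamily fun _ : ℝ => φ :=
    ⟨SmoothNear.comp (f := φ) (g := Prod.snd) hφ.smooth (contDiff_snd.smoothNear _), hφ.center,
      hφ.det_ne⟩
  refine (hc.eq_zero_iff P).self_of_nhds.2 ?_
  have h0 : inCoords (P 0) φ 0 - normalBivec f g (φ 0) = 0 := by
    simpa using (isLittleO_iff.1 h one_pos).self_of_nhds
  have h1 : ∀ i, MvPolynomial.eval ![(0 : ℝ), 0] (MvPolynomial.pderiv i f) = 0 := fun i =>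
    polFun_zero (hf.pderiv (i := i)) (by norm_num) 0
  rw [sub_eq_zero.1 h0, hφ.center, normalBivec, bivec_eq_zero_iff]
  simp [h1]

section

variable {f g : MvPolynomial (Fin 2) ℝ}

theorem isLittleO_bracketChart_sub (hP' : P' =ᶠ[𝓝 (0, 0)] fun q => P q.1 q.2)
    (hφ : ContDiff ℝ ∞ φ)
    (h : (fun x => inCoords (P 0) φ x - normalBivec f g (φ x)) =o[𝓝 0] fun x => ‖x‖ ^ 2) :
    (fun x => bracketChart P' φ 0 x 2 - φ x 2) =o[𝓝 0] fun x => ‖x‖ ^ 2 := by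
  have h1 : (fun x => (inCoords (P 0) φ x - normalBivec f g (φ x)) 0 1) =o[𝓝 0]
      fun x => ‖x‖ ^ 2 := isLittleO_pi.1 (isLittleO_pi.1 h 0) 1
  refine h1.congr' ?_ .rfl
  filter_upwards [(tendsto_slice ((0 : ℝ), (0 : R3))).eventually hP'] with x hx
  have h2 := bracket_eq_famBracket (contDiff_coord_snd hφ 0) (contDiff_coord_snd hφ 1) hx
  change bracket (P 0) (fun p => φ p 0) (fun p => φ p 1) x - _ = _
  rw [h2]
  simp [bracketChart, normalBivec, bivec]

/-- The remainder of the bracket `{y, z}` in the coordinates `bracketChart`. -/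
theorem remainder_yz (hP' : P' =ᶠ[𝓝 (0, 0)] fun q => P q.1 q.2) (hP's : ContDiff ℝ ∞ P')
    (hφ : ContDiff ℝ ∞ φ) (h00 : P 0 0 = 0)
    (h : (fun x => inCoords (P 0) φ x - normalBivec f g (φ x)) =o[𝓝 0] fun x => ‖x‖ ^ 2) :
    (fun x => famBracket P' (fun q => bracketChart P' φ q.1 q.2 1)
          (fun q => bracketChart P' φ q.1 q.2 2) (0, x)
        - (polFun (MvPolynomial.pderiv 0 f) (plane (0, bracketChart P' φ 0 x))
          + polFun (MvPolynomial.pderiv 0 g) (plane (0, bracketChart P' φ 0 x))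
            * bracketChart P' φ 0 x 2)) =o[𝓝 0] fun x => ‖x‖ ^ 2 := by
  have hr2 := isLittleO_bracketChart_sub hP' hφ h
  have hc := contDiff_bracketChart hP's hφ
  have hc0 : ∀ i, ContDiff ℝ ∞ fun x => bracketChart P' φ 0 x i := fun i =>
    (hc i).comp (contDiff_prodMk_right 0)
  have hφi : ∀ i, ContDiff ℝ ∞ fun x => φ x i := fun i => (contDiff_apply ℝ ℝ i).comp hφ
  have hr : ContDiff ℝ ∞ fun x => bracketChart P' φ 0 x 2 - φ x 2 := (hc0 2).sub (hφi 2)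
  have hP0 := (tendsto_slice ((0 : ℝ), (0 : R3))).eventually hP'
  have hπ : DifferentiableAt ℝ (P 0) 0 :=
    ((hP's.comp (contDiff_prodMk_right 0)).differentiable (by simp) 0).congr_of_eventuallyEq
      (hP0.mono fun x hx => hx.symm)
  have h1 : (fun x => (inCoords (P 0) φ x - normalBivec f g (φ x)) 1 2) =o[𝓝 0]
      fun x => ‖x‖ ^ 2 := isLittleO_pi.1 (isLittleO_pi.1 h 1) 2
  have h2 := isLittleO_bracket_remainder hπ h00 (hφi 1) hr hr2
  have h3 : (fun x => polFun (MvPolynomial.pderiv 0 g) (plane (0, φ x))) =O[𝓝 0]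
      fun _ => (1 : ℝ) :=
    (((contDiff_polFun _).continuous.comp (plane.continuous.comp
      (continuous_const.prodMk hφ.continuous))).tendsto 0).isBigO_one ℝ
  have h4 := h3.mul_isLittleO hr2
  simp only [one_mul] at h4
  refine ((h1.add h2).sub h4).congr' ?_ .rfl
  filter_upwards [hP0] with x hx
  have e1 := bracket_eq_famBracket (hc 1) (hc 2) hx
  have e2 : bracket (P 0) (fun p => bracketChart P' φ 0 p 1) (fun p => bracketChart P' φ 0 p 2) x =
      bracket (P 0) (fun p => φ p 1) (fun p => φ p 2) x
        + bracket (P 0) (fun p => φ p 1) (fun p => bracketChart P' φ 0 p 2 - φ p 2) x := by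
    rw [← bracket_add_right _ _ ((hφi 2).differentiable (by simp) x)
      (hr.differentiable (by simp) x)]
    simp only [add_sub_cancel]
    rfl
  rw [← e1, e2]
  change bracket (P 0) (fun p => φ p 1) (fun p => φ p 2) x - _ + _ - _ = _
  have e3 : plane (0, bracketChart P' φ 0 x) = plane (0, φ x) := rfl
  rw [e3]
  simp only [normalBivec, bivec, polFun, plane_apply, Matrix.cons_val]
  ring

/-- The remainder of the bracket `{z, x}` in the coordinates `bracketChart`. -/
theorem remainder_zx (hP' : P' =ᶠ[𝓝 (0, 0)] fun q => P q.1 q.2) (hP's : ContDiff ℝ ∞ P')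
    (hφ : ContDiff ℝ ∞ φ) (h00 : P 0 0 = 0)
    (hanti : ∀ᶠ x in 𝓝 0, ∀ i j, P 0 x i j = -P 0 x j i)
    (h : (fun x => inCoords (P 0) φ x - normalBivec f g (φ x)) =o[𝓝 0] fun x => ‖x‖ ^ 2) :
    (fun x => famBracket P' (fun q => bracketChart P' φ q.1 q.2 2)
          (fun q => bracketChart P' φ q.1 q.2 0) (0, x)
        - (polFun (MvPolynomial.pderiv 1 f) (plane (0, bracketChart P' φ 0 x))
          + polFun (MvPolynomial.pderiv 1 g) (plane (0, bracketChart P' φ 0 x))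
            * bracketChart P' φ 0 x 2)) =o[𝓝 0] fun x => ‖x‖ ^ 2 := by
  have hr2 := isLittleO_bracketChart_sub hP' hφ h
  have hc := contDiff_bracketChart hP's hφ
  have hc0 : ∀ i, ContDiff ℝ ∞ fun x => bracketChart P' φ 0 x i := fun i =>
    (hc i).comp (contDiff_prodMk_right 0)
  have hφi : ∀ i, ContDiff ℝ ∞ fun x => φ x i := fun i => (contDiff_apply ℝ ℝ i).comp hφ
  have hr : ContDiff ℝ ∞ fun x => bracketChart P' φ 0 x 2 - φ x 2 := (hc0 2).sub (hφi 2)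
  have hP0 := (tendsto_slice ((0 : ℝ), (0 : R3))).eventually hP'
  have hπ : DifferentiableAt ℝ (P 0) 0 :=
    ((hP's.comp (contDiff_prodMk_right 0)).differentiable (by simp) 0).congr_of_eventuallyEq
      (hP0.mono fun x hx => hx.symm)
  have h1 : (fun x => (inCoords (P 0) φ x - normalBivec f g (φ x)) 2 0) =o[𝓝 0]
      fun x => ‖x‖ ^ 2 := isLittleO_pi.1 (isLittleO_pi.1 h 2) 0
  have h2 := isLittleO_bracket_remainder hπ h00 (hφi 0) hr hr2
  have h3 : (fun x => polFun (MvPolynomial.pderiv 1 g) (plane (0, φ x))) =O[𝓝 0]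
      fun _ => (1 : ℝ) :=
    (((contDiff_polFun _).continuous.comp (plane.continuous.comp
      (continuous_const.prodMk hφ.continuous))).tendsto 0).isBigO_one ℝ
  have h4 := h3.mul_isLittleO hr2
  simp only [one_mul] at h4
  refine ((h1.sub h2).sub h4).congr' ?_ .rfl
  filter_upwards [hP0, hanti] with x hx ha
  have e1 := bracket_eq_famBracket (hc 2) (hc 0) hx
  have e2 : bracket (P 0) (fun p => bracketChart P' φ 0 p 2) (fun p => bracketChart P' φ 0 p 0) x =
      bracket (P 0) (fun p => φ p 2) (fun p => φ p 0) x
        - bracket (P 0) (fun p => φ p 0) (fun p => bracketChart P' φ 0 p 2 - φ p 2) x := by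
    rw [bracket_swap ha (fun p => φ p 0), sub_neg_eq_add,
      ← bracket_add_left _ _ ((hφi 2).differentiable (by simp) x)
      (hr.differentiable (by simp) x)]
    simp only [add_sub_cancel]
    rfl
  rw [← e1, e2]
  change bracket (P 0) (fun p => φ p 2) (fun p => φ p 0) x - _ - _ - _ = _
  have e3 : plane (0, bracketChart P' φ 0 x) = plane (0, φ x) := rfl
  rw [e3]
  simp only [normalBivec, bivec, polFun, plane_apply, Matrix.cons_val]
  ring

/-- `bracketChart` is a family of charts. -/
theorem isLocalChartFamily_bracketChart (hP's : ContDiff ℝ ∞ P') (hφ : ContDiff ℝ ∞ φ)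
    (hc : IsLocalChart φ 0)
    (hr2 : (fun x => bracketChart P' φ 0 x 2 - φ x 2) =o[𝓝 0] fun x => ‖x‖ ^ 2) :
    IsLocalChartFamily (bracketChart P' φ) := by
  have hcs := contDiff_bracketChart hP's hφ
  have hr : ContDiff ℝ ∞ fun x => bracketChart P' φ 0 x 2 - φ x 2 :=
    ((hcs 2).comp (contDiff_prodMk_right 0)).sub ((contDiff_apply ℝ ℝ 2).comp hφ)
  obtain ⟨hr0, hr1, -⟩ := jet_two_eq_zero hr hr2
  have heq : bracketChart P' φ 0 = fun x =>
      φ x + (bracketChart P' φ 0 x 2 - φ x 2) • (Pi.single 2 1 : R3) := by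
    ext x i
    fin_cases i <;> simp [bracketChart]
  have hd : HasFDerivAt (bracketChart P' φ 0) (fderiv ℝ φ 0) 0 := by
    rw [heq]
    have h1 := (hr.differentiable (by simp) 0).hasFDerivAt
    rw [hr1] at h1
    refine ((hφ.differentiable (by simp) 0).hasFDerivAt.add
      (h1.smul_const (Pi.single 2 1 : R3))).congr_fderiv ?_
    ext v i
    simp
  refine ⟨(contDiff_pi.2 hcs).smoothNear _, ?_, hd.fderiv ▸ hc.det_ne⟩
  refine (congrFun heq 0).trans ?_
  rw [hr0, hc.center]
  simp

end

/-- The determinant of the Gram matrix `Sᵀ M S = diag (2, 2σ)` of a symmetric matrix `M`. -/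
theorem gram_det {s t u v a b c σ : ℝ} (h1 : s ^ 2 * a + 2 * (s * u) * b + u ^ 2 * c = 2)
    (h2 : s * t * a + (s * v + u * t) * b + u * v * c = 0)
    (h3 : t ^ 2 * a + 2 * (t * v) * b + v ^ 2 * c = 2 * σ) :
    (s * v - t * u) ^ 2 * (a * c - b * b) = 4 * σ := by
  linear_combination (t ^ 2 * a + 2 * (t * v) * b + v ^ 2 * c) * h1 + 2 * h3
    - (s * t * a + (s * v + u * t) * b + u * v * c) * h2

/-- A family unfolding an `N` singularity has a reduction, with the Hessian of `g` as the derivative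
of `(A, B)`. -/
theorem exists_reduction {σ : ℝ} (hσ : σ ≠ 0) (hP : IsLocalPoissonFamily P) (hN : IsN σ (P 0) 0) :
    ∃ (R : Reduction P) (S : Matrix (Fin 2) (Fin 2) ℝ), R.A (0, 0) = 0 ∧ R.B (0, 0) = 0 ∧
      R.C (0, 0) = 0 ∧ S.det ≠ 0 ∧
      S 0 0 ^ 2 * dx R.A (0, 0) + 2 * (S 0 0 * S 1 0) * dy R.A (0, 0)
        + S 1 0 ^ 2 * dy R.B (0, 0) = 2 ∧
      S 0 0 * S 0 1 * dx R.A (0, 0) + (S 0 0 * S 1 1 + S 1 0 * S 0 1) * dy R.A (0, 0)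
        + S 1 0 * S 1 1 * dy R.B (0, 0) = 0 ∧
      S 0 1 ^ 2 * dx R.A (0, 0) + 2 * (S 0 1 * S 1 1) * dy R.A (0, 0)
        + S 1 1 ^ 2 * dy R.B (0, 0) = 2 * σ := by
  obtain ⟨f, g, hf, hg, ⟨S, hSdet, hS⟩, φ₀, hφ₀, hjet₀⟩ := hN
  obtain ⟨φ, hφ, hφe⟩ := hφ₀.smooth.exists_contDiff
  obtain ⟨P', hP's, hP'⟩ := SmoothNear.exists_contDiff (F := Bivec)
    (f := fun q : ℝ × R3 => P q.1 q.2) hP.smooth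
  have hch : IsLocalChart φ 0 :=
    ⟨hφ.smoothNear 0, hφe.self_of_nhds.trans hφ₀.center, by
      rw [hφe.fderiv_eq]
      exact hφ₀.det_ne⟩
  have hjet : (fun x => inCoords (P 0) φ x - normalBivec f g (φ x)) =o[𝓝 0] fun x => ‖x‖ ^ 2 := by
    simp only [sub_zero] at hjet₀
    refine hjet₀.congr' ?_ .rfl
    filter_upwards [hφe.eventually_nhds] with x hx
    have hxi : ∀ i, (fun x => φ₀ x i) =ᶠ[𝓝 x] fun x => φ x i := fun i =>
      hx.mono fun y hy => congrFun hy.symm i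
    rw [hx.self_of_nhds]
    congr 1
    ext i j
    exact bracket_congr (hxi i) (hxi j)
  have h00 := eq_zero_of_jet hf hch hjet
  have hr2 := isLittleO_bracketChart_sub hP' hφ hjet
  have hΦ := isLocalChartFamily_bracketChart hP's hφ hch hr2
  obtain ⟨Ψ, hΨ, hΨ0, hΦΨ, hΨΦ⟩ := hΦ.exists_inverse
  have hcs := contDiff_bracketChart hP's hφ
  set Fb := famBracket P' (fun q => bracketChart P' φ q.1 q.2 1)
    (fun q => bracketChart P' φ q.1 q.2 2) with hFb
  set Gb := famBracket P' (fun q => bracketChart P' φ q.1 q.2 2)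
    (fun q => bracketChart P' φ q.1 q.2 0) with hGb
  have hFbs : ContDiff ℝ ∞ Fb := contDiff_famBracket hP's (hcs 1) (hcs 2)
  have hGbs : ContDiff ℝ ∞ Gb := contDiff_famBracket hP's (hcs 2) (hcs 0)
  have hF : ContDiff ℝ ∞ fun q : ℝ × R3 => Fb (q.1, Ψ q) := hFbs.comp (contDiff_fst.prodMk hΨ)
  have hG : ContDiff ℝ ∞ fun q : ℝ × R3 => Gb (q.1, Ψ q) := hGbs.comp (contDiff_fst.prodMk hΨ)
  have hB : HasBrackets P (bracketChart P' φ) (fun q => Fb (q.1, Ψ q))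
      fun q => Gb (q.1, Ψ q) := by
    filter_upwards [inCoords_bracketChart hP hP's hP' hφ, hΨΦ] with q hq hq'
    rw [hq, hq']
  have hO := isBigO_inverse hΨ hΨ0
  have hO2 : (fun w : R3 => ‖Ψ (0, w)‖ ^ 2) =O[𝓝 0] fun w => ‖w‖ ^ 2 := hO.norm_norm.pow 2
  have hΨt : Tendsto (fun w : R3 => Ψ (0, w)) (𝓝 0) (𝓝 0) :=
    (hΨ.continuous.comp (Continuous.prodMk_right 0)).tendsto' _ _ hΨ0
  have hΦΨ0 : ∀ᶠ w in 𝓝 (0 : R3), bracketChart P' φ 0 (Ψ (0, w)) = w :=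
    (tendsto_slice ((0 : ℝ), (0 : R3))).eventually hΦΨ
  have hFr := ((remainder_yz hP' hP's hφ h00 hjet).comp_tendsto hΨt).trans_isBigO hO2
  have hGr := ((remainder_zx hP' hP's hφ h00
    ((tendsto_slice ((0 : ℝ), (0 : R3))).eventually hP.antisymm)
      hjet).comp_tendsto hΨt).trans_isBigO
      hO2
  obtain ⟨⟨jF, jFx, jFy⟩, jFx', jFy'⟩ := jets_of_remainder hF _ _ (hFr.congr' (by
    filter_upwards [hΦΨ0] with w hw
    simp only [Function.comp_apply, hw]
    rfl) .rfl)
  obtain ⟨⟨jG, jGx, jGy⟩, -, -⟩ := jets_of_remainder hG _ _ (hGr.congr' (by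
    filter_upwards [hΦΨ0] with w hw
    simp only [Function.comp_apply, hw]
    rfl) .rfl)
  rw [← dx_polFun] at jFx jFy
  rw [← dy_polFun] at jGx jGy
  rw [polFun_zero hg.pderiv (by norm_num)] at jF jG
  rw [dx_polFun, polFun_zero hf.pderiv.pderiv (by norm_num)] at jFx'
  rw [dy_polFun, polFun_zero hf.pderiv.pderiv (by norm_num)] at jFy'
  obtain ⟨g1, g2, g3⟩ := gram_of_rEquivDiag hg hS jFx.symm jFy.symm jGy.symm
  have hcomm : dx (dy (polFun g)) (0, (0, 0)) = dy (dx (polFun g)) (0, (0, 0)) :=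
    dx_dy_comm (contDiff_polFun g)
  have hjac : jac (Reduction.dzZero fun q : ℝ × R3 => Fb (q.1, Ψ q))
      (Reduction.dzZero fun q : ℝ × R3 => Gb (q.1, Ψ q)) (0, (0, 0)) ≠ 0 := by
    rw [jac, jGx, hcomm, ← jFy]
    intro h0
    apply hσ
    have h1 := gram_det g1 g2 g3
    rw [h0, mul_zero] at h1
    linarith
  obtain ⟨R, hRA, hRB, hRC⟩ := exists_reduction_of_hasBrackets hP hΦ hF hG hB jF jG hjac
  refine ⟨R, S, hRA ▸ jF, hRB ▸ jG, ?_, hSdet, ?_, ?_, ?_⟩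
  · have hRs : ContDiff ℝ ∞ fun q : ℝ × (ℝ × ℝ) => Fb ((lift q 0).1, Ψ (lift q 0)) :=
      hF.comp contDiff_lift_zero
    have hRA0 : R.A (0, (0, 0)) = 0 := hRA ▸ jF
    have h1 := dx_congr hRC
    have h2 := dy_congr hRC
    rw [dx_mul R.smooth_C R.smooth_A] at h1
    rw [dy_mul R.smooth_C R.smooth_A] at h2
    by_contra hC
    have h3 : dx R.A (0, (0, 0)) = 0 := by
      refine (mul_eq_zero.1 (?_ : R.C (0, (0, 0)) * _ = 0)).resolve_left hC
      linear_combination jFx' - h1 - dx R.C (0, (0, 0)) * hRA0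
    have h4 : dy R.A (0, (0, 0)) = 0 := by
      refine (mul_eq_zero.1 (?_ : R.C (0, (0, 0)) * _ = 0)).resolve_left hC
      linear_combination jFy' - h2 - dy R.C (0, (0, 0)) * hRA0
    apply hjac
    rw [jac, ← hRA, h3, h4]
    ring
  · rw [hRA, hRB]
    exact g1
  · rw [hRA, hRB]
    exact g2
  · rw [hRA, hRB]
    exact g3

theorem nonempty_normalForm_of_isN {σ : ℝ} (hσ : σ = 1 ∨ σ = -1) (hP : IsLocalPoissonFamily P)
    (hN : IsN σ (P 0) 0) : Nonempty (NormalForm σ P) := by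
  have hσ0 : σ ≠ 0 := by rcases hσ with rfl | rfl <;> norm_num
  obtain ⟨R, S, hA0, hB0, hC0, hS, hα, hβ, hγ⟩ := exists_reduction hσ0 hP hN
  obtain ⟨R', hl, hC, hd⟩ := R.exists_diagonal hP hσ hA0 hB0 hC0 S hS hα hβ hγ
  exact R'.nonempty_normalForm hP hσ hl hC hd

/-! ### Expansions in the plane -/

section Plane

variable {f : ℝ × (ℝ × ℝ) → ℝ}

/-- The coefficients of a first order expansion are the partial derivatives. -/
theorem first_jet_of_isLittleO (hf : ContDiff ℝ ∞ f) {ε a b : ℝ}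
    (h : (fun v : ℝ × ℝ => f (ε, v) - (a * v.1 + b * v.2)) =o[𝓝 0] fun v => ‖v‖) :
    f (ε, 0) = 0 ∧ dx f (ε, 0) = a ∧ dy f (ε, 0) = b := by
  have h0 : f (ε, 0) = 0 := by simpa using (isLittleO_iff.1 h one_pos).self_of_nhds
  have h1 : HasFDerivAt (fun v => f (ε, v)) (a • ContinuousLinearMap.fst ℝ ℝ ℝ
      + b • ContinuousLinearMap.snd ℝ ℝ ℝ) 0 := by
    rw [hasFDerivAt_iff_isLittleO_nhds_zero]
    simpa [h0] using h.of_norm_right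
  have h2 := h1.unique (hasFDerivAt_slice hf ε 0)
  refine ⟨h0, ?_, ?_⟩
  · simpa using (congrArg (fun L : ℝ × ℝ →L[ℝ] ℝ => L (1, 0)) h2).symm
  · simpa using (congrArg (fun L : ℝ × ℝ →L[ℝ] ℝ => L (0, 1)) h2).symm

/-- The coefficients of a second order expansion are given by the partial derivatives. -/
theorem second_jet_of_isLittleO (hf : ContDiff ℝ ∞ f) {ε m n σ : ℝ}
    (h : (fun v : ℝ × ℝ => f (ε, v) - (m + n * (v.1 ^ 2 + σ * v.2 ^ 2))) =o[𝓝 0]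
      fun v => ‖v‖ ^ 2) :
    f (ε, 0) = m ∧ dx f (ε, 0) = 0 ∧ dy f (ε, 0) = 0 ∧ dx (dx f) (ε, 0) = 2 * n := by
  set g : ℝ × (ℝ × ℝ) → ℝ := fun q => f q - (m + n * (q.2.1 ^ 2 + σ * q.2.2 ^ 2)) with hg
  have hps : ContDiff ℝ ∞ fun q : ℝ × (ℝ × ℝ) => m + n * (q.2.1 ^ 2 + σ * q.2.2 ^ 2) := by fun_prop
  have hgs : ContDiff ℝ ∞ g := hf.sub hps
  obtain ⟨j0, j1, j2⟩ := jet_two_eq_zero (hgs.comp (contDiff_prodMk_right ε)) h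
  have hdx : ∀ q, dx g q = dx f q - 2 * n * q.2.1 := fun q => by
    have h1 : dx (fun q : ℝ × (ℝ × ℝ) => m + n * (q.2.1 ^ 2 + σ * q.2.2 ^ 2)) q =
        2 * n * q.2.1 := by
      refine dx_eq_of_hasDerivAt (x := q.2.1) hps ?_
      have := ((((hasDerivAt_id q.2.1).pow 2).add_const (σ * q.2.2 ^ 2)).const_mul n).const_add m
      refine this.congr_deriv ?_
      simp
      ring
    rw [hg, dx_sub hf hps, h1]
  have hdy : ∀ q, dy g q = dy f q - 2 * n * σ * q.2.2 := fun q => by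
    have h1 : dy (fun q : ℝ × (ℝ × ℝ) => m + n * (q.2.1 ^ 2 + σ * q.2.2 ^ 2)) q =
        2 * n * σ * q.2.2 := by
      refine dy_eq_of_hasDerivAt (y := q.2.2) hps ?_
      have := (((((hasDerivAt_id q.2.2).pow 2).const_mul σ).const_add (q.2.1 ^ 2)).const_mul
        n).const_add m
      refine this.congr_deriv ?_
      simp
      ring
    rw [hg, dy_sub hf hps, h1]
  have e1 : ∀ v w : ℝ × ℝ, fderiv ℝ (g ∘ Prod.mk ε) v w = fderiv ℝ g (ε, v) (0, w) := fun v w =>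
    fderiv_slice hgs ε v w
  have k1 : dx g (ε, 0) = 0 := by
    have := e1 0 (1, 0)
    rw [j1] at this
    exact this.symm
  have k2 : dy g (ε, 0) = 0 := by
    have := e1 0 (0, 1)
    rw [j1] at this
    exact this.symm
  have k3 : dx (dx g) (ε, 0) = 0 := by
    have h3 := j2.clm_apply (hasFDerivAt_const ((1 : ℝ), (0 : ℝ)) (0 : ℝ × ℝ))
    have h4 : HasFDerivAt (fun v : ℝ × ℝ => dx g (ε, v)) (0 : ℝ × ℝ →L[ℝ] ℝ) 0 := by
      refine (h3.congr_of_eventuallyEq (.of_forall fun v => (e1 v (1, 0)).symm)).congr_fderiv ?_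
      ext <;> simp
    have h5 := fderiv_slice (contDiff_dx hgs) ε 0 ((1 : ℝ), (0 : ℝ))
    rw [h4.fderiv] at h5
    exact h5.symm
  rw [hdx] at k1
  rw [hdy] at k2
  refine ⟨?_, by simpa using k1, by simpa using k2, ?_⟩
  · have : f (ε, 0) - (m + n * ((0 : ℝ) ^ 2 + σ * (0 : ℝ) ^ 2)) = 0 := j0
    linarith
  · have h6 : dx (fun q : ℝ × (ℝ × ℝ) => 2 * n * q.2.1) (ε, ((0 : ℝ), (0 : ℝ))) = 2 * n := by
      refine dx_eq_of_hasDerivAt (by fun_prop) ?_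
      simpa using! (hasDerivAt_id (0 : ℝ)).const_mul (2 * n)
    rw [funext hdx, dx_sub (contDiff_dx hf) (by fun_prop)] at k3
    have h7 : dx (fun q : ℝ × (ℝ × ℝ) => 2 * n * q.2.1) (ε, (0 : ℝ × ℝ)) = 2 * n := h6
    linarith

/-- Second order Taylor expansion with smooth coefficients. -/
theorem exists_quadratic_expansion (hf : ContDiff ℝ ∞ f) :
    ∃ a b c : ℝ × (ℝ × ℝ) → ℝ, ContDiff ℝ ∞ a ∧ ContDiff ℝ ∞ b ∧ ContDiff ℝ ∞ c ∧ ∀ q,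
      f q = f (q.1, 0) + q.2.1 * dx f (q.1, 0) + q.2.2 * dy f (q.1, 0)
        + (q.2.1 ^ 2 * a q + q.2.1 * q.2.2 * b q + q.2.2 ^ 2 * c q) := by
  let lx : ℝ × (ℝ × ℝ) →L[ℝ] ℝ := (ContinuousLinearMap.fst ℝ ℝ ℝ).comp (.snd ℝ ℝ (ℝ × ℝ))
  let ly : ℝ × (ℝ × ℝ) →L[ℝ] ℝ := (ContinuousLinearMap.snd ℝ ℝ ℝ).comp (.snd ℝ ℝ (ℝ × ℝ))
  have ex : ∀ q : ℝ × (ℝ × ℝ), q - lx q • ((0 : ℝ), ((1 : ℝ), (0 : ℝ))) = (q.1, (0, q.2.2)) :=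
    fun q => by ext <;> simp [lx]
  have ey : ∀ q : ℝ × (ℝ × ℝ), q - ly q • ((0 : ℝ), ((0 : ℝ), (1 : ℝ))) = (q.1, (q.2.1, 0)) :=
    fun q => by ext <;> simp [ly]
  obtain ⟨h₁, hh₁, e1⟩ := exists_hadamard hf lx (0, (1, 0))
  obtain ⟨a, ha, e2⟩ := exists_hadamard hh₁ lx (0, (1, 0))
  obtain ⟨b, hb, e3⟩ := exists_hadamard hh₁ ly (0, (0, 1))
  obtain ⟨k, hk, e4⟩ := exists_hadamard hf ly (0, (0, 1))
  obtain ⟨c, hc, e5⟩ := exists_hadamard hk ly (0, (0, 1))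
  simp only [ex, ey, smul_eq_mul] at e1 e2 e3 e4 e5
  have d1 : ∀ ε : ℝ, dx f (ε, ((0 : ℝ), (0 : ℝ))) = h₁ (ε, (0, 0)) := fun ε => by
    refine dx_eq_of_hasDerivAt hf ?_
    have h2 : (fun x : ℝ => f (ε, (x, 0))) = fun x => f (ε, (0, 0)) + x * h₁ (ε, (x, 0)) :=
      funext fun x => e1 (ε, (x, 0))
    rw [h2]
    refine (((hasDerivAt_id (0 : ℝ)).mul (hasDerivAt_x hh₁ ε 0 0)).const_add _).congr_deriv ?_
    simp
  have d2 : ∀ ε : ℝ, dy f (ε, ((0 : ℝ), (0 : ℝ))) = k (ε, (0, 0)) := fun ε => by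
    refine dy_eq_of_hasDerivAt hf ?_
    have h2 : (fun y : ℝ => f (ε, (0, y))) = fun y => f (ε, (0, 0)) + y * k (ε, (0, y)) :=
      funext fun y => e4 (ε, (0, y))
    rw [h2]
    refine (((hasDerivAt_id (0 : ℝ)).mul (hasDerivAt_y hk ε 0 0)).const_add _).congr_deriv ?_
    simp
  have hr : ContDiff ℝ ∞ fun q : ℝ × (ℝ × ℝ) => (q.1, ((0 : ℝ), q.2.2)) := by fun_prop
  refine ⟨a, fun q => b (q.1, (0, q.2.2)), fun q => c (q.1, (0, q.2.2)), ha, hb.comp hr,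
    hc.comp hr, fun q => ?_⟩
  have i1 := e1 q
  have i2 := e2 q
  have i3 := e3 (q.1, (0, q.2.2))
  have i4 := e4 (q.1, (0, q.2.2))
  have i5 := e5 (q.1, (0, q.2.2))
  change f q = _ + q.2.1 * _ at i1
  change h₁ q = _ + q.2.1 * _ at i2
  change _ = _ + q.2.2 * _ at i3 i4 i5
  change f q = f (q.1, (0, 0)) + q.2.1 * dx f (q.1, (0, 0)) + q.2.2 * dy f (q.1, (0, 0)) + _
  rw [d1, d2]
  linear_combination i1 + q.2.1 * i2 + q.2.1 * i3 + i4 + q.2.2 * i5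

/-- A quadratic expression with continuous coefficients that is `o(‖v‖²)` has coefficients vanishing
at the origin. -/
theorem coeff_eq_zero_of_isLittleO {a b c : ℝ × ℝ → ℝ} (ha : Continuous a) (hb : Continuous b)
    (hc : Continuous c)
    (h : (fun v : ℝ × ℝ => v.1 ^ 2 * a v + v.1 * v.2 * b v + v.2 ^ 2 * c v) =o[𝓝 0]
      fun v => ‖v‖ ^ 2) : a 0 = 0 ∧ b 0 = 0 ∧ c 0 = 0 := by
  have key : ∀ w : ℝ × ℝ, w.1 ^ 2 * a 0 + w.1 * w.2 * b 0 + w.2 ^ 2 * c 0 = 0 := fun w => by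
    have hcw : Continuous fun t : ℝ => t • w := by fun_prop
    set k : ℝ → ℝ := fun t =>
      w.1 ^ 2 * a (t • w) + w.1 * w.2 * b (t • w) + w.2 ^ 2 * c (t • w) with hk
    have hkc : Continuous k := by
      have := ha.comp hcw
      have := hb.comp hcw
      have := hc.comp hcw
      fun_prop
    have h1 : (fun t : ℝ => t ^ 2 * k t) =o[𝓝 0] fun t : ℝ => t ^ 2 := by
      have h2 := h.comp_tendsto (hcw.tendsto' 0 0 (zero_smul ℝ w))
      refine (h2.congr_left fun t => ?_).trans_isBigO ?_
      · simp only [Function.comp_apply, hk, Prod.smul_fst, Prod.smul_snd, smul_eq_mul]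
        ring
      · refine IsBigO.of_bound (‖w‖ ^ 2) (.of_forall fun t => ?_)
        simp only [Function.comp_apply, norm_smul, norm_pow, norm_mul, norm_norm]
        linarith [mul_pow ‖t‖ ‖w‖ 2]
    have h3 : (fun t : ℝ => k t - k 0) =o[𝓝 0] fun _ => (1 : ℝ) := by
      rw [isLittleO_one_iff]
      exact (hkc.sub continuous_const).tendsto' 0 0 (sub_self _)
    have h4 : (fun t : ℝ => t ^ 2 * (k t - k 0)) =o[𝓝 0] fun t : ℝ => t ^ 2 := by
      simpa using (isBigO_refl (fun t : ℝ => t ^ 2) (𝓝 0)).mul_isLittleO h3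
    have h5 : k 0 = 0 := eq_zero_of_isLittleO_pow (k := 2)
      ((h1.sub h4).congr_left fun t => by simp only [smul_eq_mul]; ring)
    simpa [hk] using h5
  have k1 := key (1, 0)
  have k2 := key (0, 1)
  have k3 := key (1, 1)
  simp only at k1 k2 k3
  exact ⟨by linarith, by linarith, by linarith⟩

/-- Near a point where a function is positive, its square root extends smoothly. -/
theorem exists_smooth_sqrt (hf : ContDiff ℝ ∞ f) (h0 : 0 < f (0, 0)) :
    ∃ s : ℝ × (ℝ × ℝ) → ℝ, ContDiff ℝ ∞ s ∧ s (0, 0) ≠ 0 ∧ ∀ᶠ q in 𝓝 (0, 0), s q ^ 2 = f q := by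
  have hne : ∀ᶠ q in 𝓝 (0, 0), 0 < f q := hf.continuous.continuousAt.eventually_const_lt h0
  have hs : SmoothNear (fun q => √(f q)) (0, 0) := by
    filter_upwards [hne] with q hq
    exact hf.contDiffAt.sqrt hq.ne'
  obtain ⟨s, hs', hse⟩ := hs.exists_contDiff
  have hsq : ∀ᶠ q in 𝓝 (0, 0), s q ^ 2 = f q := by
    filter_upwards [hse, hne] with q h1 h2
    rw [h1, Real.sq_sqrt h2.le]
  refine ⟨s, hs', fun h => ?_, hsq⟩
  have := hsq.self_of_nhds
  rw [h] at this
  norm_num at this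
  exact h0.ne this

/-- The Morse lemma with parameters for a critical point of signature `(1, σ)`: the quadratic
expansion is diagonalized by completing the square. -/
theorem exists_morse_coordinates (hf : ContDiff ℝ ∞ f) {σ m : ℝ} (hσ : σ = 1 ∨ σ = -1)
    (hm : m ≠ 0) (hcrit : ∀ᶠ ε in 𝓝 (0 : ℝ), dx f (ε, 0) = 0 ∧ dy f (ε, 0) = 0)
    (h2 : (fun v : ℝ × ℝ => f (0, v) - m * (v.1 ^ 2 + σ * v.2 ^ 2)) =o[𝓝 0] fun v => ‖v‖ ^ 2) :
    ∃ X Y : ℝ × (ℝ × ℝ) → ℝ, ContDiff ℝ ∞ X ∧ ContDiff ℝ ∞ Y ∧ (∀ ε, X (ε, 0) = 0) ∧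
      (∀ ε, Y (ε, 0) = 0) ∧ jac X Y (0, 0) ≠ 0 ∧
      ∀ᶠ q in 𝓝 (0, 0), f q = f (q.1, 0) + m * (X q ^ 2 + σ * Y q ^ 2) := by
  have hσ2 : σ * σ = 1 := by rcases hσ with rfl | rfl <;> norm_num
  obtain ⟨a, b, c, ha, hb, hc, hq⟩ := exists_quadratic_expansion hf
  obtain ⟨c1, c2⟩ := hcrit.self_of_nhds
  have h00 : f (0, 0) = 0 := by simpa using (isLittleO_iff.1 h2 one_pos).self_of_nhds
  obtain ⟨ha0, hb0, hc0⟩ := coeff_eq_zero_of_isLittleO (a := fun v => a (0, v) - m)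
    (b := fun v => b (0, v)) (c := fun v => c (0, v) - m * σ)
    ((ha.continuous.comp (Continuous.prodMk_right 0)).sub continuous_const)
    (hb.continuous.comp (Continuous.prodMk_right 0))
    ((hc.continuous.comp (Continuous.prodMk_right 0)).sub continuous_const)
    (h2.congr_left fun v => by
      have e := hq (0, v)
      simp only [h00, c1, c2] at e
      rw [e]
      ring)
  have ha1 : a (0, 0) = m := sub_eq_zero.1 ha0
  have hb1 : b (0, 0) = 0 := hb0
  have hc1 : c (0, 0) = m * σ := sub_eq_zero.1 hc0
  obtain ⟨i, hi, hia⟩ := exists_smooth_inv (J := fun q => 2 * a q) (contDiff_const.mul ha)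
    (by rw [ha1]; exact mul_ne_zero two_ne_zero hm)
  have hts : ContDiff ℝ ∞ fun q => i q * b q := hi.mul hb
  obtain ⟨s₁, hs₁, hs₁0, hs₁q⟩ := exists_smooth_sqrt (f := fun q => m⁻¹ * a q)
    (contDiff_const.mul ha) (by rw [ha1, inv_mul_cancel₀ hm]; norm_num)
  obtain ⟨s₂, hs₂, hs₂0, hs₂q⟩ := exists_smooth_sqrt
    (f := fun q => m⁻¹ * (σ * (c q - i q * b q ^ 2 / 2)))
    (by fun_prop) (by
      simp only [hb1, hc1]
      have : m⁻¹ * (σ * (m * σ - i (0, 0) * 0 ^ 2 / 2)) = (m⁻¹ * m) * (σ * σ) := by ring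
      rw [this, hσ2, inv_mul_cancel₀ hm]
      norm_num)
  have hl : ContDiff ℝ ∞ fun q : ℝ × (ℝ × ℝ) => q.2.1 + i q * b q * q.2.2 := by fun_prop
  have hy : ContDiff ℝ ∞ fun q : ℝ × (ℝ × ℝ) => q.2.2 := by fun_prop
  refine ⟨fun q => s₁ q * (q.2.1 + i q * b q * q.2.2), fun q => s₂ q * q.2.2, hs₁.mul hl,
    hs₂.mul hy, fun ε => by simp, fun ε => by simp, ?_, ?_⟩
  · have hx : ContDiff ℝ ∞ fun q : ℝ × (ℝ × ℝ) => q.2.1 := by fun_prop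
    have dxx : dx (fun q : ℝ × (ℝ × ℝ) => q.2.1) (0, 0) = 1 :=
      dx_eq_of_hasDerivAt (x := (0 : ℝ)) hx (hasDerivAt_id 0)
    rw [jac, dx_mul hs₁ hl, dy_mul hs₂ hy, dx_mul hs₂ hy, dx_add hx (hts.mul hy),
      dx_mul hts hy, dx_snd, dy_snd, dxx]
    simp only [Prod.snd_zero, Prod.fst_zero]
    simp [hs₁0, hs₂0]
  · have hfst : Tendsto (fun q : ℝ × (ℝ × ℝ) => q.1) (𝓝 (0, 0)) (𝓝 0) :=
      continuous_fst.tendsto' _ _ rfl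
    filter_upwards [hia, hs₁q, hs₂q, hfst.eventually hcrit] with q e1 e2 e3 ⟨e4, e5⟩
    rw [hq q, e4, e5]
    simp only [mul_pow, e2, e3]
    linear_combination
      -(a q * (q.2.1 + i q * b q * q.2.2) ^ 2 + σ * σ * (c q - i q * b q ^ 2 / 2) * q.2.2 ^ 2) *
        mul_inv_cancel₀ hm - (c q - i q * b q ^ 2 / 2) * q.2.2 ^ 2 * hσ2
        - (b q * q.2.1 * q.2.2 + i q * b q ^ 2 / 2 * q.2.2 ^ 2) * e1

/-- A family of planar local diffeomorphisms fixing the origin vanishes only there. -/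
theorem eventually_eq_zero_iff {K₀ K₁ : ℝ × (ℝ × ℝ) → ℝ} (h₀ : ContDiff ℝ ∞ K₀)
    (h₁ : ContDiff ℝ ∞ K₁) (hJ : jac K₀ K₁ (0, 0) ≠ 0)
    (hK : ∀ᶠ ε in 𝓝 (0 : ℝ), K₀ (ε, 0) = 0 ∧ K₁ (ε, 0) = 0) :
    ∀ᶠ q in 𝓝 (0, 0), K₀ q = 0 ∧ K₁ q = 0 ↔ q.2 = 0 := by
  obtain ⟨k0, k1⟩ := hK.self_of_nhds
  obtain ⟨Ψ, -, -, -, hΨ⟩ := exists_family_inverse (Φ := fun q => (K₀ q, K₁ q))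
    ((h₀.prodMk h₁).smoothNear _) (Prod.ext k0 k1) (injective_planar h₀ h₁ hJ)
  have hfst : Tendsto (fun q : ℝ × (ℝ × ℝ) => q.1) (𝓝 (0, 0)) (𝓝 0) :=
    continuous_fst.tendsto' _ _ rfl
  have hfst' : Tendsto (fun q : ℝ × (ℝ × ℝ) => (q.1, (0 : ℝ × ℝ))) (𝓝 (0, 0)) (𝓝 (0, 0)) :=
    Continuous.tendsto' (by fun_prop) _ _ rfl
  filter_upwards [hΨ, hfst'.eventually hΨ, hfst.eventually hK] with q e1 e2 ⟨e3, e4⟩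
  constructor
  · rintro ⟨z0, z1⟩
    simp only [z0, z1] at e1
    simp only [e3, e4] at e2
    rw [← e1, e2]
  · intro h
    have : q = (q.1, 0) := Prod.ext rfl h
    rw [this]
    exact ⟨e3, e4⟩

end Plane

/-! ### Singular points of a reduced family -/

/-- The brackets of coordinates obtained by an affine change `N (φ - w₀)`. -/
theorem inCoords_linear {π : R3 → Bivec} {φ : R3 → R3} {p : R3} (hφ : DifferentiableAt ℝ φ p)
    (N : Matrix (Fin 3) (Fin 3) ℝ) (w₀ : R3) (i j : Fin 3) :
    inCoords π (fun x => N.mulVec (φ x - w₀)) p i j =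
      ∑ k, ∑ l, inCoords π φ p k l * N i k * N j l := by
  have hd : ∀ i, HasFDerivAt (fun w : R3 => N.mulVec (w - w₀) i)
      ((ContinuousLinearMap.proj (R := ℝ) (φ := fun _ : Fin 3 => ℝ) i).comp
        (Matrix.mulVecLin N).toContinuousLinearMap) (φ p) := fun i => by
    have := ((ContinuousLinearMap.proj (R := ℝ) (φ := fun _ : Fin 3 => ℝ) i).comp
        (Matrix.mulVecLin N).toContinuousLinearMap).hasFDerivAt.comp (φ p)
        ((hasFDerivAt_id (φ p)).sub_const w₀)
    simpa using! this
  have h := bracket_comp (π := π) (f := fun w => N.mulVec (w - w₀) i)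
    (g := fun w => N.mulVec (w - w₀) j) hφ (hd i).differentiableAt (hd j).differentiableAt
  refine h.trans ?_
  simp only [bracket, (hd i).fderiv, (hd j).fderiv]
  simp

/-- The 1-jet at a zero of a 2-vector in reduced coordinates, after a linear change `N` of these
coordinates. -/
theorem jetEquiv_of_linear {π : R3 → Bivec} {φ : R3 → R3} {p : R3} (hφ : SmoothNear φ p)
    (hinj : Function.Injective (fderiv ℝ φ p)) {F G : R3 → ℝ} (hF : DifferentiableAt ℝ F (φ p))
    (hG : DifferentiableAt ℝ G (φ p)) (h2 : φ p 2 = 0) (hF0 : F (φ p) = 0) (hG0 : G (φ p) = 0)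
    (hb : ∀ᶠ x in 𝓝 p, inCoords π φ x = bivec (φ x 2) (F (φ x)) (G (φ x)))
    (N : Matrix (Fin 3) (Fin 3) ℝ) (hN : N.det ≠ 0) {model : R3 → Bivec}
    (hm : ∀ v i j, model (N.mulVec v) i j =
      ∑ k, ∑ l, bivec (v 2) (fderiv ℝ F (φ p) v) (fderiv ℝ G (φ p) v) k l * N i k * N j l) :
    JetEquiv 1 π p model := by
  have hφd : DifferentiableAt ℝ φ p := hφ.contDiffAt.differentiableAt (by simp)
  have hχ : ContDiff ℝ ∞ fun w : R3 => N.mulVec (w - φ p) :=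
    (Matrix.mulVecLin N).toContinuousLinearMap.contDiff.comp (contDiff_id.sub contDiff_const)
  refine ⟨fun x => N.mulVec (φ x - φ p), ⟨SmoothNear.comp (f := fun w : R3 => N.mulVec (w - φ p))
    (hχ.smoothNear _) hφ, by simp, det_ne_zero_of_injective ?_⟩, ?_⟩
  · have hd : HasFDerivAt (fun x => N.mulVec (φ x - φ p))
        ((Matrix.mulVecLin N).toContinuousLinearMap.comp (fderiv ℝ φ p)) p :=
      (Matrix.mulVecLin N).toContinuousLinearMap.hasFDerivAt.comp p
        (hφd.hasFDerivAt.sub_const (φ p))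
    rw [hd.fderiv]
    exact (Matrix.mulVec_injective_of_isUnit ((Matrix.isUnit_iff_isUnit_det N).2
      (isUnit_iff_ne_zero.2 hN))).comp hinj
  · -- the three coefficients agree with their linear parts up to `o(‖x - p‖)`
    have hO : (fun x => φ x - φ p) =O[𝓝 p] fun x => x - p := hφd.isBigO_sub
    have hlin : ∀ F : R3 → ℝ, DifferentiableAt ℝ F (φ p) → F (φ p) = 0 →
        (fun x => F (φ x) - fderiv ℝ F (φ p) (φ x - φ p)) =o[𝓝 p] fun x => ‖x - p‖ ^ 1 :=
      fun F hF h0 => by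
        have h := (hF.hasFDerivAt.isLittleO.comp_tendsto hφd.continuousAt).trans_isBigO hO
        simp only [pow_one]
        refine (h.congr_left fun x => ?_).norm_right
        simp [h0]
    have h1 := hlin F hF hF0
    have h3 := hlin G hG hG0
    have hent : ∀ k l, (fun x => bivec (φ x 2) (F (φ x)) (G (φ x)) k l
        - bivec ((φ x - φ p) 2) (fderiv ℝ F (φ p) (φ x - φ p)) (fderiv ℝ G (φ p) (φ x - φ p)) k l)
          =o[𝓝 p] fun x => ‖x - p‖ ^ 1 := fun k l => by
      have h0 : (fun _ : R3 => (0 : ℝ)) =o[𝓝 p] fun x => ‖x - p‖ ^ 1 := isLittleO_zero _ _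
      fin_cases k <;> fin_cases l
      · exact h0.congr_left fun x => by simp [bivec]
      · exact h0.congr_left fun x => by simp [bivec, h2]
      · exact h3.neg_left.congr_left fun x => by simp [bivec]; ring
      · exact h0.congr_left fun x => by simp [bivec, h2]
      · exact h0.congr_left fun x => by simp [bivec]
      · exact h1.congr_left fun x => by simp [bivec]
      · exact h3.congr_left fun x => by simp [bivec]
      · exact h1.neg_left.congr_left fun x => by simp [bivec]; ring
      · exact h0.congr_left fun x => by simp [bivec]
    refine isLittleO_pi.2 fun i => isLittleO_pi.2 fun j => ?_
    have hsum : (fun x => ∑ k, ∑ l, (bivec (φ x 2) (F (φ x)) (G (φ x)) k l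
        - bivec ((φ x - φ p) 2) (fderiv ℝ F (φ p) (φ x - φ p))
          (fderiv ℝ G (φ p) (φ x - φ p)) k l) * (N i k * N j l)) =o[𝓝 p] fun x => ‖x - p‖ ^ 1 := by
      refine IsLittleO.fun_sum fun k _ => ?_
      refine IsLittleO.fun_sum fun l _ => ?_
      exact ((hent k l).const_mul_left (N i k * N j l)).congr_left fun x => mul_comm _ _
    refine hsum.congr' ?_ .rfl
    filter_upwards [hb, hφ] with x hx hs
    simp only [Pi.sub_apply, inCoords_linear (hs.differentiableAt (by simp)), hx]
    have := hm (φ x - φ p) i j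
    simp only [Pi.sub_apply] at this
    rw [this]
    simp only [← Finset.sum_sub_distrib]
    refine Finset.sum_congr rfl fun k _ => Finset.sum_congr rfl fun l _ => ?_
    ring

/-! ### The types of the singular points -/

theorem normalBivec_V (h : ℝ) (v : R3) :
    normalBivec (MvPolynomial.C (h / 2) * MvPolynomial.X 0 ^ 2) (MvPolynomial.X 0) v =
      bivec (v 2) (h * v 0 + v 2) 0 := by
  simp [normalBivec, MvPolynomial.pderiv_X, Derivation.leibniz, pow_two]
  ring_nf

theorem wedgeBivec_V (h : ℝ) (v : R3) :
    wedgeBivec !![0, -1; h, 1] v = bivec (v 2) (h * v 0 + v 2) 0 := by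
  simp [wedgeBivec]

/-- The 1-jet `{x,y} = z`, `{y,z} = h x + z`, `{z,x} = 0` is the one of a `V` singularity, with
`f = h x² / 2` and `g = x`. -/
theorem isV_of_jetEquiv {π : R3 → Bivec} {p : R3} {h : ℝ}
    (hj : JetEquiv 1 π p fun v => bivec (v 2) (h * v 0 + v 2) 0) : IsV π p := by
  refine Or.inr ⟨MvPolynomial.C (h / 2) * MvPolynomial.X 0 ^ 2, MvPolynomial.X 0, ?_,
    MvPolynomial.isHomogeneous_X _ _, MvPolynomial.X_ne_zero _, ?_⟩
  · simpa using! (MvPolynomial.isHomogeneous_C (Fin 2) (h / 2)).mul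
      ((MvPolynomial.isHomogeneous_X ℝ (0 : Fin 2)).pow 2)
  · rwa [funext (normalBivec_V h)]

/-- The linear vector field belonging to this 1-jet has the characteristic polynomial
`X² - X + h`. -/
theorem hasEigenvalues_of_jetEquiv {π : R3 → Bivec} {p : R3} {h : ℝ}
    (hj : JetEquiv 1 π p fun v => bivec (v 2) (h * v 0 + v 2) 0) {l₁ l₂ : ℂ} (h1 : l₁ + l₂ = 1)
    (h2 : l₁ * l₂ = h) : HasEigenvalues π p l₁ l₂ := by
  refine ⟨!![0, -1; h, 1], ?_, ?_⟩
  · rwa [funext (wedgeBivec_V h)]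
  · rw [Matrix.charpoly_fin_two, Matrix.trace_fin_two, Matrix.det_fin_two]
    simp only [Matrix.map_apply]
    have e1 : Polynomial.C l₁ + Polynomial.C l₂ = 1 := by rw [← map_add, h1, map_one]
    have e2 : Polynomial.C l₁ * Polynomial.C l₂ = Polynomial.C (h : ℂ) := by rw [← map_mul, h2]
    simp
    linear_combination -e2 + Polynomial.X * e1

/-- Real eigenvalues of the 1-jet `{x,y} = z`, `{y,z} = h x + z`, `{z,x} = 0`. -/
theorem exists_real_eigenvalues {π : R3 → Bivec} {p : R3} {h : ℝ}
    (hj : JetEquiv 1 π p fun v => bivec (v 2) (h * v 0 + v 2) 0) (hd : 0 ≤ 1 - 4 * h) :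
    ∃ l₁ l₂ : ℝ, l₁ * l₂ = h ∧ HasEigenvalues π p l₁ l₂ := by
  have hs := Real.sq_sqrt hd
  have e : (1 + √(1 - 4 * h)) / 2 * ((1 - √(1 - 4 * h)) / 2) = h := by
    linear_combination -hs / 4
  refine ⟨_, _, e, hasEigenvalues_of_jetEquiv hj ?_ ?_⟩
  · push_cast
    ring
  · rw [← Complex.ofReal_mul, e]

theorem isNodeV_of_jetEquiv {π : R3 → Bivec} {p : R3} {h : ℝ}
    (hj : JetEquiv 1 π p fun v => bivec (v 2) (h * v 0 + v 2) 0) (hh : 0 < h)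
    (hd : 0 ≤ 1 - 4 * h) : IsNodeV π p := by
  obtain ⟨l₁, l₂, hl, he⟩ := exists_real_eigenvalues hj hd
  exact ⟨isV_of_jetEquiv hj, l₁, l₂, hl ▸ hh, he⟩

theorem isSaddleV_of_jetEquiv {π : R3 → Bivec} {p : R3} {h : ℝ}
    (hj : JetEquiv 1 π p fun v => bivec (v 2) (h * v 0 + v 2) 0) (hh : h < 0) :
    IsSaddleV π p := by
  obtain ⟨l₁, l₂, hl, he⟩ := exists_real_eigenvalues hj (by linarith)
  exact ⟨isV_of_jetEquiv hj, l₁, l₂, hl ▸ hh, he⟩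

theorem isFocusV_of_jetEquiv {π : R3 → Bivec} {p : R3} {h : ℝ}
    (hj : JetEquiv 1 π p fun v => bivec (v 2) (h * v 0 + v 2) 0) (hd : 1 - 4 * h < 0) :
    IsFocusV π p := by
  have hd' : 0 < 4 * h - 1 := by linarith
  have hs := Real.sq_sqrt hd'.le
  refine ⟨isV_of_jetEquiv hj, 1 / 2, √(4 * h - 1) / 2, by norm_num,
    (half_pos (Real.sqrt_pos.2 hd')).ne', hasEigenvalues_of_jetEquiv hj (by push_cast; ring) ?_⟩
  have hs' : ((√(4 * h - 1) : ℝ) : ℂ) ^ 2 = 4 * h - 1 := by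
    rw [← Complex.ofReal_pow, hs]
    push_cast
    ring
  push_cast
  linear_combination hs' / 4 - (√(4 * h - 1) : ℂ) ^ 2 / 4 * Complex.I_sq

theorem normalBivec_diag (k σ : ℝ) (v : R3) :
    normalBivec (MvPolynomial.C (k / 2) * (MvPolynomial.X 0 ^ 2
      + MvPolynomial.C σ * MvPolynomial.X 1 ^ 2)) 0 v = bivec (v 2) (k * v 0) (σ * k * v 1) := by
  simp [normalBivec, MvPolynomial.pderiv_X, Derivation.leibniz, pow_two]
  ring_nf

theorem isHomogeneous_diag (k σ : ℝ) : (MvPolynomial.C (k / 2) * (MvPolynomial.X 0 ^ 2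
    + MvPolynomial.C σ * MvPolynomial.X 1 ^ 2) : MvPolynomial (Fin 2) ℝ).IsHomogeneous 2 := by
  have h1 : (MvPolynomial.X 0 ^ 2 : MvPolynomial (Fin 2) ℝ).IsHomogeneous 2 := by
    simpa using! (MvPolynomial.isHomogeneous_X ℝ (0 : Fin 2)).pow 2
  have h2 : (MvPolynomial.C σ * MvPolynomial.X 1 ^ 2 : MvPolynomial (Fin 2) ℝ).IsHomogeneous 2 := by
    simpa using! (MvPolynomial.isHomogeneous_C (Fin 2) σ).mul
      ((MvPolynomial.isHomogeneous_X ℝ (1 : Fin 2)).pow 2)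
  simpa using! (MvPolynomial.isHomogeneous_C (Fin 2) (k / 2)).mul (h1.add h2)

/-- Rescaling, with an exchange of the variables if `σ = -1` and `s = -1`. -/
theorem rEquivDiag_scale {k σ s : ℝ} (hs : s = 1 ∨ s = -1) (hk : 0 < s * k) :
    REquivDiag (MvPolynomial.C (k / 2) * (MvPolynomial.X 0 ^ 2
      + MvPolynomial.C σ * MvPolynomial.X 1 ^ 2)) s (s * σ) := by
  have hs2 : s * s = 1 := by rcases hs with rfl | rfl <;> norm_num
  have hr := Real.sq_sqrt (div_pos two_pos hk).le
  have hr0 := Real.sqrt_pos.2 (div_pos two_pos hk)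
  set r := √(2 / (s * k)) with hrdef
  have hkr : k * r ^ 2 = 2 * s := by
    rw [hr]
    have hk0 : k ≠ 0 := by
      rintro rfl
      simp at hk
    have hs0 : s ≠ 0 := by
      rintro rfl
      simp at hk
    field_simp
    linear_combination -hs2
  refine ⟨!![r, 0; 0, r], by simp [hr0.ne'], fun v => ?_⟩
  simp [dotProduct, Fin.sum_univ_two]
  linear_combination (v 0 ^ 2 + σ * v 1 ^ 2) / 2 * hkr

theorem rEquivDiag_swap {f : MvPolynomial (Fin 2) ℝ} {a b : ℝ} (h : REquivDiag f a b) :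
    REquivDiag f b a := by
  obtain ⟨S, hS, hf⟩ := h
  refine ⟨S * !![0, 1; 1, 0], ?_, fun v => ?_⟩
  · rw [Matrix.det_mul]
    simpa using hS
  · rw [← Matrix.mulVec_mulVec, hf]
    simp [Matrix.mulVec, dotProduct, Fin.sum_univ_two]
    ring

theorem isSO3_of_jetEquiv {π : R3 → Bivec} {p : R3} {k : ℝ}
    (hj : JetEquiv 1 π p fun v => bivec (v 2) (k * v 0) (1 * k * v 1)) (hk : 0 < k) :
    IsSO3 π p := by
  refine ⟨_, isHomogeneous_diag k 1, ?_, ?_⟩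
  · simpa using rEquivDiag_scale (σ := 1) (Or.inl rfl) (by simpa using hk : 0 < 1 * k)
  · rwa [funext (normalBivec_diag k 1)]

theorem isSL2_of_jetEquiv_one {π : R3 → Bivec} {p : R3} {k : ℝ}
    (hj : JetEquiv 1 π p fun v => bivec (v 2) (k * v 0) (1 * k * v 1)) (hk : k < 0) :
    IsSL2 π p := by
  refine ⟨_, isHomogeneous_diag k 1, Or.inr ?_, ?_⟩
  · simpa using rEquivDiag_scale (σ := 1) (Or.inr rfl) (by simpa using hk : 0 < (-1) * k)
  · rwa [funext (normalBivec_diag k 1)]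

theorem isSL2_of_jetEquiv_neg_one {π : R3 → Bivec} {p : R3} {k : ℝ}
    (hj : JetEquiv 1 π p fun v => bivec (v 2) (k * v 0) (-1 * k * v 1)) (hk : k ≠ 0) :
    IsSL2 π p := by
  refine ⟨_, isHomogeneous_diag k (-1), Or.inl ?_, ?_⟩
  · rcases hk.lt_or_gt with hk | hk
    · simpa using rEquivDiag_swap
        (rEquivDiag_scale (σ := -1) (Or.inr rfl) (by simpa using hk : 0 < (-1) * k))
    · simpa using rEquivDiag_scale (σ := -1) (Or.inl rfl) (by simpa using hk : 0 < 1 * k)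
  · rwa [funext (normalBivec_diag k (-1))]

/-! ### The singular points of a generic normal form -/

namespace Reduction

variable {P : ℝ → R3 → Bivec} (R : Reduction P)

theorem tendsto_plane_chart :
    Tendsto (fun q : ℝ × R3 => plane (q.1, R.Φ q.1 q.2)) (𝓝 (0, 0)) (𝓝 (0, 0)) :=
  (plane.continuous.tendsto' (0, 0) (0, 0) rfl).comp R.chart.tendsto

theorem fderiv_slice_reducedForm {A C : ℝ × (ℝ × ℝ) → ℝ} {Q : ℝ × R3 → ℝ} (hA : ContDiff ℝ ∞ A)
    (hC : ContDiff ℝ ∞ C) (hQ : ContDiff ℝ ∞ Q) (ε : ℝ) {w : R3} (h2 : w 2 = 0) (v : R3) :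
    fderiv ℝ (fun w => reducedForm A C Q (ε, w)) w v =
      (v 0 * dx A (plane (ε, w)) + v 1 * dy A (plane (ε, w))) * C (plane (ε, w))
        + A (plane (ε, w)) * (v 2 + (v 0 * dx C (plane (ε, w)) + v 1 * dy C (plane (ε, w)))) := by
  rw [fderiv_slice (contDiff_reducedForm hA hC hQ), fderiv_reducedForm hA hC hQ]
  have h : plane ((0 : ℝ), v) = (0, (v 0, v 1)) := rfl
  rw [h, fderiv_plane_direction, fderiv_plane_direction]
  simp only [h2]
  ring

/-- The 1-jets of the reduced family at its singular points, in terms of the derivatives of the two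
coefficients. -/
theorem eventually_jetEquiv : ∀ᶠ q : ℝ × R3 in 𝓝 (0, 0), R.Φ q.1 q.2 2 = 0 →
    R.A (plane (q.1, R.Φ q.1 q.2)) * R.C (plane (q.1, R.Φ q.1 q.2)) = 0 →
    R.B (plane (q.1, R.Φ q.1 q.2)) * R.C (plane (q.1, R.Φ q.1 q.2)) = 0 →
    ∀ (N : Matrix (Fin 3) (Fin 3) ℝ), N.det ≠ 0 → ∀ model : R3 → Bivec,
    (∀ v i j, model (N.mulVec v) i j = ∑ k, ∑ l, bivec (v 2)
      (fderiv ℝ (fun w => reducedForm R.A R.C R.Q₁ (q.1, w)) (R.Φ q.1 q.2) v)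
      (fderiv ℝ (fun w => reducedForm R.B R.C R.Q₂ (q.1, w)) (R.Φ q.1 q.2) v) k l
        * N i k * N j l) →
    JetEquiv 1 (P q.1) q.2 model := by
  filter_upwards [R.chart.eventually_smoothNear, R.chart.eventually_injective,
    R.brackets.eventually_nhds] with q hs hi hb h2 hA hB N hN model hm
  have hF : ContDiff ℝ ∞ fun w => reducedForm R.A R.C R.Q₁ (q.1, w) :=
    (contDiff_reducedForm R.smooth_A R.smooth_C R.smooth_Q₁).comp (contDiff_prodMk_right q.1)
  have hG : ContDiff ℝ ∞ fun w => reducedForm R.B R.C R.Q₂ (q.1, w) :=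
    (contDiff_reducedForm R.smooth_B R.smooth_C R.smooth_Q₂).comp (contDiff_prodMk_right q.1)
  refine jetEquiv_of_linear hs hi (hF.differentiable (by simp) _) (hG.differentiable (by simp) _)
    h2 ?_ ?_ ((tendsto_slice q).eventually hb) N hN hm
  · simp only [reducedForm, h2]
    linear_combination hA
  · simp only [reducedForm, h2]
    linear_combination hB

/-- At a singular point with `(A, B) ≠ 0` the linear part of the reduced form is brought to a
normal form by the coordinates `u = A₀ x + B₀ y` and `s` dual to it. -/
theorem eventually_jetEquiv_V {h : ℝ × (ℝ × ℝ) → ℝ}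
    (hh : ∀ᶠ q in 𝓝 (0, 0), dx R.C q = h q * R.A q - R.C q * R.D₁ q ∧
      dy R.C q = h q * R.B q - R.C q * R.D₂ q) :
    ∀ᶠ q : ℝ × R3 in 𝓝 (0, 0), R.Φ q.1 q.2 2 = 0 → R.C (plane (q.1, R.Φ q.1 q.2)) = 0 →
      ¬(R.A (plane (q.1, R.Φ q.1 q.2)) = 0 ∧ R.B (plane (q.1, R.Φ q.1 q.2)) = 0) →
      JetEquiv 1 (P q.1) q.2
        fun v => bivec (v 2) (h (plane (q.1, R.Φ q.1 q.2)) * v 0 + v 2) 0 := by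
  filter_upwards [R.eventually_jetEquiv, R.tendsto_plane_chart.eventually hh] with q hq hd h2 hC hAB
  have hF := fderiv_slice_reducedForm R.smooth_A R.smooth_C R.smooth_Q₁ q.1 h2
  have hG := fderiv_slice_reducedForm R.smooth_B R.smooth_C R.smooth_Q₂ q.1 h2
  simp only [hC, hd.1, hd.2] at hF hG
  rw [hC, mul_zero, mul_zero] at hq
  set A₀ := R.A (plane (q.1, R.Φ q.1 q.2))
  set B₀ := R.B (plane (q.1, R.Φ q.1 q.2))
  set h₀ := h (plane (q.1, R.Φ q.1 q.2))
  have hΔ : A₀ ^ 2 + B₀ ^ 2 ≠ 0 := fun h0 => hAB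
    ⟨by nlinarith [sq_nonneg A₀, sq_nonneg B₀], by nlinarith [sq_nonneg A₀, sq_nonneg B₀]⟩
  have e : A₀ * (A₀ / (A₀ ^ 2 + B₀ ^ 2)) + B₀ * (B₀ / (A₀ ^ 2 + B₀ ^ 2)) = 1 := by
    field_simp
  set α := A₀ / (A₀ ^ 2 + B₀ ^ 2)
  set β := B₀ / (A₀ ^ 2 + B₀ ^ 2)
  refine hq h2 rfl rfl !![A₀, B₀, 0; -β, α, 0; 0, 0, 1] ?_ _ fun v i j => ?_
  · rw [Matrix.det_fin_three]
    simp
    rw [e]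
    exact one_ne_zero
  · simp only [hF, hG, Matrix.mulVec, dotProduct, Fin.sum_univ_three, bivec]
    fin_cases i <;> fin_cases j <;> simp
    · ring
    · linear_combination -v 2 * e
    · ring
    · linear_combination v 2 * e
    · ring
    · linear_combination -(v 2 + h₀ * (A₀ * v 0 + B₀ * v 1)) * e
    · ring
    · linear_combination (v 2 + h₀ * (A₀ * v 0 + B₀ * v 1)) * e

/-- At the common zero of `A` and `B` the linear part of the reduced form is diagonal. -/
theorem eventually_jetEquiv_zero {σ : ℝ} {l m : ℝ → ℝ}
    (hA : ∀ᶠ ε in 𝓝 (0 : ℝ), R.A (ε, 0) = 0 ∧ dx R.A (ε, 0) = l ε ∧ dy R.A (ε, 0) = 0)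
    (hB : ∀ᶠ ε in 𝓝 (0 : ℝ), R.B (ε, 0) = 0 ∧ dx R.B (ε, 0) = 0 ∧ dy R.B (ε, 0) = σ * l ε)
    (hC : ∀ᶠ ε in 𝓝 (0 : ℝ), R.C (ε, 0) = m ε) :
    ∀ᶠ q : ℝ × R3 in 𝓝 (0, 0), R.Φ q.1 q.2 = 0 →
      JetEquiv 1 (P q.1) q.2 fun v => bivec (v 2) (m q.1 * l q.1 * v 0)
        (σ * (m q.1 * l q.1) * v 1) := by
  have hfst : Tendsto (fun q : ℝ × R3 => q.1) (𝓝 (0, 0)) (𝓝 0) := continuous_fst.tendsto' _ _ rfl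
  filter_upwards [R.eventually_jetEquiv, hfst.eventually hA, hfst.eventually hB,
    hfst.eventually hC] with q hq ⟨a0, ax, ay⟩ ⟨b0, bx, by'⟩ c0 h0
  have h2 : R.Φ q.1 q.2 2 = 0 := by rw [h0]; rfl
  have hpl : plane (q.1, R.Φ q.1 q.2) = (q.1, 0) := by rw [h0]; rfl
  have hF := fderiv_slice_reducedForm R.smooth_A R.smooth_C R.smooth_Q₁ q.1 h2
  have hG := fderiv_slice_reducedForm R.smooth_B R.smooth_C R.smooth_Q₂ q.1 h2
  rw [hpl] at hF hG hq
  simp only [a0, ax, ay, b0, bx, by', c0] at hF hG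
  refine hq h2 (by rw [a0, zero_mul]) (by rw [b0, zero_mul]) 1 (by simp) _ fun v i j => ?_
  simp only [hF, hG, Matrix.one_mulVec, Matrix.one_apply, mul_ite, mul_one, mul_zero,
    Finset.sum_ite_eq, Finset.mem_univ, if_true]
  congr 2 <;> ring

/-- The singular points of a reduced family. -/
theorem eventually_eq_zero_iff : ∀ᶠ q : ℝ × R3 in 𝓝 (0, 0), P q.1 q.2 = 0 ↔
    R.Φ q.1 q.2 2 = 0 ∧ (R.C (plane (q.1, R.Φ q.1 q.2)) = 0 ∨
      (R.A (plane (q.1, R.Φ q.1 q.2)) = 0 ∧ R.B (plane (q.1, R.Φ q.1 q.2)) = 0)) := by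
  filter_upwards [R.chart.eq_zero_iff P, R.brackets] with q hq hb
  rw [hq, hb, bivec_eq_zero_iff]
  refine and_congr_right fun h2 => ?_
  simp only [reducedForm, h2]
  have e : ∀ t u s : ℝ, t * (0 + u) + 0 ^ 2 * s = 0 ↔ t = 0 ∨ u = 0 := fun t u s => by simp
  rw [e, e]
  tauto

end Reduction

namespace NormalForm

variable {σ : ℝ} {P : ℝ → R3 → Bivec}

/-- The functions of a normal form extend to globally defined smooth functions. -/
theorem exists_reduction (D : NormalForm σ P) : ∃ R : Reduction P, R.Φ = D.Φ ∧
    (∀ᶠ ε in 𝓝 (0 : ℝ), R.A (ε, 0) = 0 ∧ dx R.A (ε, 0) = D.l₀ ε ∧ dy R.A (ε, 0) = 0) ∧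
    (∀ᶠ ε in 𝓝 (0 : ℝ), R.B (ε, 0) = 0 ∧ dx R.B (ε, 0) = 0 ∧ dy R.B (ε, 0) = σ * D.l₀ ε) ∧
    (∀ᶠ ε in 𝓝 (0 : ℝ), R.C (ε, 0) = D.m₀ ε ∧ dx R.C (ε, 0) = 0 ∧ dy R.C (ε, 0) = 0 ∧
      dx (dx R.C) (ε, 0) = 2 * D.m₁ ε) ∧
    (fun v : ℝ × ℝ => R.C (0, v) - D.m₁ 0 * (v.1 ^ 2 + σ * v.2 ^ 2)) =o[𝓝 0]
      fun v => ‖v‖ ^ 2 := by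
  obtain ⟨A, hA, eA⟩ := D.smooth_A.exists_contDiff
  obtain ⟨B, hB, eB⟩ := D.smooth_B.exists_contDiff
  obtain ⟨C, hC, eC⟩ := D.smooth_C.exists_contDiff
  obtain ⟨Q₁, hQ₁, eQ₁⟩ := D.smooth_Q₁.exists_contDiff
  obtain ⟨Q₂, hQ₂, eQ₂⟩ := D.smooth_Q₂.exists_contDiff
  have hpl : Tendsto (fun q : ℝ × R3 => plane (q.1, D.Φ q.1 q.2)) (𝓝 (0, 0)) (𝓝 (0, 0)) :=
    (plane.continuous.tendsto' (0, 0) (0, 0) rfl).comp D.chart.tendsto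
  have hloc : ∀ {f g : ℝ × (ℝ × ℝ) → ℝ}, f =ᶠ[𝓝 (0, 0)] g →
      ∀ᶠ ε in 𝓝 (0 : ℝ), ∀ᶠ v in 𝓝 (0 : ℝ × ℝ), f (ε, v) = g (ε, v) := fun h => by
    have h1 := Reduction.tendsto_prodMk_zero.eventually h.eventually_nhds
    filter_upwards [h1] with ε hε
    exact (tendsto_slice (ε, (0 : ℝ × ℝ))).eventually hε
  have jC : ∀ᶠ ε in 𝓝 (0 : ℝ), (fun v : ℝ × ℝ => C (ε, v) - (D.m₀ ε
      + D.m₁ ε * (v.1 ^ 2 + σ * v.2 ^ 2))) =o[𝓝 0] fun v => ‖v‖ ^ 2 := by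
    filter_upwards [D.expand_C, hloc eC] with ε h1 h2
    exact h1.congr' (h2.mono fun v hv => by simp only [hv]) .rfl
  refine ⟨⟨D.Φ, A, B, C, Q₁, Q₂, D.chart, hA, hB, hC, hQ₁, hQ₂, ?_⟩, rfl, ?_, ?_, ?_, ?_⟩
  · filter_upwards [D.reduces, hpl.eventually eA, hpl.eventually eB, hpl.eventually eC,
      D.chart.tendsto.eventually eQ₁, D.chart.tendsto.eventually eQ₂] with q hq a b c q₁ q₂
    have eta : D.Φ q.1 q.2 = ![D.Φ q.1 q.2 0, D.Φ q.1 q.2 1, D.Φ q.1 q.2 2] := by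
      ext i
      fin_cases i <;> rfl
    rw [hq _ _ _ eta, ← eta]
    simp only [reducedForm, a, b, c, q₁, q₂]
    rfl
  · filter_upwards [D.expand_A, hloc eA] with ε h1 h2
    exact first_jet_of_isLittleO hA (b := 0)
      (h1.congr' (h2.mono fun v hv => by simp only [hv, zero_mul, add_zero]) .rfl)
  · filter_upwards [D.expand_B, hloc eB] with ε h1 h2
    exact first_jet_of_isLittleO hB (a := 0)
      (h1.congr' (h2.mono fun v hv => by simp only [hv, zero_mul, zero_add]) .rfl)
  · filter_upwards [jC] with ε hε
    exact second_jet_of_isLittleO hC hε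
  · have h := jC.self_of_nhds
    simpa only [D.m₀_zero, zero_add] using h

/-- The coefficient `m₀` is `ε` times a smooth function. -/
theorem exists_m₀_eq (D : NormalForm σ P) : ∃ k : ℝ → ℝ, ContDiff ℝ ∞ k ∧ k 0 = deriv D.m₀ 0 ∧
    ∀ᶠ ε in 𝓝 (0 : ℝ), D.m₀ ε = ε * k ε := by
  obtain ⟨m, hm, em⟩ := D.smooth_m₀.exists_contDiff
  obtain ⟨k, hk, hmk⟩ := exists_hadamard hm (ContinuousLinearMap.id ℝ ℝ) 1
  have hm0 : m 0 = 0 := em.self_of_nhds.trans D.m₀_zero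
  have hmk' : ∀ x, m x = x * k x := fun x => by simpa [hm0] using hmk x
  refine ⟨k, hk, ?_, em.mono fun ε hε => hε ▸ hmk' ε⟩
  have h : HasDerivAt (fun x => x * k x) (1 * k 0 + 0 * deriv k 0) 0 :=
    (hasDerivAt_id (0 : ℝ)).mul (hk.differentiable (by simp) 0).hasDerivAt
  rw [← em.deriv_eq, funext hmk', h.deriv]
  simp

/-- A continuous function of `(x, y)` keeps its sign at the origin. -/
theorem eventually_sign {R : Reduction P} {f : ℝ × (ℝ × ℝ) → ℝ} (hf : Continuous f) {κ : ℝ}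
    (h0 : 0 < κ → 0 < f (0, 0)) :
    ∀ᶠ q : ℝ × R3 in 𝓝 (0, 0), 0 < κ → 0 < f (plane (q.1, R.Φ q.1 q.2)) := by
  by_cases hκ : 0 < κ
  · exact (R.tendsto_plane_chart.eventually
      (hf.continuousAt.eventually_const_lt (h0 hκ))).mono fun q hq _ => hq
  · exact .of_forall fun q hq => absurd hq hκ

/-- The bifurcation diagram of a generic unfolding. -/
theorem exists_bifurcation_coordinates (hσ : σ = 1 ∨ σ = -1) (hP : IsLocalPoissonFamily P)
    (D : NormalForm σ P) (h1 : D.GenericSingularity) (h2 : D.GenericUnfolding) :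
    ∃ (Ψ : ℝ → R3 → R3) (Q : ℝ → ℝ),
      IsLocalChartFamily Ψ ∧ SmoothNear Q 0 ∧ Q 0 ≠ 0 ∧
      ∀ᶠ q : ℝ × R3 in 𝓝 (0, 0), ∀ (ε ε' : ℝ) (p : R3), q = (ε, p) → ε' = ε * Q ε →
        (P ε p = 0 ↔
          (Ψ ε p 2 = 0 ∧ Ψ ε p 0 ^ 2 + σ * Ψ ε p 1 ^ 2 - ε' = 0) ∨ Ψ ε p = 0) ∧
        (P ε p = 0 → Ψ ε p ≠ 0 →
          IsV (P ε) p ∧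
          (0 < D.κ₂ → 0 < D.κ₁ → IsNodeV (P ε) p) ∧
          (0 ≤ D.κ₂ → D.κ₁ < 0 → IsSaddleV (P ε) p) ∧
          (D.κ₂ < 0 → IsFocusV (P ε) p) ∧
          (D.κ₂ = 0 → IsNodeV (P ε) p ∨ IsFocusV (P ε) p)) ∧
        (σ = 1 → Ψ ε p = 0 →
          (0 < D.κ₁ → (ε' < 0 → IsSO3 (P ε) p) ∧ (0 < ε' → IsSL2 (P ε) p)) ∧
          (D.κ₁ < 0 → (ε' < 0 → IsSL2 (P ε) p) ∧ (0 < ε' → IsSO3 (P ε) p))) ∧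
        (σ = -1 → Ψ ε p = 0 → ε ≠ 0 → IsSL2 (P ε) p) := by
  have hσ0 : σ ≠ 0 := by rcases hσ with rfl | rfl <;> norm_num
  have hm₁ : D.m₁ 0 ≠ 0 := h1
  have hm₀' : deriv D.m₀ 0 ≠ 0 := left_ne_zero_of_mul h2
  have hl₀ := D.l₀_ne
  obtain ⟨R, hΦ, hA, hB, hC, hC2⟩ := D.exists_reduction
  obtain ⟨a0, ax, ay⟩ := hA.self_of_nhds
  obtain ⟨b0, bx, by'⟩ := hB.self_of_nhds
  obtain ⟨c0, cx, cy, cxx⟩ := hC.self_of_nhds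
  rw [D.m₀_zero] at c0
  have hjac : jac R.A R.B (0, 0) ≠ 0 := by
    have : jac R.A R.B (0, 0) = σ * D.l₀ 0 ^ 2 := by
      change dx R.A (0, 0) * dy R.B (0, 0) - dy R.A (0, 0) * dx R.B (0, 0) = _
      rw [ax, ay, bx, by']
      ring
    rw [this]
    exact mul_ne_zero hσ0 (pow_ne_zero _ hl₀)
  -- the function `h`, whose value at the origin decides on the type of the singular points
  obtain ⟨h, hhs, hh⟩ := R.exists_dC_eq hP a0 b0 (injective_planar R.smooth_A R.smooth_B hjac)
  have hh0 : h (0, 0) = 2 * D.m₁ 0 / D.l₀ 0 := by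
    have e := dx_congr (hh.mono fun q hq => hq.1)
    rw [dx_sub (hhs.mul R.smooth_A) (R.smooth_C.mul R.contDiff_D₁), dx_mul hhs R.smooth_A,
      dx_mul R.smooth_C R.contDiff_D₁] at e
    rw [eq_div_iff hl₀]
    rw [a0, ax, cx, c0, cxx] at e
    linear_combination -e
  -- the new coordinates
  obtain ⟨X, Y, hX, hY, hX0, hY0, hJ, hXY⟩ := exists_morse_coordinates R.smooth_C hσ hm₁
    (hC.mono fun ε hε => ⟨hε.2.1, hε.2.2.1⟩) hC2
  -- the new parameter
  obtain ⟨k, hk, hk0, hmk⟩ := D.exists_m₀_eq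
  have hk0' : k 0 ≠ 0 := hk0 ▸ hm₀'
  have hQs : ContDiff ℝ ∞ fun ε => -k ε / D.m₁ 0 := hk.neg.div_const _
  have hl0s : ContinuousAt D.l₀ 0 := D.smooth_l₀.contDiffAt.continuousAt
  have hfst : Tendsto (fun q : ℝ × R3 => q.1) (𝓝 (0, 0)) (𝓝 0) := continuous_fst.tendsto' _ _ rfl
  have hpl := R.tendsto_plane_chart
  have hl2 : 0 < D.l₀ 0 ^ 2 := by positivity
  have hκ₁ : h (0, 0) * D.l₀ 0 ^ 2 = 2 * D.κ₁ := by
    rw [hh0, κ₁]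
    field_simp
  have hκ₂ : (1 - 4 * h (0, 0)) * D.l₀ 0 ^ 2 = D.κ₂ := by
    rw [κ₂]
    linear_combination -4 * hκ₁
  have hhc := hhs.continuous
  have s1 := eventually_sign (R := R) (f := h) (κ := D.κ₁) hhc fun hκ => by nlinarith
  have s2 := eventually_sign (R := R) (f := fun q => -h q) (κ := -D.κ₁) (by fun_prop)
    fun hκ => by nlinarith
  have s3 := eventually_sign (R := R) (f := fun q => 1 - 4 * h q) (κ := D.κ₂) (by fun_prop)
    fun hκ => by nlinarith
  have s4 := eventually_sign (R := R) (f := fun q => -(1 - 4 * h q)) (κ := -D.κ₂) (by fun_prop)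
    fun hκ => by nlinarith
  simp only [neg_pos] at s2 s4
  have s5 : ∀ᶠ q : ℝ × R3 in 𝓝 (0, 0), 0 < D.l₀ q.1 * D.l₀ 0 :=
    hfst.eventually ((hl0s.mul_const _).eventually_const_lt (by nlinarith))
  have s6 : ∀ᶠ q : ℝ × R3 in 𝓝 (0, 0), k q.1 ≠ 0 :=
    hfst.eventually (hk.continuous.continuousAt.eventually_ne hk0')
  refine ⟨fun ε p => planarMap X Y (fun _ => 1) (ε, R.Φ ε p), fun ε => -k ε / D.m₁ 0,
    R.chart.planar hX hY contDiff_const (hX0 0) (hY0 0) hJ one_ne_zero, hQs.smoothNear _,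
    div_ne_zero (neg_ne_zero.2 hk0') hm₁, ?_⟩
  filter_upwards [R.eventually_eq_zero_iff, R.eventually_jetEquiv_V hh,
    R.eventually_jetEquiv_zero (σ := σ) (l := D.l₀) (m := D.m₀) hA hB (hC.mono fun ε hε => hε.1),
    hpl.eventually (eventually_eq_zero_iff R.smooth_A R.smooth_B hjac
      ((hA.and hB).mono fun ε hε => ⟨hε.1.1, hε.2.1⟩)),
    hpl.eventually (eventually_eq_zero_iff hX hY hJ (.of_forall fun ε => ⟨hX0 ε, hY0 ε⟩)),
    hpl.eventually hXY, hfst.eventually hC, hfst.eventually hmk, s1, s2, s3, s4, s5, s6] with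
    q i1 i2 i3 i4 i5 i6 i7 i8 s1 s2 s3 s4 s5 s6 ε ε' p hq hε'
  subst hq
  simp only at i1 i2 i3 i6 i7 i8 s1 s2 s3 s4 s5 s6
  have hm₀ : D.m₀ ε = -(D.m₁ 0 * ε') := by
    rw [i8, hε']
    field_simp
  have hΨ : planarMap X Y (fun _ => 1) (ε, R.Φ ε p) = 0 ↔
      R.Φ ε p 2 = 0 ∧ (plane (ε, R.Φ ε p)).2 = 0 := by
    rw [← i5]
    constructor
    · intro h0
      exact ⟨by simpa [planarMap] using congrFun h0 2, congrFun h0 0, congrFun h0 1⟩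
    · rintro ⟨z2, z0, z1⟩
      ext i
      fin_cases i
      · exact z0
      · exact z1
      · simpa [planarMap] using z2
  have hΦ0 : planarMap X Y (fun _ => 1) (ε, R.Φ ε p) = 0 → R.Φ ε p = 0 := fun h0 => by
    obtain ⟨z2, z01⟩ := hΨ.1 h0
    ext i
    fin_cases i
    · exact congrArg Prod.fst z01
    · exact congrArg Prod.snd z01
    · exact z2
  have hC' : R.C (plane (ε, R.Φ ε p)) = 0 ↔ planarMap X Y (fun _ => 1) (ε, R.Φ ε p) 0 ^ 2
      + σ * planarMap X Y (fun _ => 1) (ε, R.Φ ε p) 1 ^ 2 - ε' = 0 := by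
    change _ ↔ X (plane (ε, R.Φ ε p)) ^ 2 + σ * Y (plane (ε, R.Φ ε p)) ^ 2 - ε' = 0
    have e : R.C (plane (ε, R.Φ ε p)) = D.m₁ 0 *
        (X (plane (ε, R.Φ ε p)) ^ 2 + σ * Y (plane (ε, R.Φ ε p)) ^ 2 - ε') := by
      rw [i6]
      have : R.C ((plane (ε, R.Φ ε p)).1, 0) = D.m₀ ε := i7.1
      rw [this, hm₀]
      ring
    rw [e, mul_eq_zero, or_iff_right hm₁]
  have hΨ2 : planarMap X Y (fun _ => 1) (ε, R.Φ ε p) 2 = R.Φ ε p 2 := by simp [planarMap]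
  -- the sign of the coefficient `m₀ l₀` of the linear part at the origin of the new coordinates
  have hsgn : D.m₀ ε * D.l₀ ε * D.l₀ 0 ^ 2 = -(ε' * D.κ₁) * (D.l₀ ε * D.l₀ 0) := by
    rw [hm₀, κ₁]
    ring
  have hneg : 0 < ε' * D.κ₁ → D.m₀ ε * D.l₀ ε < 0 := fun h0 =>
    neg_of_mul_neg_left (hsgn ▸ mul_neg_of_neg_of_pos (neg_neg_of_pos h0) s5) hl2.le
  have hpos' : ε' * D.κ₁ < 0 → 0 < D.m₀ ε * D.l₀ ε := fun h0 =>
    pos_of_mul_pos_left (hsgn ▸ mul_pos (neg_pos.2 h0) s5) hl2.le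
  refine ⟨?_, fun hP0 hne => ?_, ?_, ?_⟩
  · rw [i1, i4, hΨ, hΨ2, ← hC']
    exact and_or_left
  · obtain ⟨z2, hz⟩ := i1.1 hP0
    rw [i4] at hz
    have hv : (plane (ε, R.Φ ε p)).2 ≠ 0 := fun hv => hne (hΨ.2 ⟨z2, hv⟩)
    have hj := i2 z2 (hz.resolve_right hv) (i4.not.2 hv)
    refine ⟨isV_of_jetEquiv hj, fun k2 k1 => isNodeV_of_jetEquiv hj (s1 k1) (s3 k2).le,
      fun _ k1 => isSaddleV_of_jetEquiv hj (s2 k1), fun k2 => isFocusV_of_jetEquiv hj (s4 k2),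
      fun k2 => ?_⟩
    have k1 : 0 < D.κ₁ := by
      have : D.κ₂ = D.l₀ 0 ^ 2 - 8 * D.κ₁ := rfl
      nlinarith
    rcases lt_or_ge (1 - 4 * h (plane (ε, R.Φ ε p))) 0 with hd | hd
    · exact Or.inr (isFocusV_of_jetEquiv hj hd)
    · exact Or.inl (isNodeV_of_jetEquiv hj (s1 k1) hd)
  · rintro rfl h0
    have hj := i3 (hΦ0 h0)
    exact ⟨fun k1 => ⟨fun e => isSO3_of_jetEquiv hj (hpos' (mul_neg_of_neg_of_pos e k1)),
        fun e => isSL2_of_jetEquiv_one hj (hneg (mul_pos e k1))⟩,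
      fun k1 => ⟨fun e => isSL2_of_jetEquiv_one hj (hneg (mul_pos_of_neg_of_neg e k1)),
        fun e => isSO3_of_jetEquiv hj (hpos' (mul_neg_of_pos_of_neg e k1))⟩⟩
  · rintro rfl h0 hε
    refine isSL2_of_jetEquiv_neg_one (i3 (hΦ0 h0)) (mul_ne_zero ?_ (left_ne_zero_of_mul s5.ne'))
    rw [i8]
    exact mul_ne_zero hε s6

end NormalForm

end PoissonBif

end

open PoissonBif in
theorem theorem4p2 (σ : ℝ) (hσ : σ = 1 ∨ σ = -1) (P : ℝ → R3 → Bivec)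
    (hP : IsLocalPoissonFamily P) (hN : IsN σ (P 0) 0) :
    Nonempty (NormalForm σ P) ∧
    ∀ D : NormalForm σ P, D.GenericSingularity → D.GenericUnfolding →
      ∃ (Ψ : ℝ → R3 → R3) (Q : ℝ → ℝ),
        IsLocalChartFamily Ψ ∧ SmoothNear Q 0 ∧ Q 0 ≠ 0 ∧
        ∀ᶠ q : ℝ × R3 in 𝓝 (0, 0), ∀ (ε ε' : ℝ) (p : R3), q = (ε, p) → ε' = ε * Q ε →
          -- the set of singular points
          (P ε p = 0 ↔
            (Ψ ε p 2 = 0 ∧ Ψ ε p 0 ^ 2 + σ * Ψ ε p 1 ^ 2 - ε' = 0) ∨ Ψ ε p = 0) ∧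
          -- the singular points other than the origin of the new coordinates
          (P ε p = 0 → Ψ ε p ≠ 0 →
            IsV (P ε) p ∧
            (0 < D.κ₂ → 0 < D.κ₁ → IsNodeV (P ε) p) ∧
            (0 ≤ D.κ₂ → D.κ₁ < 0 → IsSaddleV (P ε) p) ∧
            (D.κ₂ < 0 → IsFocusV (P ε) p) ∧
            (D.κ₂ = 0 → IsNodeV (P ε) p ∨ IsFocusV (P ε) p)) ∧
          -- the origin of the new coordinates, `N⁺` case
          (σ = 1 → Ψ ε p = 0 →
            (0 < D.κ₁ → (ε' < 0 → IsSO3 (P ε) p) ∧ (0 < ε' → IsSL2 (P ε) p)) ∧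
            (D.κ₁ < 0 → (ε' < 0 → IsSL2 (P ε) p) ∧ (0 < ε' → IsSO3 (P ε) p))) ∧
          -- the origin of the new coordinates, `N⁻` case
          (σ = -1 → Ψ ε p = 0 → ε ≠ 0 → IsSL2 (P ε) p) := by
  exact ⟨nonempty_normalForm_of_isN hσ hP hN, fun D h1 h2 =>
    D.exists_bifurcation_coordinates hσ hP h1 h2⟩
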